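/- **Paths.** For a path $Y=(Y_t)_{t\ge0}$ and $\bar x\in\mathbb R$ write $\overline Y_t=\bar x\vee\sup_{0\le s\le t}Y_s$ (running supremum with initial maximum level $\bar x$). Stieltjes integrals $\int_{0^+}^t$ are over $(0,t]$, and $\int_0^\infty$ is over $[0,\infty)$, an integrator $G$ having mass $G_0$ at $0$. **Lévy process.** Let $(\Omega,\mathcal F)$ be a measurable space with a real process $X=(X_t)_{t\ge0}$ all of whose paths are càdlàg without positive jumps, and let $(\mathbb P_{x,\bar x})_{x\in\mathbb R,\,\bar x\ge x}$ be probability measures under which $X$ is one and the same spectrally negative Lévy process (stationary independent increments whose law does not depend on $(x,\bar x)$, and $X$ is not almost surely decreasing in the weak sense) started at $X_0=x$ a.s. Let $\mathcal F_t=\sigma(X_s:s\le t)$ and $\mathcal F_t^+=\bigcap_{s>t}\mathcal F_s$. **Tax rate.** Let $\delta:[0,\infty)\to[0,1)$ be measurable, such that $\delta=\gamma$ on $[0,\epsilon]$ for some $\epsilon>0$ and $\gamma\in[0,1)$, and such that for each $y_0\ge0$ the equation $y'(t)=1-\delta(y(t))$ for a.e. $t\ge0$, $y(0)=y_0$, has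 a unique (locally) absolutely continuous solution $y:[0,\infty)\to[0,\infty)$. **The process.** For $\bar x\ge X_0\vee0$, the tax-reflection transform of $X$ with initial maximum level $\bar x$ is the pair of càdlàg paths $(V^+,K^+)$ with $V^+\ge0$ and $K^+\ge 0$ increasing such that $$V^+_t=X_t+K^+_t-\int_{0^+}^t\delta(V^+_s)\,\mathrm d(\overline{X+K^+})_s\quad(t\ge0),\qquad \int_0^\infty \mathbf 1_{\{V^+_t>0\}}\,\mathrm dK^+_t=0.$$ The natural tax process with minimal bailouts $(V,K)$ is given by $K_0=0$, $K_t=K^+_{t-}$ for $t>0$, and $V_0=V^+_0-K^+_0$, $V_t=V^+_t-(K^+_t-K^+_{t-})$ for $t>0$. On $\{X_0>\bar x\}$, which is null under $\mathbb P_{x,\bar x}$, set $V=K=0$. Let $\overline V$ be the running supremum of $V$ with initial maximum level $\bar x$. **Proposition.** For every $\bar x\ge0$ and every path of $X$ with $X_0\le\bar x$ the pair $(V^+,K^+)$ exists and is unique, and: 1. $(V,K)$ is adapted to $(\mathcal F_t)_{t\ge0}$. 2. The process $(V,\overline V)$, with the measures $\mathbb P_{x,\bar x}$, is a strong Markov process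 in the filtration $(\mathcal F^+_t)_{t\ge0}$ with state space $E=\{(x,\bar x):\bar x\ge x\vee0\}$. That is: it is $E$-valued, adapted to $(\mathcal F^+_t)$ and starts from $(x,\bar x)$ $\mathbb P_{x,\bar x}$-a.s.; its law under $\mathbb P_{x,\bar x}$ depends measurably on $(x,\bar x)\in E$; and for every $(x,\bar x)\in E$ and every $(\mathcal F^+_t)$-stopping time $T$, on $\{T<\infty\}$ the pair $(V_T,\overline V_T)$ is $\mathcal F^+_T$-measurable and the conditional law under $\mathbb P_{x,\bar x}$ of $(V_{T+t},\overline V_{T+t})_{t\ge0}$ given $\mathcal F_T^+$ is the law of $(V,\overline V)$ under $\mathbb P_{V_T,\overline V_T}$. -/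

import Mathlib

open MeasureTheory ProbabilityTheory Filter Set Topology
open scoped NNReal ENNReal

namespace TaxProcess

noncomputable section

/-! ### Paths indexed by `[0, ∞)` -/

/-- A real path on `[0, ∞)` is càdlàg: right-continuous, with (finite) left limits. At `t = 0` the
left neighbourhood filter is trivial, so that the second condition is void there. -/
def IsCadlag (f : ℝ≥0 → ℝ) : Prop :=
  ∀ t, ContinuousWithinAt f (Ici t) t ∧ ∃ l, Tendsto f (𝓝[<] t) (𝓝 l)

/-- A path has no positive jumps: `f t ≤ f (t-)` for all `t > 0`. -/
def NoPositiveJumps (f : ℝ≥0 → ℝ) : Prop :=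
  ∀ t, 0 < t → ∀ l, Tendsto f (𝓝[<] t) (𝓝 l) → f t ≤ l

/-- The running supremum `t ↦ m ∨ sup_{0 ≤ s ≤ t} f s` with initial maximum level `m`. -/
def runningSup (m : ℝ) (f : ℝ≥0 → ℝ) (t : ℝ≥0) : ℝ :=
  max m (⨆ s : Iic t, f s)

open Classical in
/-- The Lebesgue–Stieltjes measure `dG` on `(0, ∞)` of an increasing right-continuous `G`: it gives
mass `G t - G s` to `(s, t]` and no mass to `{0}`. (The zero measure if `G` is not increasing and
right-continuous.) -/
def stieltjes (G : ℝ≥0 → ℝ) : Measure ℝ≥0 :=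
  if h : Monotone G ∧ ∀ t, ContinuousWithinAt G (Ici t) t then
    (StieltjesFunction.mk G h.1 h.2).measure
  else 0

/-- The Lebesgue–Stieltjes measure on `[0, ∞)` of an increasing right-continuous nonnegative `G`,
with the convention `G (0-) = 0`: it gives mass `G 0` to `{0}`. -/
def stieltjesZero (G : ℝ≥0 → ℝ) : Measure ℝ≥0 :=
  stieltjes G + ENNReal.ofReal (G 0) • Measure.dirac 0

/-! ### Tax rates -/

/-- `y` solves `y' = 1 - δ(y)`, `y(0) = y₀` on `[0, ∞)`: it is `[0, ∞)`-valued there, absolutely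
continuous on compact intervals, and satisfies the equation for almost every `t ≥ 0`. -/
structure IsODESolution (δ : ℝ≥0 → ℝ) (y₀ : ℝ) (y : ℝ → ℝ) : Prop where
  initial : y 0 = y₀
  nonneg : ∀ t, 0 ≤ t → 0 ≤ y t
  absCont : ∀ T, 0 ≤ T → AbsolutelyContinuousOnInterval y 0 T
  deriv : ∀ᵐ t ∂(volume.restrict (Ici (0 : ℝ))), HasDerivAt y (1 - δ (y t).toNNReal) t

/-- The standing conditions on the tax rate `δ : [0, ∞) → [0, 1)`. -/
structure IsTaxRate (δ : ℝ≥0 → ℝ) : Prop where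
  measurable : Measurable δ
  mem_Ico : ∀ x, δ x ∈ Ico (0 : ℝ) 1
  ode_unique : ∀ y₀, 0 ≤ y₀ → ∃ y, IsODESolution δ y₀ y ∧
    ∀ z, IsODESolution δ y₀ z → EqOn z y (Ici 0)
  const_near_zero : ∃ ε : ℝ≥0, 0 < ε ∧ ∃ γ ∈ Ico (0 : ℝ) 1, ∀ x ∈ Icc 0 ε, δ x = γ

/-! ### The tax-reflection transform -/

/-- `(V, K)` is a tax-reflection transform of the path `X` with tax rate `δ` and initial maximum
level `m ≥ X 0 ∨ 0`. -/
structure IsTaxReflection (δ : ℝ≥0 → ℝ) (m : ℝ) (X V K : ℝ≥0 → ℝ) : Prop where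
  level : max (X 0) 0 ≤ m
  cadlag_V : IsCadlag V
  cadlag_K : IsCadlag K
  nonneg_V : ∀ t, 0 ≤ V t
  nonneg_K : ∀ t, 0 ≤ K t
  monotone_K : Monotone K
  tax : ∀ t, V t = X t + K t -
    ∫ s in Ioc 0 t, δ (V s).toNNReal ∂(stieltjes (runningSup m (fun u => X u + K u)))
  compl : ∫⁻ t, indicator {t | 0 < V t} 1 t ∂(stieltjesZero K) = 0

open Classical in
/-- The tax-reflection transform `(V⁺, K⁺)` of the path `X` (the pair `(0, 0)` if there is none). -/
def taxReflection (δ : ℝ≥0 → ℝ) (m : ℝ) (X : ℝ≥0 → ℝ) : (ℝ≥0 → ℝ) × (ℝ≥0 → ℝ) :=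
  if h : ∃ VK : (ℝ≥0 → ℝ) × (ℝ≥0 → ℝ), IsTaxReflection δ m X VK.1 VK.2 then h.choose else (0, 0)

/-! ### The natural tax process with minimal bailouts -/

variable {Ω : Type*}

/-- `V⁺`, for the initial maximum level `m`. -/
def VPlus (δ : ℝ≥0 → ℝ) (X : ℝ≥0 → Ω → ℝ) (m : ℝ) (t : ℝ≥0) (ω : Ω) : ℝ :=
  (taxReflection δ m (fun s => X s ω)).1 t

/-- `K⁺`, for the initial maximum level `m`. -/
def KPlus (δ : ℝ≥0 → ℝ) (X : ℝ≥0 → Ω → ℝ) (m : ℝ) (t : ℝ≥0) (ω : Ω) : ℝ :=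
  (taxReflection δ m (fun s => X s ω)).2 t

/-- The cumulative bailouts: `K_0 = 0` and `K_t = K⁺_{t-}` for `t > 0`. -/
def bailout (δ : ℝ≥0 → ℝ) (X : ℝ≥0 → Ω → ℝ) (m : ℝ) (t : ℝ≥0) (ω : Ω) : ℝ :=
  if t = 0 then 0 else Function.leftLim (fun s => KPlus δ X m s ω) t

/-- The natural tax process: `V_0 = V⁺_0 - K⁺_0` and `V_t = V⁺_t - (K⁺_t - K⁺_{t-})` for `t > 0`. -/
def taxProcess (δ : ℝ≥0 → ℝ) (X : ℝ≥0 → Ω → ℝ) (m : ℝ) (t : ℝ≥0) (ω : Ω) : ℝ :=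
  if t = 0 then VPlus δ X m 0 ω - KPlus δ X m 0 ω
  else VPlus δ X m t ω - (KPlus δ X m t ω - Function.leftLim (fun s => KPlus δ X m s ω) t)

/-- The bivariate process `(V, V̄)`, for the starting point `p = (x, x̄)`; `V̄` is the running
supremum of `V` with initial maximum level `x̄`. -/
def taxPair (δ : ℝ≥0 → ℝ) (X : ℝ≥0 → Ω → ℝ) (p : ℝ × ℝ) (t : ℝ≥0) (ω : Ω) : ℝ × ℝ :=
  (taxProcess δ X p.2 t ω, runningSup p.2 (fun s => taxProcess δ X p.2 s ω) t)

/-- The state space `{(x, x̄) : x̄ ≥ x ∨ 0}` of `(V, V̄)`. -/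
def stateSpace : Set (ℝ × ℝ) := {p | max p.1 0 ≤ p.2}

/-! ### Spectrally negative Lévy processes -/

/-- `X` is a spectrally negative Lévy process under `μ` (with an arbitrary initial value). -/
structure IsSpectrallyNegativeLevy [MeasurableSpace Ω] (X : ℝ≥0 → Ω → ℝ) (μ : Measure Ω) :
    Prop where
  isProbabilityMeasure : IsProbabilityMeasure μ
  measurable : ∀ t, Measurable (X t)
  cadlag : ∀ ω, IsCadlag (fun t => X t ω)
  noPositiveJumps : ∀ ω, NoPositiveJumps (fun t => X t ω)
  indepIncrements : HasIndepIncrements X μ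
  stationaryIncrements : ∀ s t, μ.map (X (s + t) - X s) = μ.map (X t - X 0)
  not_decreasing : ¬ ∀ᵐ ω ∂μ, Antitone (fun t => X t ω)

/-- `P (x, x̄)`, `x ≤ x̄`, is the family of laws under which `X` is one and the same spectrally
negative Lévy process (the law of the increments does not depend on `(x, x̄)`), started at `x`. -/
structure IsSpectrallyNegativeLevyFamily [MeasurableSpace Ω] (X : ℝ≥0 → Ω → ℝ)
    (P : ℝ × ℝ → Measure Ω) : Prop where
  levy : ∀ p : ℝ × ℝ, p.1 ≤ p.2 → IsSpectrallyNegativeLevy X (P p)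
  initial : ∀ p : ℝ × ℝ, p.1 ≤ p.2 → ∀ᵐ ω ∂(P p), X 0 ω = p.1
  law_increment : ∀ p q : ℝ × ℝ, p.1 ≤ p.2 → q.1 ≤ q.2 → ∀ t,
    (P p).map (X t - X 0) = (P q).map (X t - X 0)

/-! ### Strong Markov processes -/

/-- For every starting point `p` in the state space `E`, let `Z p` be a process on `Ω`, observed
under the measure `P p`. The family is (time-homogeneous) strong Markov in the filtration `𝓖` if
`Z p` is `E`-valued, adapted and starts from `p` under `P p`, if the law of `Z p` under `P p`
depends measurably on `p`, and if for every stopping time `T`, on the event `{T < ∞}`, the state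
`Z_T` is `𝓖_T`-measurable and the conditional law of `(Z_{T+t})_{t ≥ 0}` given `𝓖_T` is the law of
the process started from `Z_T`. -/
structure IsStrongMarkov {S : Type*} [MeasurableSpace S] {mΩ : MeasurableSpace Ω}
    (𝓖 : Filtration ℝ≥0 mΩ) (E : Set S) (Z : S → ℝ≥0 → Ω → S) (P : S → Measure Ω) : Prop where
  mem_state : ∀ p ∈ E, ∀ t ω, Z p t ω ∈ E
  adapted : ∀ p ∈ E, ∀ t, Measurable[𝓖 t] (Z p t)
  initial : ∀ p ∈ E, ∀ᵐ ω ∂(P p), Z p 0 ω = p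
  measurable_law : ∀ B : Set (ℝ≥0 → S), MeasurableSet B →
    Measurable (fun p : E => P p {ω | (fun t => Z p t ω) ∈ B})
  measurable_stopped : ∀ p ∈ E, ∀ (T : Ω → WithTop ℝ≥0) (hT : IsStoppingTime 𝓖 T),
    ∀ C : Set S, MeasurableSet C →
      MeasurableSet[hT.measurableSpace] {ω | T ω ≠ ⊤ ∧ stoppedValue (Z p) T ω ∈ C}
  strong_markov : ∀ p ∈ E, ∀ (T : Ω → WithTop ℝ≥0) (hT : IsStoppingTime 𝓖 T),
    ∀ G : Set Ω, MeasurableSet[hT.measurableSpace] G → (∀ ω ∈ G, T ω ≠ ⊤) →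
    ∀ B : Set (ℝ≥0 → S), MeasurableSet B →
      P p (G ∩ {ω | (fun t => Z p ((T ω).untopA + t) ω) ∈ B}) =
        ∫⁻ ω in G, P (stoppedValue (Z p) T ω)
          {ω' | (fun t => Z (stoppedValue (Z p) T ω) t ω') ∈ B} ∂(P p)

end

end TaxProcess

namespace TaxProcess

/-! ### Induction along the half-line -/

/-! The proof trades the integral equation for a fixed-point system without integrals. Let `S` be
the running supremum of `X + K⁺` from level `m`. It is continuous: at a jump `V⁺` would be positive,
so `K⁺` would not jump there and `X` would have to jump upwards. Moreover `dS` charges only times at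
which `X + K⁺ = S`, and there `V⁺` equals `S` minus the tax paid. As a function of `S`, this untaxed
part therefore solves `y' = 1 - δ(y)`, `y(0) = m`, so the tax is `Φ(S)` with `Φ(s) = s - taxFlow δ m
(s - m)` (`sup_sub_tax_eq_taxFlow`). Complementarity makes `K⁺` the Skorokhod reflection term of `X
- Φ(S)`. Thus the transform is equivalent to the system `S = m ∨ sup (X + K)`, `K = 0 ∨ sup (Φ(S) -
X)` (`IsTaxReflection.isTaxSystem`, `IsTaxSystem.isTaxReflection`).

Existence is by monotone iteration from `K = 0`; the iterates stay bounded because `s - Φ(s)` is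
increasing and positive above `m` (`isTaxSystem_lim`). For uniqueness, right after any time either
`K` is frozen (if `V⁺ > 0`) or `S` is frozen (if `X + K < S`), and then each determines the other.
Both can fail only at `S = m = 0`, where constancy of `δ` near zero makes the system a contraction
(`IsTaxSystem.unique`).

The iterates are built from countable suprema of the path, whence adaptedness and measurable
dependence on the starting point. By uniqueness and the semigroup property of the flow, the process
after time `T` is the same functional of `(V_T, V̄_T)` and of the increments of `X` after `T`
(`taxPath_shift`). Those increments are independent of the past of a stopping time and have a fixed
law (`map_restrict_increments`), so Fubini yields the strong Markov property. -/

theorem nnreal_induction {p : ℝ≥0 → Prop} (zero : p 0)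
    (right : ∀ t, p t → ∃ b, t < b ∧ ∀ s, t < s → s < b → p s)
    (left : ∀ t, 0 < t → (∀ s < t, p s) → p t) (t : ℝ≥0) : p t := by
  by_contra hpt
  set A : Set ℝ≥0 := {s | ¬ p s} with hA
  have hne : A.Nonempty := ⟨t, hpt⟩
  have hlt : ∀ s < sInf A, p s := fun s hs => by
    by_contra h
    exact absurd (csInf_le (OrderBot.bddBelow _) h) (not_le.2 hs)
  have hinf : p (sInf A) := by
    rcases eq_zero_or_pos (sInf A) with h | h
    · rwa [h]
    · exact left _ h hlt
  obtain ⟨b, hb, hbs⟩ := right _ hinf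
  obtain ⟨a, haA, hab⟩ := exists_lt_of_csInf_lt hne hb
  rcases (csInf_le (OrderBot.bddBelow _) haA : sInf A ≤ a).eq_or_lt with h | h
  · exact haA (h ▸ hinf)
  · exact haA (hbs a h hab)

/-! ### Right-continuous paths -/

theorem exists_forall_Ico {p : ℝ≥0 → Prop} {t : ℝ≥0} (h : ∀ᶠ s in 𝓝[≥] t, p s) :
    ∃ b, t < b ∧ ∀ s, t ≤ s → s < b → p s := by
  obtain ⟨b, hb, hsub⟩ := (mem_nhdsGE_iff_exists_Ico_subset' (lt_add_one t)).1 h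
  exact ⟨b, hb, fun s h1 h2 => hsub ⟨h1, h2⟩⟩

theorem exists_forall_Ioo {p : ℝ≥0 → Prop} {t : ℝ≥0} (ht : 0 < t) (h : ∀ᶠ s in 𝓝[<] t, p s) :
    ∃ a, a < t ∧ ∀ s, a < s → s < t → p s := by
  obtain ⟨b, hb, hsub⟩ := (mem_nhdsLT_iff_exists_Ioo_subset' ht).1 h
  exact ⟨b, hb, fun s h1 h2 => hsub ⟨h1, h2⟩⟩

/-- A path all of whose initial segments are bounded above. -/
def LocallyBddAbove (f : ℝ≥0 → ℝ) : Prop := ∀ t, BddAbove (f '' Iic t)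

theorem locallyBddAbove_iff {f : ℝ≥0 → ℝ} :
    LocallyBddAbove f ↔ ∀ t, ∃ C, ∀ s ≤ t, f s ≤ C := by
  refine forall_congr' fun t => ⟨fun ⟨C, hC⟩ => ⟨C, fun s hs => hC ⟨s, hs, rfl⟩⟩,
    fun ⟨C, hC⟩ => ⟨C, ?_⟩⟩
  rintro _ ⟨s, hs, rfl⟩
  exact hC s hs

theorem LocallyBddAbove.add {f g : ℝ≥0 → ℝ} (hf : LocallyBddAbove f) (hg : LocallyBddAbove g) :
    LocallyBddAbove (fun t => f t + g t) := by
  rw [locallyBddAbove_iff] at *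
  intro t
  obtain ⟨C, hC⟩ := hf t
  obtain ⟨D, hD⟩ := hg t
  exact ⟨C + D, fun s hs => add_le_add (hC s hs) (hD s hs)⟩

theorem _root_.Monotone.locallyBddAbove {f : ℝ≥0 → ℝ} (hf : Monotone f) : LocallyBddAbove f :=
  locallyBddAbove_iff.2 fun t => ⟨f t, fun _ hs => hf hs⟩

theorem IsCadlag.locallyBddAbove {f : ℝ≥0 → ℝ} (hf : IsCadlag f) : LocallyBddAbove f := by
  rw [locallyBddAbove_iff]
  suffices H : ∀ t, ∃ C, ∀ s < t, f s ≤ C by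
    intro t
    obtain ⟨C, hC⟩ := H (t + 1)
    exact ⟨C, fun s hs => hC s (hs.trans_lt (lt_add_one t))⟩
  refine nnreal_induction ⟨0, fun s hs => absurd hs not_lt_zero⟩ ?_ ?_
  · rintro t ⟨C, hC⟩
    obtain ⟨b, hb, hfb⟩ := exists_forall_Ico
      ((hf t).1.eventually (Iio_mem_nhds (lt_add_one (f t))))
    refine ⟨b, hb, fun s _ hs => ⟨max C (f t + 1), fun u hu => ?_⟩⟩
    rcases lt_or_ge u t with h | h
    · exact (hC u h).trans (le_max_left _ _)
    · exact (hfb u h (hu.trans hs)).le.trans (le_max_right _ _)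
  · intro t ht h
    obtain ⟨l, hl⟩ := (hf t).2
    obtain ⟨a, hat, ha⟩ := exists_forall_Ioo ht (hl.eventually (Iio_mem_nhds (lt_add_one l)))
    obtain ⟨a', haa', ha't⟩ := exists_between hat
    obtain ⟨C, hC⟩ := h a' ha't
    refine ⟨max C (l + 1), fun u hu => ?_⟩
    rcases lt_or_ge u a' with h | h
    · exact (hC u h).trans (le_max_left _ _)
    · exact (ha u (haa'.trans_le h) hu).le.trans (le_max_right _ _)

theorem IsCadlag.add {f g : ℝ≥0 → ℝ} (hf : IsCadlag f) (hg : IsCadlag g) :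
    IsCadlag (fun t => f t + g t) := fun t => by
  obtain ⟨l, hl⟩ := (hf t).2
  obtain ⟨l', hl'⟩ := (hg t).2
  exact ⟨(hf t).1.add (hg t).1, l + l', hl.add hl'⟩

theorem IsCadlag.neg {f : ℝ≥0 → ℝ} (hf : IsCadlag f) : IsCadlag (fun t => -f t) := fun t => by
  obtain ⟨l, hl⟩ := (hf t).2
  exact ⟨(hf t).1.neg, -l, hl.neg⟩

theorem IsCadlag.sub {f g : ℝ≥0 → ℝ} (hf : IsCadlag f) (hg : IsCadlag g) :
    IsCadlag (fun t => f t - g t) := by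
  simpa only [sub_eq_add_neg] using hf.add hg.neg

theorem isCadlag_const (c : ℝ) : IsCadlag (fun _ => c) := fun _ =>
  ⟨continuousWithinAt_const, c, tendsto_const_nhds⟩

theorem IsCadlag.comp_continuous {f : ℝ≥0 → ℝ} {φ : ℝ → ℝ} (hf : IsCadlag f) (hφ : Continuous φ) :
    IsCadlag (fun t => φ (f t)) := fun t => by
  obtain ⟨l, hl⟩ := (hf t).2
  exact ⟨hφ.continuousAt.comp_continuousWithinAt (hf t).1, φ l, (hφ.tendsto l).comp hl⟩

theorem _root_.Monotone.exists_tendsto_nhdsLT {f : ℝ≥0 → ℝ} (hf : Monotone f) (t : ℝ≥0) :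
    ∃ l, Tendsto f (𝓝[<] t) (𝓝 l) :=
  ⟨_, hf.tendsto_leftLim t⟩

theorem isCadlag_of_monotone {f : ℝ≥0 → ℝ} (hf : Monotone f)
    (hc : ∀ t, ContinuousWithinAt f (Ici t) t) : IsCadlag f := fun t =>
  ⟨hc t, hf.exists_tendsto_nhdsLT t⟩

open Classical in
/-- The left limits of a path, with the convention that the path vanishes before time `0`. -/
noncomputable def leftPart (f : ℝ≥0 → ℝ) (t : ℝ≥0) : ℝ :=
  if t = 0 then 0 else Function.leftLim f t

theorem leftPart_zero (f : ℝ≥0 → ℝ) : leftPart f 0 = 0 := if_pos rfl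

theorem leftPart_of_pos (f : ℝ≥0 → ℝ) {t : ℝ≥0} (ht : 0 < t) :
    leftPart f t = Function.leftLim f t := if_neg ht.ne'

theorem le_leftPart {f : ℝ≥0 → ℝ} (hf : Monotone f) {s t : ℝ≥0} (hst : s < t) :
    f s ≤ leftPart f t := by
  rw [leftPart_of_pos f (zero_le.trans_lt hst)]
  exact hf.le_leftLim hst

theorem leftPart_le {f : ℝ≥0 → ℝ} (hf : Monotone f) (h0 : 0 ≤ f 0) (t : ℝ≥0) :
    leftPart f t ≤ f t := by
  rcases eq_zero_or_pos t with rfl | ht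
  · rwa [leftPart_zero]
  · rw [leftPart_of_pos f ht]
    exact hf.leftLim_le le_rfl

theorem leftPart_nonneg {f : ℝ≥0 → ℝ} (hf : Monotone f) (h0 : 0 ≤ f 0) (t : ℝ≥0) :
    0 ≤ leftPart f t := by
  rcases eq_zero_or_pos t with rfl | ht
  · rw [leftPart_zero]
  · exact h0.trans (le_leftPart hf ht)

/-- The smallest multiple of `1 / (n + 1)` strictly larger than `t`. -/
noncomputable def gridAbove (n : ℕ) (t : ℝ≥0) : ℝ≥0 := (⌊t * (n + 1)⌋₊ + 1) / (n + 1)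

theorem lt_gridAbove (n : ℕ) (t : ℝ≥0) : t < gridAbove n t := by
  rw [gridAbove, lt_div_iff₀ (by positivity)]
  exact Nat.lt_floor_add_one _

theorem gridAbove_le (n : ℕ) (t : ℝ≥0) : gridAbove n t ≤ t + 1 / (n + 1) := by
  rw [gridAbove, add_div]
  gcongr
  rw [div_le_iff₀ (by positivity)]
  exact Nat.floor_le zero_le

theorem tendsto_gridAbove (t : ℝ≥0) : Tendsto (fun n => gridAbove n t) atTop (𝓝[>] t) := by
  refine tendsto_nhdsWithin_iff.2 ⟨?_, .of_forall fun n => lt_gridAbove n t⟩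
  refine tendsto_of_tendsto_of_tendsto_of_le_of_le tendsto_const_nhds ?_
    (fun n => (lt_gridAbove n t).le) (fun n => gridAbove_le n t)
  have : Tendsto (fun n : ℕ => (1 : ℝ≥0) / (n + 1)) atTop (𝓝 0) :=
    tendsto_one_div_add_atTop_nhds_zero_nat
  simpa using tendsto_const_nhds.add this

/-- Sampling at the next grid point factors through an integer-valued floor, and these samples
converge by right-continuity. -/
theorem measurable_of_rightContinuous {f : ℝ≥0 → ℝ}
    (hf : ∀ t, ContinuousWithinAt f (Ici t) t) : Measurable f := by
  refine measurable_of_tendsto_metrizable (f := fun n t => f (gridAbove n t)) (fun n => ?_)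
    (tendsto_pi_nhds.2 fun t => ((hf t).mono Ioi_subset_Ici_self).tendsto.comp
      (tendsto_gridAbove t))
  have : Measurable fun t : ℝ≥0 => ⌊t * (n + 1)⌋₊ :=
    Nat.measurable_floor.comp (measurable_id.mul_const _)
  exact (measurable_from_nat (f := fun k : ℕ => f ((k + 1) / (n + 1)))).comp this

/-! ### Running suprema -/

theorem le_runningSup_level (m : ℝ) (f : ℝ≥0 → ℝ) (t : ℝ≥0) : m ≤ runningSup m f t :=
  le_max_left _ _

theorem le_runningSup {f : ℝ≥0 → ℝ} (hf : LocallyBddAbove f) (m : ℝ) {s t : ℝ≥0} (hst : s ≤ t) :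
    f s ≤ runningSup m f t := by
  refine le_max_of_le_right (le_ciSup (f := fun s : Iic t => f s) ?_ ⟨s, hst⟩)
  have := hf t
  rwa [image_eq_range] at this

theorem runningSup_le {m c : ℝ} {f : ℝ≥0 → ℝ} {t : ℝ≥0} (hm : m ≤ c) (hf : ∀ s ≤ t, f s ≤ c) :
    runningSup m f t ≤ c := by
  have : Nonempty (Iic t) := ⟨⟨t, mem_Iic.2 le_rfl⟩⟩
  exact max_le hm (ciSup_le fun s => hf s s.2)

theorem runningSup_congr {m : ℝ} {f g : ℝ≥0 → ℝ} {t : ℝ≥0} (h : ∀ s ≤ t, f s = g s) :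
    runningSup m f t = runningSup m g t := by
  have : (fun s : Iic t => f s) = fun s : Iic t => g s := funext fun s => h s s.2
  simp only [runningSup, this]

theorem monotone_runningSup {f : ℝ≥0 → ℝ} (hf : LocallyBddAbove f) (m : ℝ) :
    Monotone (runningSup m f) := fun _ _ hst =>
  runningSup_le (le_runningSup_level _ _ _) fun _ hu => le_runningSup hf m (hu.trans hst)

theorem runningSup_mono {m : ℝ} {f g : ℝ≥0 → ℝ} (hg : LocallyBddAbove g) {t : ℝ≥0}
    (h : ∀ s ≤ t, f s ≤ g s) : runningSup m f t ≤ runningSup m g t :=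
  runningSup_le (le_runningSup_level _ _ _) fun s hs => (h s hs).trans (le_runningSup hg m hs)

theorem runningSup_le_add {m d : ℝ} {f g : ℝ≥0 → ℝ} (hg : LocallyBddAbove g) {t : ℝ≥0}
    (hd : 0 ≤ d) (h : ∀ s ≤ t, f s ≤ g s + d) : runningSup m f t ≤ runningSup m g t + d :=
  runningSup_le (by linarith [le_runningSup_level m g t]) fun s hs =>
    (h s hs).trans (by linarith [le_runningSup hg m hs])

/-- Splitting the running supremum at an intermediate time. -/
theorem runningSup_le_max {m c : ℝ} {f : ℝ≥0 → ℝ} (hf : LocallyBddAbove f) {s t : ℝ≥0}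
    (h : ∀ u, s ≤ u → u ≤ t → f u ≤ c) : runningSup m f t ≤ max (runningSup m f s) c := by
  refine runningSup_le ((le_runningSup_level _ _ _).trans (le_max_left _ _)) fun u hu => ?_
  rcases le_total u s with hus | hus
  · exact (le_runningSup hf m hus).trans (le_max_left _ _)
  · exact (h u hus hu).trans (le_max_right _ _)

theorem lt_runningSup {m c : ℝ} {f : ℝ≥0 → ℝ} {t : ℝ≥0} (h : c < runningSup m f t) (hm : m ≤ c) :
    ∃ s ≤ t, c < f s := by
  by_contra! H
  exact absurd (runningSup_le hm H) (not_le.2 h)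

theorem rightContinuous_runningSup {f : ℝ≥0 → ℝ} (hb : LocallyBddAbove f)
    (hf : ∀ t, ContinuousWithinAt f (Ici t) t) (m : ℝ) (t : ℝ≥0) :
    ContinuousWithinAt (runningSup m f) (Ici t) t := by
  refine tendsto_order.2 ⟨fun a ha => ?_, fun a ha => ?_⟩
  · filter_upwards [self_mem_nhdsWithin] with s hs
    exact ha.trans_le (monotone_runningSup hb m hs)
  · obtain ⟨c, hc, hca⟩ := exists_between ha
    obtain ⟨b, hb', hfb⟩ := exists_forall_Ico ((hf t).eventually
      (Iio_mem_nhds ((le_runningSup hb m (le_refl t)).trans_lt hc)))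
    filter_upwards [Ico_mem_nhdsGE hb'] with s hs
    refine (runningSup_le_max hb (s := t) (c := c) fun u h1 h2 => ?_).trans_lt (max_lt ha hca)
    exact (hfb u h1 (h2.trans_lt hs.2)).le

theorem isCadlag_runningSup {f : ℝ≥0 → ℝ} (hf : IsCadlag f) (m : ℝ) : IsCadlag (runningSup m f) :=
  isCadlag_of_monotone (monotone_runningSup hf.locallyBddAbove m)
    (rightContinuous_runningSup hf.locallyBddAbove (fun t => (hf t).1) m)

/-- The running supremum is locally constant to the right as long as the path is below it. -/
theorem exists_runningSup_eq {f : ℝ≥0 → ℝ} (hb : LocallyBddAbove f) {m : ℝ} {t : ℝ≥0}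
    (hf : ContinuousWithinAt f (Ici t) t) (ht : f t < runningSup m f t) :
    ∃ b, t < b ∧ ∀ s, t ≤ s → s < b → runningSup m f s = runningSup m f t := by
  obtain ⟨b, hb', hbs⟩ := exists_forall_Ico (hf.eventually (Iio_mem_nhds ht))
  refine ⟨b, hb', fun s h1 h2 => le_antisymm ?_ (monotone_runningSup hb m h1)⟩
  simpa using runningSup_le_max hb (m := m) (s := t) (c := runningSup m f t) fun u hu1 hu2 =>
    (hbs u hu1 (hu2.trans_lt h2)).le

theorem exists_denseSeq_mem_Ioo {s t : ℝ≥0} (h : s < t) :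
    ∃ k, TopologicalSpace.denseSeq ℝ≥0 k ∈ Ioo s t :=
  (TopologicalSpace.denseRange_denseSeq ℝ≥0).exists_mem_open isOpen_Ioo (nonempty_Ioo.2 h)

/-- The running supremum of a right-continuous path is a countable supremum. -/
theorem runningSup_eq_max_iSup {f : ℝ≥0 → ℝ} (hb : LocallyBddAbove f)
    (hf : ∀ t, ContinuousWithinAt f (Ici t) t) (m : ℝ) (t : ℝ≥0) :
    runningSup m f t = max m (⨆ k, f (min (TopologicalSpace.denseSeq ℝ≥0 k) t)) := by
  have hbd : BddAbove (range fun k => f (min (TopologicalSpace.denseSeq ℝ≥0 k) t)) := by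
    refine ⟨runningSup m f t, ?_⟩
    rintro _ ⟨k, rfl⟩
    exact le_runningSup hb m (min_le_right _ _)
  refine le_antisymm (runningSup_le (le_max_left _ _) fun s hs => le_max_of_le_right ?_)
    (max_le (le_runningSup_level _ _ _) (ciSup_le fun k => le_runningSup hb m (min_le_right _ _)))
  rcases hs.eq_or_lt with rfl | hst
  · obtain ⟨k, hk⟩ := exists_denseSeq_mem_Ioo (lt_add_one s)
    simpa [min_eq_right hk.1.le] using le_ciSup hbd k
  · refine le_of_forall_lt fun c hc => ?_
    obtain ⟨b, hb', hfb⟩ := exists_forall_Ico ((hf s).eventually (Ioi_mem_nhds hc))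
    obtain ⟨k, hk⟩ := exists_denseSeq_mem_Ioo (lt_min hb' hst)
    have hkt := hk.2.trans_le (min_le_right _ _)
    have := le_ciSup hbd k
    rw [min_eq_left hkt.le] at this
    exact (hfb _ hk.1.le (hk.2.trans_le (min_le_left _ _))).trans_le this

end TaxProcess

namespace TaxProcess

/-! ### The fixed-point system behind the tax-reflection transform -/

/-- The properties of `Φ`, the cumulative tax as a function of the running supremum of the
reflected process, on which the well-posedness of the fixed-point system depends. -/
structure IsTaxFunction (m : ℝ) (Φ : ℝ → ℝ) : Prop where
  level_nonneg : 0 ≤ m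
  mono : Monotone Φ
  mono_sub : Monotone fun s => s - Φ s
  map_level : Φ m = 0
  lt_self : ∀ s, m < s → Φ s < s
  contract : 0 < m ∨ ∃ ε, 0 < ε ∧ ∃ γ, 0 ≤ γ ∧ γ < 1 ∧
    ∀ s s', m ≤ s → s ≤ s' → s' ≤ m + ε → Φ s' - Φ s ≤ γ * (s' - s)

theorem IsTaxFunction.continuous {m : ℝ} {Φ : ℝ → ℝ} (hΦ : IsTaxFunction m Φ) :
    Continuous Φ := by
  refine (LipschitzWith.of_dist_le_mul (K := 1) fun s s' => ?_).continuous
  have key : ∀ s s', s ≤ s' → |Φ s - Φ s'| ≤ |s - s'| := fun s s' h => by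
    have h1 := hΦ.mono h
    have h2 : s - Φ s ≤ s' - Φ s' := hΦ.mono_sub h
    rw [abs_of_nonpos (by linarith), abs_of_nonpos (by linarith)]
    linarith
  rw [NNReal.coe_one, one_mul, Real.dist_eq, Real.dist_eq]
  rcases le_total s s' with h | h
  · exact key s s' h
  · rw [abs_sub_comm, abs_sub_comm s]
    exact key s' s h

/-- `S` is the running supremum of the reflected path `X + K`, and `K` is the cumulative
reflection at zero of the taxed path `X - Φ (S)`. -/
structure IsTaxSystem (Φ : ℝ → ℝ) (m : ℝ) (X S K : ℝ≥0 → ℝ) : Prop where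
  mono_K : Monotone K
  S_eq : ∀ t, S t = runningSup m (fun u => X u + K u) t
  K_eq : ∀ t, K t = runningSup 0 (fun u => Φ (S u) - X u) t

/-! ### Regularity and uniqueness of solutions of the system. -/

namespace IsTaxSystem

variable {Φ : ℝ → ℝ} {m : ℝ} {X S K S' K' : ℝ≥0 → ℝ}

theorem locallyBddAbove_add (h : IsTaxSystem Φ m X S K) (hX : IsCadlag X) :
    LocallyBddAbove (fun u => X u + K u) :=
  hX.locallyBddAbove.add h.mono_K.locallyBddAbove

theorem mono_S (h : IsTaxSystem Φ m X S K) (hX : IsCadlag X) : Monotone S := fun s t hst => by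
  rw [h.S_eq, h.S_eq]
  exact monotone_runningSup (h.locallyBddAbove_add hX) m hst

theorem locallyBddAbove_sub (h : IsTaxSystem Φ m X S K) (hΦ : IsTaxFunction m Φ)
    (hX : IsCadlag X) : LocallyBddAbove (fun u => Φ (S u) - X u) := by
  simpa only [sub_eq_add_neg, Function.comp_apply] using
    (hΦ.mono.comp (h.mono_S hX)).locallyBddAbove.add hX.neg.locallyBddAbove

theorem K_nonneg (h : IsTaxSystem Φ m X S K) (t : ℝ≥0) : 0 ≤ K t := by
  rw [h.K_eq]
  exact le_runningSup_level _ _ _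

theorem level_le_S (h : IsTaxSystem Φ m X S K) (t : ℝ≥0) : m ≤ S t := by
  rw [h.S_eq]
  exact le_runningSup_level _ _ _

theorem add_le_S (h : IsTaxSystem Φ m X S K) (hX : IsCadlag X) (t : ℝ≥0) : X t + K t ≤ S t := by
  rw [h.S_eq]
  exact le_runningSup (h.locallyBddAbove_add hX) m le_rfl

theorem sub_le_K (h : IsTaxSystem Φ m X S K) (hΦ : IsTaxFunction m Φ) (hX : IsCadlag X)
    (t : ℝ≥0) : Φ (S t) - X t ≤ K t := by
  rw [h.K_eq]
  exact le_runningSup (h.locallyBddAbove_sub hΦ hX) 0 le_rfl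

theorem S_le_max (h : IsTaxSystem Φ m X S K) (hX : IsCadlag X) {c : ℝ} {s t : ℝ≥0}
    (hc : ∀ u, s ≤ u → u ≤ t → X u + K u ≤ c) : S t ≤ max (S s) c := by
  rw [h.S_eq t, h.S_eq s]
  exact runningSup_le_max (h.locallyBddAbove_add hX) hc

theorem K_le_max (h : IsTaxSystem Φ m X S K) (hΦ : IsTaxFunction m Φ) (hX : IsCadlag X) {c : ℝ}
    {s t : ℝ≥0} (hc : ∀ u, s ≤ u → u ≤ t → Φ (S u) - X u ≤ c) : K t ≤ max (K s) c := by
  rw [h.K_eq t, h.K_eq s]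
  exact runningSup_le_max (h.locallyBddAbove_sub hΦ hX) hc

/-- The running supremum does not jump. -/
theorem S_le_of_forall_lt (h : IsTaxSystem Φ m X S K) (hΦ : IsTaxFunction m Φ) (hX : IsCadlag X)
    (hJ : NoPositiveJumps X) (h0 : X 0 ≤ m) {t : ℝ≥0} {c : ℝ} (hm : m ≤ c)
    (hc : ∀ s < t, S s ≤ c) : S t ≤ c := by
  by_contra! hlt
  -- An overshoot of `c` can only be produced at time `t` itself.
  have hS : S t ≤ X t + K t := by
    have : S t ≤ max c (X t + K t) := by
      rw [h.S_eq t]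
      refine runningSup_le (hm.trans (le_max_left _ _)) fun s hs => ?_
      rcases hs.eq_or_lt with rfl | hst
      · exact le_max_right _ _
      · exact ((h.add_le_S hX s).trans (hc s hst)).trans (le_max_left _ _)
    rcases le_max_iff.1 this with h1 | h1
    · exact absurd h1 (not_le.2 hlt)
    · exact h1
  -- Before `t`, `X + K ≤ S ≤ c`. As `K` increases, this gives `K s + X (t-) ≤ c`, and `X t ≤ X
  -- (t-)`.
  have hK : ∀ s < t, K s ≤ c - X t := by
    intro s hst
    have ht : 0 < t := (zero_le (a := s)).trans_lt hst
    obtain ⟨l, hl⟩ := (hX t).2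
    have : (𝓝[<] t).NeBot := nhdsLT_neBot_of_exists_lt ⟨s, hst⟩
    have h1 : K s + l ≤ c := by
      refine le_of_tendsto (hl.const_add (K s)) ?_
      filter_upwards [Ioo_mem_nhdsLT hst] with u hu
      have := h.add_le_S hX u
      linarith [hc u hu.2, h.mono_K hu.1.le]
    linarith [hJ t ht l hl]
  have h0' : 0 ≤ c - X t := by
    rcases eq_zero_or_pos t with rfl | ht
    · linarith
    · exact (h.K_nonneg 0).trans (hK 0 ht)
  have hKt : K t ≤ max (c - X t) (Φ (S t) - X t) := by
    rw [h.K_eq t]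
    refine runningSup_le (h0'.trans (le_max_left _ _)) fun s hs => ?_
    rcases hs.eq_or_lt with rfl | hst
    · exact le_max_right _ _
    · exact ((h.sub_le_K hΦ hX s).trans (hK s hst)).trans (le_max_left _ _)
  -- Either `K t ≤ c - X t`, so that `S t ≤ c`, or `K t ≤ Φ (S t) - X t`, so that `S t ≤ Φ (S t) < S
  -- t`.
  have hlt' := hΦ.lt_self _ (hm.trans_lt hlt)
  rcases le_max_iff.1 hKt with h1 | h1 <;> linarith

theorem S_zero (h : IsTaxSystem Φ m X S K) (hΦ : IsTaxFunction m Φ) (hX : IsCadlag X)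
    (hJ : NoPositiveJumps X) (h0 : X 0 ≤ m) : S 0 = m :=
  le_antisymm (h.S_le_of_forall_lt hΦ hX hJ h0 le_rfl fun _ hs => absurd hs not_lt_zero)
    (h.level_le_S 0)

/-- In the limit, splitting the suprema at `t` gives `σ ≤ S t ∨ (X t + k)` and `k ≤ K t ∨ (Φ σ - X
t)` for the right limits. A jump `σ > S t` would force `σ ≤ X t + K t ≤ S t` or `σ ≤ Φ σ`, both
impossible; once `σ = S t`, the second bound gives `k ≤ K t`. -/
theorem rightLim_eq (h : IsTaxSystem Φ m X S K) (hΦ : IsTaxFunction m Φ) (hX : IsCadlag X)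
    (t : ℝ≥0) : Function.rightLim S t = S t ∧ Function.rightLim K t = K t := by
  set σ := Function.rightLim S t
  set k := Function.rightLim K t
  have hSσ : Tendsto S (𝓝[>] t) (𝓝 σ) := (h.mono_S hX).tendsto_rightLim t
  have hKk : Tendsto K (𝓝[>] t) (𝓝 k) := h.mono_K.tendsto_rightLim t
  have hσ : S t ≤ σ := (h.mono_S hX).le_rightLim le_rfl
  have hk : K t ≤ k := h.mono_K.le_rightLim le_rfl
  have h1 : σ ≤ max (S t) (X t + k) := by
    refine le_of_forall_pos_le_add fun ε hε => ?_
    obtain ⟨b, hb, hXb⟩ := exists_forall_Ico ((hX t).1.eventually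
      (Iio_mem_nhds (lt_add_of_pos_right (X t) hε)))
    have : σ ≤ max (S t) (X t + ε + k) := by
      refine le_of_tendsto_of_tendsto hSσ (tendsto_const_nhds.max (hKk.const_add (X t + ε))) ?_
      filter_upwards [Ioo_mem_nhdsGT hb] with s hs
      refine h.S_le_max hX fun u h1 h2 => ?_
      linarith [hXb u h1 (h2.trans_lt hs.2), h.mono_K h2]
    refine this.trans (max_le ?_ ?_)
    · linarith [le_max_left (S t) (X t + k)]
    · linarith [le_max_right (S t) (X t + k)]
  have h2 : k ≤ max (K t) (Φ σ - X t) := by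
    refine le_of_forall_pos_le_add fun ε hε => ?_
    obtain ⟨b, hb, hXb⟩ := exists_forall_Ico ((hX t).1.eventually
      (Ioi_mem_nhds (sub_lt_self (X t) hε)))
    have : k ≤ max (K t) (Φ σ - (X t - ε)) := by
      refine le_of_tendsto_of_tendsto hKk (tendsto_const_nhds.max
        (((hΦ.continuous.tendsto σ).comp hSσ).sub_const (X t - ε))) ?_
      filter_upwards [Ioo_mem_nhdsGT hb] with s hs
      refine h.K_le_max hΦ hX fun u h1 h2 => ?_
      have := hXb u h1 (h2.trans_lt hs.2)
      have := hΦ.mono (h.mono_S hX h2)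
      simp only [Function.comp_apply]
      linarith
    refine this.trans (max_le ?_ ?_)
    · linarith [le_max_left (K t) (Φ σ - X t)]
    · linarith [le_max_right (K t) (Φ σ - X t)]
  have h3 := h.add_le_S hX t
  have h4 := h.sub_le_K hΦ hX t
  have h5 := h.level_le_S t
  rcases hσ.eq_or_lt with h6 | h6
  · refine ⟨h6.symm, le_antisymm ?_ hk⟩
    rw [← h6] at h2
    exact h2.trans (max_le le_rfl h4)
  · have h7 := hΦ.lt_self σ (h5.trans_lt h6)
    rcases le_max_iff.1 h1 with h8 | h8
    · linarith
    · rcases le_max_iff.1 h2 with h9 | h9 <;> linarith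

theorem rightContinuous_S (h : IsTaxSystem Φ m X S K) (hΦ : IsTaxFunction m Φ) (hX : IsCadlag X)
    (t : ℝ≥0) : ContinuousWithinAt S (Ici t) t :=
  continuousWithinAt_Ioi_iff_Ici.1
    ((h.mono_S hX).continuousWithinAt_Ioi_iff_rightLim_eq.2 (h.rightLim_eq hΦ hX t).1)

theorem rightContinuous_K (h : IsTaxSystem Φ m X S K) (hΦ : IsTaxFunction m Φ) (hX : IsCadlag X)
    (t : ℝ≥0) : ContinuousWithinAt K (Ici t) t :=
  continuousWithinAt_Ioi_iff_Ici.1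
    (h.mono_K.continuousWithinAt_Ioi_iff_rightLim_eq.2 (h.rightLim_eq hΦ hX t).2)

theorem isCadlag_K (h : IsTaxSystem Φ m X S K) (hΦ : IsTaxFunction m Φ) (hX : IsCadlag X) :
    IsCadlag K :=
  isCadlag_of_monotone h.mono_K (h.rightContinuous_K hΦ hX)

theorem isCadlag_S (h : IsTaxSystem Φ m X S K) (hΦ : IsTaxFunction m Φ) (hX : IsCadlag X) :
    IsCadlag S :=
  isCadlag_of_monotone (h.mono_S hX) (h.rightContinuous_S hΦ hX)

theorem continuous_S (h : IsTaxSystem Φ m X S K) (hΦ : IsTaxFunction m Φ) (hX : IsCadlag X)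
    (hJ : NoPositiveJumps X) (h0 : X 0 ≤ m) : Continuous S := by
  refine continuous_iff_continuousAt.2 fun t => continuousAt_iff_continuous_left'_right'.2
    ⟨?_, (h.rightContinuous_S hΦ hX t).mono Ioi_subset_Ici_self⟩
  rw [(h.mono_S hX).continuousWithinAt_Iio_iff_leftLim_eq]
  rcases eq_zero_or_pos t with rfl | ht
  · exact leftLim_eq_of_eq_bot _ (by simp)
  · have : (𝓝[<] t).NeBot := nhdsLT_neBot_of_exists_lt ⟨0, ht⟩
    refine le_antisymm ((h.mono_S hX).leftLim_le le_rfl) ?_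
    exact h.S_le_of_forall_lt hΦ hX hJ h0 ((h.level_le_S 0).trans ((h.mono_S hX).le_leftLim ht))
      fun s hs => (h.mono_S hX).le_leftLim hs

/-- `K` is locally constant to the right as long as the taxed reflected path is positive. -/
theorem exists_K_eq (h : IsTaxSystem Φ m X S K) (hΦ : IsTaxFunction m Φ) (hX : IsCadlag X)
    {t : ℝ≥0} (ht : 0 < X t + K t - Φ (S t)) : ∃ b, t < b ∧ ∀ s, t ≤ s → s < b → K s = K t := by
  obtain ⟨c, hc0, hc⟩ := exists_between ht
  have hcont : ContinuousWithinAt (fun s => X s + K s - Φ (S s)) (Ici t) t :=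
    ((hX t).1.add (h.rightContinuous_K hΦ hX t)).sub
      (hΦ.continuous.continuousAt.comp_continuousWithinAt (h.rightContinuous_S hΦ hX t))
  obtain ⟨b, hb, hbs⟩ := exists_forall_Ico (hcont.eventually (Ioi_mem_nhds hc))
  refine ⟨b, hb, fun s h1 h2 => le_antisymm ?_ (h.mono_K h1)⟩
  have : K s ≤ max (K t) (K s - c) := h.K_le_max hΦ hX fun u hu1 hu2 => by
    have := hbs u hu1 (hu2.trans_lt h2)
    linarith [h.mono_K hu2]
  rcases le_max_iff.1 this with h3 | h3
  · exact h3
  · linarith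

/-- `S` is locally constant to the right as long as the reflected path is below it. -/
theorem exists_S_eq (h : IsTaxSystem Φ m X S K) (hΦ : IsTaxFunction m Φ) (hX : IsCadlag X)
    {t : ℝ≥0} (ht : X t + K t < S t) : ∃ b, t < b ∧ ∀ s, t ≤ s → s < b → S s = S t := by
  rw [h.S_eq] at ht
  obtain ⟨b, hb, hbs⟩ := exists_runningSup_eq (h.locallyBddAbove_add hX)
    ((hX t).1.add (h.rightContinuous_K hΦ hX t)) ht
  exact ⟨b, hb, fun s h1 h2 => by rw [h.S_eq, h.S_eq, hbs s h1 h2]⟩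

/-- Splitting strictly before `s` leaves a bailout made at time `s` to the second term. This is the
form needed to restart the system from the state before that bailout. -/
theorem K_le_max_leftPart (h : IsTaxSystem Φ m X S K) (hΦ : IsTaxFunction m Φ) (hX : IsCadlag X)
    {c : ℝ} {s t : ℝ≥0} (hc : ∀ u, s ≤ u → u ≤ t → Φ (S u) - X u ≤ c) :
    K t ≤ max (leftPart K s) c := by
  rw [h.K_eq t]
  refine runningSup_le ((leftPart_nonneg h.mono_K (h.K_nonneg 0) s).trans (le_max_left _ _))
    fun u hu => ?_
  rcases lt_or_ge u s with hus | hus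
  · exact ((h.sub_le_K hΦ hX u).trans (le_leftPart h.mono_K hus)).trans (le_max_left _ _)
  · exact (hc u hus hu).trans (le_max_right _ _)

/-- `K` does not jump when the taxed reflected path is positive. -/
theorem leftPart_eq (h : IsTaxSystem Φ m X S K) (hΦ : IsTaxFunction m Φ) (hX : IsCadlag X)
    {t : ℝ≥0} (ht : 0 < X t + K t - Φ (S t)) : leftPart K t = K t := by
  refine le_antisymm (leftPart_le h.mono_K (h.K_nonneg 0) t) ?_
  have : K t ≤ max (leftPart K t) (Φ (S t) - X t) := h.K_le_max_leftPart hΦ hX fun u h1 h2 => by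
    rw [le_antisymm h1 h2]
  rcases le_max_iff.1 this with h1 | h1
  · exact h1
  · linarith

theorem S_congr (h : IsTaxSystem Φ m X S K) (h' : IsTaxSystem Φ m X S' K') {t : ℝ≥0}
    (hK : ∀ s ≤ t, K s = K' s) : S t = S' t := by
  rw [h.S_eq, h'.S_eq]
  exact runningSup_congr fun s hs => by rw [hK s hs]

theorem K_congr (h : IsTaxSystem Φ m X S K) (h' : IsTaxSystem Φ m X S' K') {t : ℝ≥0}
    (hS : ∀ s ≤ t, S s = S' s) : K t = K' t := by
  rw [h.K_eq, h'.K_eq]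
  exact runningSup_congr fun s hs => by rw [hS s hs]

/-- One turn of the loop: an excess `d` of `K` raises the supremum by at most `d`, hence the tax,
and with it the next `K`, by at most `γ * d`. The bound on `S t` keeps both suprema where the
contraction estimate is available; where `S u ≤ S' u`, monotonicity of `Φ` suffices. -/
theorem K_le_add_of_K_le_add (h : IsTaxSystem Φ m X S K) (h' : IsTaxSystem Φ m X S' K')
    (hΦ : IsTaxFunction m Φ) (hX : IsCadlag X) {ε γ d : ℝ} (hγ : 0 ≤ γ)
    (hcon : ∀ s s', m ≤ s → s ≤ s' → s' ≤ m + ε → Φ s' - Φ s ≤ γ * (s' - s)) {t : ℝ≥0}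
    (hS : S t ≤ m + ε) (hd : 0 ≤ d) (hK : ∀ s ≤ t, K s ≤ K' s + d) :
    ∀ s ≤ t, K s ≤ K' s + γ * d := by
  intro s hs
  rw [h.K_eq, h'.K_eq]
  refine runningSup_le_add (h'.locallyBddAbove_sub hΦ hX) (by positivity) fun u hu => ?_
  have hSu : S u ≤ S' u + d := by
    rw [h.S_eq, h'.S_eq]
    exact runningSup_le_add (h'.locallyBddAbove_add hX) hd fun v hv => by
      linarith [hK v (hv.trans (hu.trans hs))]
  rcases le_total (S u) (S' u) with h1 | h1
  · have := hΦ.mono h1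
    nlinarith
  · have := hcon _ _ (h'.level_le_S u) h1 ((h.mono_S hX (hu.trans hs)).trans hS)
    nlinarith

/-- The fixed-point system has at most one solution. -/
theorem unique (h : IsTaxSystem Φ m X S K) (h' : IsTaxSystem Φ m X S' K')
    (hΦ : IsTaxFunction m Φ) (hX : IsCadlag X) (hJ : NoPositiveJumps X) (h0 : X 0 ≤ m) :
    S = S' ∧ K = K' := by
  suffices H : ∀ t, ∀ s < t, S s = S' s ∧ K s = K' s from
    ⟨funext fun t => (H _ t (lt_add_one t)).1, funext fun t => (H _ t (lt_add_one t)).2⟩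
  refine nnreal_induction (fun s hs => absurd hs not_lt_zero) (fun t ht => ?_)
    fun t _ ht s hs => ?_
  swap
  · obtain ⟨r, hsr, hrt⟩ := exists_between hs
    exact ht r hrt s hsr
  -- Agreement passes to `t` because `S` has no jumps; `K`, which may jump, then follows from `S`.
  have hSt : S t = S' t := le_antisymm
    (h.S_le_of_forall_lt hΦ hX hJ h0 (h'.level_le_S t) fun s hs =>
      (ht s hs).1.le.trans (h'.mono_S hX hs.le))
    (h'.S_le_of_forall_lt hΦ hX hJ h0 (h.level_le_S t) fun s hs =>
      (ht s hs).1.ge.trans (h.mono_S hX hs.le))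
  have hKt : K t = K' t := h.K_congr h' fun s hs => by
    rcases hs.eq_or_lt with rfl | hs
    · exact hSt
    · exact (ht s hs).1
  -- Each component up to a given time determines the other, so agreement of either one just after
  -- `t` is enough.
  suffices H : ∃ b, t < b ∧ ((∀ s, t ≤ s → s < b → K s = K' s) ∨
      ∀ s, t ≤ s → s < b → S s = S' s) by
    obtain ⟨b, hb, H⟩ := H
    refine ⟨b, hb, fun r _ hrb s hsr => ?_⟩
    have hsb := hsr.trans hrb
    rcases H with H | H
    · have HK : ∀ u < b, K u = K' u := fun u hu => by
        rcases lt_or_ge u t with hut | hut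
        · exact (ht u hut).2
        · exact H u hut hu
      exact ⟨h.S_congr h' fun u hu => HK u (hu.trans_lt hsb), HK s hsb⟩
    · have HS : ∀ u < b, S u = S' u := fun u hu => by
        rcases lt_or_ge u t with hut | hut
        · exact (ht u hut).1
        · exact H u hut hu
      exact ⟨HS s hsb, h.K_congr h' fun u hu => HS u (hu.trans_lt hsb)⟩
  -- The quantity compared with zero is `V = X + K - Φ(S)`. If `V > 0`, both versions of `K` are
  -- frozen after `t`. If `V = 0`, then `X + K = Φ(S)`, which is below `S` when `S > m`, and also
  -- when `S = m > 0` since `Φ m = 0`; both versions of `S` are then frozen. The contraction covers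
  -- what remains.
  rcases (sub_nonneg.2 (h.sub_le_K hΦ hX t)).eq_or_lt with hV | hV
  · rcases (h.level_le_S t).eq_or_lt with hm | hm
    · rcases hΦ.contract with hpos | ⟨ε, hε, γ, hγ0, hγ1, hcon⟩
      · have hlt : X t + K t < S t := by
          have := hΦ.map_level
          rw [hm] at this hpos
          linarith
        obtain ⟨b, hb, hb'⟩ := h.exists_S_eq hΦ hX hlt
        obtain ⟨c, hc, hc'⟩ := h'.exists_S_eq hΦ hX (t := t) (by rwa [← hSt, ← hKt])
        refine ⟨min b c, lt_min hb hc, .inr fun s h1 h2 => ?_⟩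
        rw [hb' s h1 (h2.trans_le (min_le_left _ _)), hc' s h1 (h2.trans_le (min_le_right _ _)),
          hSt]
      · obtain ⟨b, hb, hb'⟩ := exists_forall_Ico ((h.rightContinuous_S hΦ hX t).eventually
          (Iio_mem_nhds (show S t < m + ε by linarith)))
        obtain ⟨c, hc, hc'⟩ := exists_forall_Ico ((h'.rightContinuous_S hΦ hX t).eventually
          (Iio_mem_nhds (show S' t < m + ε by linarith)))
        refine ⟨min b c, lt_min hb hc, .inl fun s h1 h2 => ?_⟩
        have hs1 := (hb' s h1 (h2.trans_le (min_le_left _ _))).le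
        have hs2 := (hc' s h1 (h2.trans_le (min_le_right _ _))).le
        -- A crude bound on the difference of `K` and `K'` up to `s`; `n` turns of the contraction
        -- shrink it to `γ ^ n * C`.
        set C := K s + K' s
        have hC : 0 ≤ C := add_nonneg (h.K_nonneg s) (h'.K_nonneg s)
        have key : ∀ n : ℕ, (∀ u ≤ s, K u ≤ K' u + γ ^ n * C) ∧
            ∀ u ≤ s, K' u ≤ K u + γ ^ n * C := by
          intro n
          induction n with
          | zero =>
            refine ⟨fun u hu => ?_, fun u hu => ?_⟩
            · linarith [h.mono_K hu, h'.K_nonneg u, h'.K_nonneg s]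
            · linarith [h'.mono_K hu, h.K_nonneg u, h.K_nonneg s]
          | succ n ih =>
            simp only [pow_succ', mul_assoc]
            exact ⟨h.K_le_add_of_K_le_add h' hΦ hX hγ0 hcon hs1 (by positivity) ih.1,
              h'.K_le_add_of_K_le_add h hΦ hX hγ0 hcon hs2 (by positivity) ih.2⟩
        have hlim : ∀ a : ℝ, Tendsto (fun n : ℕ => a + γ ^ n * C) atTop (𝓝 a) := fun a => by
          simpa using ((tendsto_pow_atTop_nhds_zero_of_lt_one hγ0 hγ1).mul_const C).const_add a
        exact le_antisymm (ge_of_tendsto' (hlim _) fun n => (key n).1 s le_rfl)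
          (ge_of_tendsto' (hlim _) fun n => (key n).2 s le_rfl)
    · have hlt : X t + K t < S t := by linarith [hΦ.lt_self _ hm]
      obtain ⟨b, hb, hb'⟩ := h.exists_S_eq hΦ hX hlt
      obtain ⟨c, hc, hc'⟩ := h'.exists_S_eq hΦ hX (t := t) (by rwa [← hSt, ← hKt])
      refine ⟨min b c, lt_min hb hc, .inr fun s h1 h2 => ?_⟩
      rw [hb' s h1 (h2.trans_le (min_le_left _ _)), hc' s h1 (h2.trans_le (min_le_right _ _)),
        hSt]
  · have hpos : 0 < X t + K t - Φ (S t) := by linarith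
    obtain ⟨b, hb, hb'⟩ := h.exists_K_eq hΦ hX hpos
    obtain ⟨c, hc, hc'⟩ := h'.exists_K_eq hΦ hX (t := t) (by rwa [← hSt, ← hKt])
    refine ⟨min b c, lt_min hb hc, .inl fun s h1 h2 => ?_⟩
    rw [hb' s h1 (h2.trans_le (min_le_left _ _)), hc' s h1 (h2.trans_le (min_le_right _ _)), hKt]

end IsTaxSystem

end TaxProcess

namespace TaxProcess

/-! ### Existence of a solution by monotone iteration -/

/-- The iterates, started from `0`, of the map that sends a reflection term `K` to the reflection
term of the path taxed according to the running supremum of `X + K`. -/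
noncomputable def reflIter (Φ : ℝ → ℝ) (m : ℝ) (X : ℝ≥0 → ℝ) : ℕ → ℝ≥0 → ℝ
  | 0 => fun _ => 0
  | n + 1 => runningSup 0 fun u => Φ (runningSup m (fun v => X v + reflIter Φ m X n v) u) - X u

/-- The running supremum of the path reflected by the `n`-th iterate. -/
noncomputable def supIter (Φ : ℝ → ℝ) (m : ℝ) (X : ℝ≥0 → ℝ) (n : ℕ) : ℝ≥0 → ℝ :=
  runningSup m fun v => X v + reflIter Φ m X n v

/-- The reflection term of the minimal solution of the fixed-point system. -/
noncomputable def reflLim (Φ : ℝ → ℝ) (m : ℝ) (X : ℝ≥0 → ℝ) (t : ℝ≥0) : ℝ :=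
  ⨆ n, reflIter Φ m X n t

/-- The running supremum of the minimal solution of the fixed-point system. -/
noncomputable def supLim (Φ : ℝ → ℝ) (m : ℝ) (X : ℝ≥0 → ℝ) (t : ℝ≥0) : ℝ :=
  ⨆ n, supIter Φ m X n t

section Iteration

variable {Φ : ℝ → ℝ} {m : ℝ} {X : ℝ≥0 → ℝ}

theorem isCadlag_reflIter (hΦ : IsTaxFunction m Φ) (hX : IsCadlag X) :
    ∀ n, IsCadlag (reflIter Φ m X n)
  | 0 => isCadlag_const 0
  | n + 1 => isCadlag_runningSup (((isCadlag_runningSup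
      (hX.add (isCadlag_reflIter hΦ hX n)) m).comp_continuous hΦ.continuous).sub hX) 0

theorem isCadlag_supIter (hΦ : IsTaxFunction m Φ) (hX : IsCadlag X) (n : ℕ) :
    IsCadlag (supIter Φ m X n) :=
  isCadlag_runningSup (hX.add (isCadlag_reflIter hΦ hX n)) m

theorem isCadlag_taxed_sub (hΦ : IsTaxFunction m Φ) (hX : IsCadlag X) (n : ℕ) :
    IsCadlag fun u => Φ (supIter Φ m X n u) - X u :=
  ((isCadlag_supIter hΦ hX n).comp_continuous hΦ.continuous).sub hX

theorem reflIter_succ (n : ℕ) : reflIter Φ m X (n + 1) =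
    runningSup 0 fun u => Φ (supIter Φ m X n u) - X u := rfl

theorem reflIter_nonneg (n : ℕ) (t : ℝ≥0) : 0 ≤ reflIter Φ m X n t := by
  cases n with
  | zero => exact le_rfl
  | succ n => exact le_runningSup_level _ _ _

theorem monotone_reflIter_time (hΦ : IsTaxFunction m Φ) (hX : IsCadlag X) (n : ℕ) :
    Monotone (reflIter Φ m X n) := by
  cases n with
  | zero => exact fun _ _ _ => le_rfl
  | succ n => exact monotone_runningSup (isCadlag_taxed_sub hΦ hX n).locallyBddAbove 0

theorem supIter_le_of_reflIter_le (hΦ : IsTaxFunction m Φ) (hX : IsCadlag X) {n k : ℕ}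
    (h : ∀ t, reflIter Φ m X n t ≤ reflIter Φ m X k t) (t : ℝ≥0) :
    supIter Φ m X n t ≤ supIter Φ m X k t :=
  runningSup_mono (hX.add (isCadlag_reflIter hΦ hX k)).locallyBddAbove fun s _ => by
    linarith [h s]

theorem reflIter_le_succ (hΦ : IsTaxFunction m Φ) (hX : IsCadlag X) :
    ∀ n t, reflIter Φ m X n t ≤ reflIter Φ m X (n + 1) t
  | 0, t => le_runningSup_level _ _ _
  | n + 1, t => runningSup_mono (isCadlag_taxed_sub hΦ hX (n + 1)).locallyBddAbove fun s _ => by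
      have := hΦ.mono (supIter_le_of_reflIter_le hΦ hX (reflIter_le_succ hΦ hX n) s)
      change Φ (supIter Φ m X n s) - X s ≤ _
      linarith

theorem monotone_supIter (hΦ : IsTaxFunction m Φ) (hX : IsCadlag X) (t : ℝ≥0) :
    Monotone fun n => supIter Φ m X n t :=
  monotone_nat_of_le_succ fun n =>
    supIter_le_of_reflIter_le hΦ hX (reflIter_le_succ hΦ hX n) t

/-- A bound on the iterates before time `a` extends to one before time `b` if the path oscillates
little on `[a, b)`. -/
theorem iterates_bounded_step (hΦ : IsTaxFunction m Φ) (hX : IsCadlag X) {a b : ℝ≥0} {κ σ x₀ : ℝ}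
    (hσ : m + 1 ≤ σ) (hκ : 0 ≤ κ)
    (h : ∀ n, ∀ s < a, reflIter Φ m X n s ≤ κ ∧ supIter Φ m X n s ≤ σ)
    (hosc : ∀ s, a ≤ s → s < b → |X s - x₀| ≤ (m + 1 - Φ (m + 1)) / 2) :
    ∃ κ' σ', m + 1 ≤ σ' ∧ 0 ≤ κ' ∧
      ∀ n, ∀ s < b, reflIter Φ m X n s ≤ κ' ∧ supIter Φ m X n s ≤ σ' := by
  -- With `η` half the gap between `m + 1` and `Φ (m + 1)`, the bounds `(κ', σ')` reproduce
  -- themselves: `K ≤ κ'` gives `X + K ≤ x₀ + η + κ' ≤ σ'`, and `S ≤ σ'` gives `Φ(S) - X ≤ Φ σ' - x₀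
  -- + η ≤ κ'`. The inequality `x₀ + η + κ' ≤ σ'` uses that the gap is still at least `2η` at `σ'`.
  set η := (m + 1 - Φ (m + 1)) / 2 with hη
  set σ' := max σ (x₀ + η + κ)
  set κ' := max κ (Φ σ' - x₀ + η)
  have hσσ' : σ ≤ σ' := le_max_left _ _
  have hκκ' : κ ≤ κ' := le_max_left _ _
  have hgap : m + 1 - Φ (m + 1) ≤ σ' - Φ σ' := hΦ.mono_sub (hσ.trans hσσ')
  have hκ'σ' : x₀ + η + κ' ≤ σ' := by
    rcases max_choice κ (Φ σ' - x₀ + η) with hc | hc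
    · rw [show κ' = κ from hc]
      exact le_max_right _ _
    · rw [show κ' = _ from hc]
      linarith
  have hS : ∀ n, (∀ s < b, reflIter Φ m X n s ≤ κ') → ∀ s < b, supIter Φ m X n s ≤ σ' := by
    intro n hn s hs
    refine runningSup_le (by linarith) fun u hu => ?_
    rcases lt_or_ge u a with hua | hua
    · exact ((le_runningSup (hX.add (isCadlag_reflIter hΦ hX n)).locallyBddAbove m
        (le_refl u)).trans (h n u hua).2).trans hσσ'
    · linarith [hn u (hu.trans_lt hs), (abs_le.1 (hosc u hua (hu.trans_lt hs))).2]
  have hK : ∀ n, ∀ s < b, reflIter Φ m X n s ≤ κ' := by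
    intro n
    induction n with
    | zero => exact fun s _ => hκ.trans hκκ'
    | succ n ih =>
      intro s hs
      rw [reflIter_succ]
      refine runningSup_le (hκ.trans hκκ') fun u hu => ?_
      rcases lt_or_ge u a with hua | hua
      · exact ((le_runningSup (isCadlag_taxed_sub hΦ hX n).locallyBddAbove 0
          (le_refl u)).trans (h (n + 1) u hua).1).trans hκκ'
      · have h1 := hΦ.mono (hS n ih u (hu.trans_lt hs))
        have h2 : Φ σ' - x₀ + η ≤ κ' := le_max_right _ _
        linarith [(abs_le.1 (hosc u hua (hu.trans_lt hs))).1]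
  exact ⟨κ', σ', hσ.trans hσσ', hκ.trans hκκ', fun n s hs => ⟨hK n s hs, hS n (hK n) s hs⟩⟩

theorem iterates_bounded (hΦ : IsTaxFunction m Φ) (hX : IsCadlag X) (t : ℝ≥0) :
    ∃ κ σ, m + 1 ≤ σ ∧ 0 ≤ κ ∧
      ∀ n, ∀ s < t, reflIter Φ m X n s ≤ κ ∧ supIter Φ m X n s ≤ σ := by
  have hη : 0 < (m + 1 - Φ (m + 1)) / 2 := by
    linarith [hΦ.lt_self (m + 1) (lt_add_one m)]
  induction t using nnreal_induction with
  | zero => exact ⟨0, m + 1, le_rfl, le_rfl, fun n s hs => absurd hs not_lt_zero⟩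
  | right t ih =>
    obtain ⟨κ, σ, hσ, hκ, h⟩ := ih
    obtain ⟨b, hb, hXb⟩ := exists_forall_Ico ((hX t).1.eventually
      (Metric.closedBall_mem_nhds (X t) hη))
    refine ⟨b, hb, fun s _ hs => iterates_bounded_step hΦ hX hσ hκ h (x₀ := X t) fun u h1 h2 => ?_⟩
    exact hXb u h1 (h2.trans hs)
  | left t ht ih =>
    obtain ⟨l, hl⟩ := (hX t).2
    obtain ⟨a, hat, hXa⟩ := exists_forall_Ioo ht (hl.eventually (Metric.closedBall_mem_nhds l hη))
    obtain ⟨a', haa', ha't⟩ := exists_between hat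
    obtain ⟨κ, σ, hσ, hκ, h⟩ := ih a' ha't
    exact iterates_bounded_step hΦ hX hσ hκ h (x₀ := l) fun u h1 h2 =>
      hXa u (haa'.trans_le h1) h2

theorem bddAbove_reflIter (hΦ : IsTaxFunction m Φ) (hX : IsCadlag X) (t : ℝ≥0) :
    BddAbove (range fun n => reflIter Φ m X n t) := by
  obtain ⟨κ, σ, -, -, h⟩ := iterates_bounded hΦ hX (t + 1)
  exact ⟨κ, by rintro _ ⟨n, rfl⟩; exact (h n t (lt_add_one t)).1⟩

theorem bddAbove_supIter (hΦ : IsTaxFunction m Φ) (hX : IsCadlag X) (t : ℝ≥0) :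
    BddAbove (range fun n => supIter Φ m X n t) := by
  obtain ⟨κ, σ, -, -, h⟩ := iterates_bounded hΦ hX (t + 1)
  exact ⟨σ, by rintro _ ⟨n, rfl⟩; exact (h n t (lt_add_one t)).2⟩

/-- The limit of the iterates solves the fixed-point system. -/
theorem isTaxSystem_lim (hΦ : IsTaxFunction m Φ) (hX : IsCadlag X) :
    IsTaxSystem Φ m X (supLim Φ m X) (reflLim Φ m X) := by
  have hKb := bddAbove_reflIter hΦ hX
  have hSb := bddAbove_supIter hΦ hX
  have hKle : ∀ n t, reflIter Φ m X n t ≤ reflLim Φ m X t := fun n t => le_ciSup (hKb t) n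
  have hSle : ∀ n t, supIter Φ m X n t ≤ supLim Φ m X t := fun n t => le_ciSup (hSb t) n
  have hKmono : Monotone (reflLim Φ m X) := fun s t hst =>
    ciSup_mono (hKb t) fun n => monotone_reflIter_time hΦ hX n hst
  have hbdd : LocallyBddAbove fun u => X u + reflLim Φ m X u :=
    hX.locallyBddAbove.add hKmono.locallyBddAbove
  have hS : ∀ t, supLim Φ m X t = runningSup m (fun u => X u + reflLim Φ m X u) t := by
    intro t
    refine le_antisymm (ciSup_le fun n => runningSup_mono hbdd fun s _ => by linarith [hKle n s])
      (runningSup_le ((le_runningSup_level _ _ _).trans (hSle 0 t)) fun s hs => ?_)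
    have : reflLim Φ m X s ≤ supLim Φ m X t - X s := ciSup_le fun n => by
      have := (le_runningSup (hX.add (isCadlag_reflIter hΦ hX n)).locallyBddAbove m hs).trans
        (hSle n t)
      linarith
    linarith
  have hSmono : Monotone (supLim Φ m X) := fun s t hst => by
    rw [hS, hS]
    exact monotone_runningSup hbdd m hst
  have hbdd' : LocallyBddAbove fun u => Φ (supLim Φ m X u) - X u := by
    simpa only [sub_eq_add_neg, Function.comp_apply] using
      (hΦ.mono.comp hSmono).locallyBddAbove.add hX.neg.locallyBddAbove
  refine ⟨hKmono, hS, fun t => le_antisymm (ciSup_le fun n => ?_) (runningSup_le ?_ fun s hs => ?_)⟩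
  · cases n with
    | zero => exact le_runningSup_level _ _ _
    | succ n =>
      refine runningSup_mono hbdd' fun s _ => ?_
      have := hΦ.mono (hSle n s)
      change Φ (supIter Φ m X n s) - X s ≤ _
      linarith
  · exact (reflIter_nonneg 0 t).trans (hKle 0 t)
  -- A monotone limit of suprema is a supremum of limits; continuity of `Φ` carries the limit
  -- through the tax.
  · have hlim : Tendsto (fun n => Φ (supIter Φ m X n s) - X s) atTop
        (𝓝 (Φ (supLim Φ m X s) - X s)) :=
      ((hΦ.continuous.tendsto _).comp
        (tendsto_atTop_ciSup (monotone_supIter hΦ hX s) (hSb s))).sub_const _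
    refine le_of_tendsto' hlim fun n => ?_
    exact (le_runningSup (isCadlag_taxed_sub hΦ hX n).locallyBddAbove 0 hs).trans (hKle (n + 1) t)

end Iteration

end TaxProcess

namespace TaxProcess

/-! ### The flow of the tax equation -/

/-- The right-hand side `1 - δ` of the tax equation. -/
def netRate (δ : ℝ≥0 → ℝ) (u : ℝ) : ℝ := 1 - δ u.toNNReal

open Classical in
/-- The solution at time `t` of `y' = 1 - δ(y)`, `y(0) = m`. Negative arguments are replaced by
zero. -/
noncomputable def taxFlow (δ : ℝ≥0 → ℝ) (m t : ℝ) : ℝ :=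
  if h : ∃ y, IsODESolution δ (max m 0) y then h.choose (max t 0) else 0

/-! ### Integral form, continuation, semigroup property and measurability of the flow. -/

namespace IsTaxRate

variable {δ : ℝ≥0 → ℝ} {m a s t : ℝ} {y z : ℝ → ℝ}

theorem netRate_pos (hδ : IsTaxRate δ) (u : ℝ) : 0 < netRate δ u :=
  sub_pos.2 (hδ.mem_Ico _).2

theorem netRate_le_one (hδ : IsTaxRate δ) (u : ℝ) : netRate δ u ≤ 1 :=
  sub_le_self _ (hδ.mem_Ico _).1

theorem measurable_netRate (hδ : IsTaxRate δ) : Measurable (netRate δ) :=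
  measurable_const.sub (hδ.measurable.comp measurable_real_toNNReal)

theorem locallyIntegrable_netRate (hδ : IsTaxRate δ) (hz : Measurable z) :
    LocallyIntegrable (fun u => netRate δ (z u)) volume := by
  refine (locallyIntegrable_const (1 : ℝ)).mono
    (hδ.measurable_netRate.comp hz).aestronglyMeasurable (.of_forall fun u => ?_)
  rw [Real.norm_of_nonneg (hδ.netRate_pos _).le, norm_one]
  exact hδ.netRate_le_one _

theorem intervalIntegrable_netRate (hδ : IsTaxRate δ) (hz : Measurable z) (s t : ℝ) :
    IntervalIntegrable (fun u => netRate δ (z u)) volume s t :=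
  ((hδ.locallyIntegrable_netRate hz).integrableOn_isCompact isCompact_uIcc).intervalIntegrable

theorem integral_netRate_nonneg (hδ : IsTaxRate δ) (hst : s ≤ t) :
    0 ≤ ∫ u in s..t, netRate δ (z u) :=
  intervalIntegral.integral_nonneg hst fun _ _ => (hδ.netRate_pos _).le

theorem integral_netRate_pos (hδ : IsTaxRate δ) (hz : Measurable z) (hst : s < t) :
    0 < ∫ u in s..t, netRate δ (z u) :=
  intervalIntegral.intervalIntegral_pos_of_pos_on (hδ.intervalIntegrable_netRate hz s t)
    (fun _ _ => hδ.netRate_pos _) hst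

theorem integral_netRate_le (hδ : IsTaxRate δ) (hz : Measurable z) (hst : s ≤ t) :
    ∫ u in s..t, netRate δ (z u) ≤ t - s := by
  have := intervalIntegral.integral_mono_on hst (hδ.intervalIntegrable_netRate hz s t)
    (intervalIntegrable_const (c := (1 : ℝ))) fun u _ => hδ.netRate_le_one _
  simpa using this

theorem integral_netRate_sub (hδ : IsTaxRate δ) (hz : Measurable z) (r s t : ℝ) :
    (∫ u in r..t, netRate δ (z u)) - ∫ u in r..s, netRate δ (z u) =
      ∫ u in s..t, netRate δ (z u) :=
  intervalIntegral.integral_interval_sub_left (hδ.intervalIntegrable_netRate hz r t)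
    (hδ.intervalIntegrable_netRate hz r s)

theorem integral_eq_of_isODESolution (hy : IsODESolution δ m y) (ht : 0 ≤ t) :
    y t = m + ∫ u in 0..t, netRate δ (y u) := by
  have h1 := (hy.absCont t ht).integral_deriv_eq_sub
  have h2 : ∫ u in 0..t, deriv y u = ∫ u in 0..t, netRate δ (y u) := by
    refine intervalIntegral.integral_congr_ae ?_
    filter_upwards [(ae_restrict_iff' measurableSet_Ici).1 hy.deriv] with u hu hmem
    rw [uIoc_of_le ht] at hmem
    exact (hu hmem.1.le).deriv
  rw [← h2, h1, hy.initial]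
  ring

/-- The rate lies in `(0, 1]`, so an integral solution is 1-Lipschitz, and Lebesgue differentiation
recovers the equation almost everywhere. -/
theorem isODESolution_of_integral_eq (hδ : IsTaxRate δ) (hm : 0 ≤ m) (hy : Measurable y)
    (h : ∀ t, 0 ≤ t → y t = m + ∫ u in 0..t, netRate δ (y u)) : IsODESolution δ m y where
  initial := by simpa using h 0 le_rfl
  nonneg t ht := by
    rw [h t ht]
    exact add_nonneg hm (hδ.integral_netRate_nonneg ht)
  absCont T hT := by
    refine LipschitzOnWith.absolutelyContinuousOnInterval (K := 1) ?_
    rw [uIcc_of_le hT]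
    have key : ∀ s t, 0 ≤ s → s ≤ t → |y s - y t| ≤ |s - t| := fun s t hs hst => by
      have h1 : y t - y s = ∫ u in s..t, netRate δ (y u) := by
        rw [h t (hs.trans hst), h s hs, ← hδ.integral_netRate_sub hy 0 s t]
        ring
      have h2 := hδ.integral_netRate_nonneg (z := y) hst
      have h3 := hδ.integral_netRate_le hy hst
      rw [abs_of_nonpos (by linarith), abs_of_nonpos (by linarith)]
      linarith
    refine LipschitzOnWith.of_dist_le_mul fun s hs t ht => ?_
    rw [NNReal.coe_one, one_mul, Real.dist_eq, Real.dist_eq]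
    rcases le_total s t with hst | hst
    · exact key s t hs.1 hst
    · rw [abs_sub_comm, abs_sub_comm s]
      exact key t s ht.1 hst
  deriv := by
    -- The integral equation constrains `y` only on `[0, ∞)`, so a two-sided derivative is available
    -- only at `t > 0`; the origin is a null set.
    rw [← restrict_Ioi_eq_restrict_Ici, ae_restrict_iff' measurableSet_Ioi]
    filter_upwards [LocallyIntegrable.ae_hasDerivAt_integral
      (hδ.locallyIntegrable_netRate hy)] with t ht htpos
    refine ((ht 0).const_add m).congr_of_eventuallyEq ?_
    filter_upwards [Ioi_mem_nhds htpos] with s hs using h s (le_of_lt hs)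

theorem exists_solution (hδ : IsTaxRate δ) (m : ℝ) : ∃ y, IsODESolution δ (max m 0) y ∧
    ∀ t, taxFlow δ m t = y (max t 0) := by
  have h : ∃ y, IsODESolution δ (max m 0) y :=
    (hδ.ode_unique _ (le_max_right m 0)).imp fun _ h => h.1
  exact ⟨h.choose, h.choose_spec, fun t => by rw [taxFlow, dif_pos h]⟩

theorem continuous_taxFlow (hδ : IsTaxRate δ) (m : ℝ) : Continuous (taxFlow δ m) := by
  obtain ⟨y, hy, h⟩ := hδ.exists_solution m
  have hc : ContinuousOn y (Ici 0) := fun t ht =>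
    ((hy.absCont (t + 1) (by linarith [mem_Ici.1 ht])).continuousOn t
      (by rw [uIcc_of_le (by linarith [mem_Ici.1 ht])]; exact
        ⟨ht, by linarith⟩)).mono_of_mem_nhdsWithin
      (by
        rw [uIcc_of_le (by linarith [mem_Ici.1 ht]), ← Ici_inter_Iic]
        exact inter_mem_nhdsWithin _ (Iic_mem_nhds (lt_add_one t)))
  rw [funext h]
  exact hc.comp_continuous (continuous_id.max continuous_const) fun t =>
    mem_Ici.2 (le_max_right _ _)

theorem measurable_taxFlow_time (hδ : IsTaxRate δ) (m : ℝ) : Measurable (taxFlow δ m) :=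
  (hδ.continuous_taxFlow m).measurable

theorem taxFlow_eq (hδ : IsTaxRate δ) (hm : 0 ≤ m) (ht : 0 ≤ t) :
    taxFlow δ m t = m + ∫ u in 0..t, netRate δ (taxFlow δ m u) := by
  obtain ⟨y, hy, h⟩ := hδ.exists_solution m
  rw [max_eq_left hm] at hy
  rw [h, max_eq_left ht, integral_eq_of_isODESolution hy ht]
  congr 1
  refine intervalIntegral.integral_congr fun u hu => ?_
  rw [uIcc_of_le ht] at hu
  simp only [h, max_eq_left hu.1]

theorem taxFlow_of_nonpos (hδ : IsTaxRate δ) (hm : 0 ≤ m) (ht : t ≤ 0) : taxFlow δ m t = m := by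
  obtain ⟨y, hy, h⟩ := hδ.exists_solution m
  rw [h, max_eq_right ht, hy.initial, max_eq_left hm]

theorem taxFlow_sub (hδ : IsTaxRate δ) (hm : 0 ≤ m) (hs : 0 ≤ s) (hst : s ≤ t) :
    taxFlow δ m t - taxFlow δ m s = ∫ u in s..t, netRate δ (taxFlow δ m u) := by
  rw [hδ.taxFlow_eq hm (hs.trans hst), hδ.taxFlow_eq hm hs,
    ← hδ.integral_netRate_sub (hδ.measurable_taxFlow_time m) 0 s t]
  ring

theorem monotone_taxFlow_time (hδ : IsTaxRate δ) (hm : 0 ≤ m) : Monotone (taxFlow δ m) := by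
  intro s t hst
  rcases le_total t 0 with ht | ht
  · rw [hδ.taxFlow_of_nonpos hm ht, hδ.taxFlow_of_nonpos hm (hst.trans ht)]
  rcases le_total s 0 with hs | hs
  · rw [hδ.taxFlow_of_nonpos hm hs, hδ.taxFlow_eq hm ht]
    linarith [hδ.integral_netRate_nonneg (z := taxFlow δ m) ht]
  · linarith [hδ.taxFlow_sub hm hs hst, hδ.integral_netRate_nonneg (z := taxFlow δ m) hst]

theorem taxFlow_sub_le (hδ : IsTaxRate δ) (hm : 0 ≤ m) (hst : s ≤ t) :
    taxFlow δ m t - taxFlow δ m s ≤ t - s := by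
  rcases le_total t 0 with ht | ht
  · rw [hδ.taxFlow_of_nonpos hm ht, hδ.taxFlow_of_nonpos hm (hst.trans ht)]
    linarith
  rcases le_total s 0 with hs | hs
  · rw [hδ.taxFlow_of_nonpos hm hs, hδ.taxFlow_eq hm ht]
    linarith [hδ.integral_netRate_le (hδ.measurable_taxFlow_time m) ht]
  · linarith [hδ.taxFlow_sub hm hs hst, hδ.integral_netRate_le (hδ.measurable_taxFlow_time m) hst]

theorem level_le_taxFlow (hδ : IsTaxRate δ) (hm : 0 ≤ m) (t : ℝ) : m ≤ taxFlow δ m t := by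
  have := hδ.monotone_taxFlow_time hm (min_le_left t 0)
  rwa [hδ.taxFlow_of_nonpos hm (min_le_right t 0)] at this

theorem eq_taxFlow (hδ : IsTaxRate δ) (hm : 0 ≤ m) (hz : Measurable z)
    (h : ∀ t, 0 ≤ t → z t = m + ∫ u in 0..t, netRate δ (z u)) (ht : 0 ≤ t) :
    z t = taxFlow δ m t := by
  obtain ⟨y, -, hy⟩ := hδ.ode_unique m hm
  rw [hy z (hδ.isODESolution_of_integral_eq hm hz h) ht, hy (taxFlow δ m)
    (hδ.isODESolution_of_integral_eq hm (hδ.measurable_taxFlow_time m) fun t ht =>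
      hδ.taxFlow_eq hm ht) ht]

/-- A solution of the tax equation on a bounded interval agrees with the flow there. -/
theorem eq_taxFlow_of_le (hδ : IsTaxRate δ) (hm : 0 ≤ m) (hz : Measurable z)
    (h : ∀ t, 0 ≤ t → t ≤ a → z t = m + ∫ u in 0..t, netRate δ (z u)) (ht : 0 ≤ t) (hta : t ≤ a) :
    z t = taxFlow δ m t := by
  have ha := ht.trans hta
  have hza : 0 ≤ z a := by
    rw [h a ha le_rfl]
    exact add_nonneg hm (hδ.integral_netRate_nonneg ha)
  -- Continuing `z` beyond `a` by the flow started from `z a` gives a global solution, to which the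
  -- uniqueness hypothesis applies.
  set w : ℝ → ℝ := fun u => if u ≤ a then z u else taxFlow δ (z a) (u - a) with hw
  have hwm : Measurable w := Measurable.ite measurableSet_Iic hz
    ((hδ.measurable_taxFlow_time _).comp (measurable_id.sub_const a))
  have hwz : ∀ u ≤ a, w u = z u := fun u hu => if_pos hu
  have hint : ∀ s, 0 ≤ s → s ≤ a →
      ∫ u in 0..s, netRate δ (w u) = ∫ u in 0..s, netRate δ (z u) := fun s hs hsa =>
    intervalIntegral.integral_congr fun u hu => by
      rw [uIcc_of_le hs] at hu
      simp only [hwz u (hu.2.trans hsa)]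
  have heq : ∀ s, 0 ≤ s → w s = m + ∫ u in 0..s, netRate δ (w u) := by
    intro s hs
    rcases le_or_gt s a with hsa | hsa
    · rw [hwz s hsa, h s hs hsa, hint s hs hsa]
    · have h1 : w s = taxFlow δ (z a) (s - a) := if_neg (not_le.2 hsa)
      have h2 := hδ.integral_netRate_sub hwm 0 a s
      have h3 : ∫ u in a..s, netRate δ (w u) = ∫ u in 0..s - a, netRate δ (taxFlow δ (z a) u) := by
        rw [← sub_self a, ← intervalIntegral.integral_comp_sub_right
          (fun u => netRate δ (taxFlow δ (z a) u)) a]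
        refine intervalIntegral.integral_congr_ae (.of_forall fun u hu => ?_)
        rw [uIoc_of_le hsa.le] at hu
        simp only [hw, if_neg (not_le.2 hu.1)]
      rw [h1, hδ.taxFlow_eq hza (sub_nonneg.2 hsa.le), ← h3, ← h2, hint a ha le_rfl]
      have := h a ha le_rfl
      linarith
  rw [← hwz t hta]
  exact hδ.eq_taxFlow hm hwm heq ht

/-- The semigroup property of the flow. -/
theorem taxFlow_taxFlow (hδ : IsTaxRate δ) (hm : 0 ≤ m) (ha : 0 ≤ a) (ht : 0 ≤ t) :
    taxFlow δ (taxFlow δ m a) t = taxFlow δ m (a + t) := by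
  refine (hδ.eq_taxFlow (hm.trans (hδ.level_le_taxFlow hm a))
    ((hδ.measurable_taxFlow_time m).comp (measurable_id.const_add a)) (fun s hs => ?_) ht).symm
  have h1 := hδ.taxFlow_sub hm ha (le_add_of_nonneg_right hs : a ≤ a + s)
  have h2 := intervalIntegral.integral_comp_add_left
    (fun u => netRate δ (taxFlow δ m u)) a (a := 0) (b := s)
  rw [add_zero] at h2
  simp only [Function.comp_apply, id_eq]
  rw [h2]
  linarith

/-- Trajectories on a line cannot overtake. If the one from `m` is above `m'` at time `t`, it passed
`m'` at some time `a ≤ t`, and from there it is the trajectory from `m'` with only `t - a` time to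
run. -/
theorem monotone_taxFlow (hδ : IsTaxRate δ) (t : ℝ) : Monotone fun m => taxFlow δ m t := by
  have key : ∀ m m', 0 ≤ m → m ≤ m' → taxFlow δ m t ≤ taxFlow δ m' t := by
    intro m m' hm hmm'
    have hm' := hm.trans hmm'
    rcases le_or_gt (taxFlow δ m t) m' with h | h
    · exact h.trans (hδ.level_le_taxFlow hm' t)
    have ht : 0 ≤ t := by
      by_contra! ht
      rw [hδ.taxFlow_of_nonpos hm ht.le] at h
      linarith
    obtain ⟨a, ha, hma⟩ := intermediate_value_Icc ht (hδ.continuous_taxFlow m).continuousOn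
      (show m' ∈ Icc (taxFlow δ m 0) (taxFlow δ m t) from
        ⟨by rwa [hδ.taxFlow_of_nonpos hm le_rfl], h.le⟩)
    have := hδ.taxFlow_taxFlow hm ha.1 (sub_nonneg.2 ha.2)
    rw [hma, add_sub_cancel] at this
    rw [← this]
    exact hδ.monotone_taxFlow_time hm' (sub_le_self _ ha.1)
  have hmax : ∀ m, taxFlow δ m t = taxFlow δ (max m 0) t := fun m => by
    have h : max (max m 0) 0 = max m 0 := max_eq_left (le_max_right m 0)
    unfold taxFlow
    rw [h]
  intro m m' h
  simp only
  rw [hmax m, hmax m']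
  exact key _ _ (le_max_right _ _) (max_le_max h le_rfl)

/-- A Carathéodory argument: continuous in time and monotone, hence measurable, in the level. -/
theorem measurable_taxFlow (hδ : IsTaxRate δ) : Measurable fun p : ℝ × ℝ => taxFlow δ p.1 p.2 :=
  (measurable_uncurry_of_continuous_of_measurable (u := fun t m => taxFlow δ m t)
    (fun m => hδ.continuous_taxFlow m) fun t => (hδ.monotone_taxFlow t).measurable).comp
    measurable_swap

end IsTaxRate

/-- The cumulative tax paid by the time the running supremum of the reflected process is `s`. -/
noncomputable def taxPaid (δ : ℝ≥0 → ℝ) (m s : ℝ) : ℝ := s - taxFlow δ m (s - m)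

/-- Since the rate lies in `(0, 1]`, `Φ` and `s - Φ(s)` both increase. For `m = 0` the flow stays
within `[0, ε]` up to time `ε`, where the rate is the constant `1 - γ`; there `Φ` is linear with
slope `γ < 1`. -/
theorem IsTaxRate.isTaxFunction {δ : ℝ≥0 → ℝ} {m : ℝ} (hδ : IsTaxRate δ) (hm : 0 ≤ m) :
    IsTaxFunction m (taxPaid δ m) where
  level_nonneg := hm
  mono s s' h := by
    have := hδ.taxFlow_sub_le hm (sub_le_sub_right h m)
    simp only [taxPaid]
    linarith
  mono_sub s s' h := by
    simpa [taxPaid] using hδ.monotone_taxFlow_time hm (sub_le_sub_right h m)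
  map_level := by simp [taxPaid, hδ.taxFlow_of_nonpos hm le_rfl]
  lt_self s hs := by
    have := hδ.taxFlow_eq hm (sub_nonneg.2 hs.le)
    have := hδ.integral_netRate_pos (hδ.measurable_taxFlow_time m) (sub_pos.2 hs)
    simp only [taxPaid]
    linarith
  contract := by
    rcases hm.eq_or_lt with rfl | hm
    · obtain ⟨ε, hε, γ, ⟨hγ0, hγ1⟩, hγ⟩ := hδ.const_near_zero
      refine .inr ⟨ε, hε, γ, hγ0, hγ1, fun s s' hs hss' hs' => ?_⟩
      have h1 := hδ.taxFlow_sub le_rfl hs hss'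
      have h2 : ∫ u in s..s', netRate δ (taxFlow δ 0 u) = ∫ u in s..s', (1 - γ) := by
        refine intervalIntegral.integral_congr fun u hu => ?_
        rw [uIcc_of_le hss'] at hu
        have h3 := hδ.taxFlow_sub_le le_rfl (hs.trans hu.1)
        rw [hδ.taxFlow_of_nonpos le_rfl le_rfl] at h3
        simp only [netRate]
        rw [hγ _ ⟨zero_le, Real.toNNReal_le_iff_le_coe.2 (by linarith [hu.2])⟩]
      rw [intervalIntegral.integral_const, smul_eq_mul] at h2
      simp only [taxPaid, sub_zero]
      rw [h2] at h1
      linarith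
    · exact .inl hm

end TaxProcess

namespace TaxProcess

/-! ### Lebesgue–Stieltjes measures on the half-line -/

section Stieltjes

variable {G : ℝ≥0 → ℝ}

theorem stieltjes_eq (hG : Monotone G) (hc : ∀ t, ContinuousWithinAt G (Ici t) t) :
    stieltjes G = (StieltjesFunction.mk G hG hc).measure := dif_pos ⟨hG, hc⟩

theorem stieltjes_Ioc (hG : Monotone G) (hc : ∀ t, ContinuousWithinAt G (Ici t) t) (s t : ℝ≥0) :
    stieltjes G (Ioc s t) = ENNReal.ofReal (G t - G s) := by
  rw [stieltjes_eq hG hc]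
  exact StieltjesFunction.measure_Ioc _ s t

theorem stieltjes_singleton (hG : Monotone G) (hc : ∀ t, ContinuousWithinAt G (Ici t) t)
    (t : ℝ≥0) : stieltjes G {t} = ENNReal.ofReal (G t - Function.leftLim G t) := by
  rw [stieltjes_eq hG hc]
  exact StieltjesFunction.measure_singleton _ t

/-- The points at which `G` is left-continuous and to the right of which it is locally constant
form a null set. -/
theorem stieltjes_eq_zero (hG : Monotone G) (hc : ∀ t, ContinuousWithinAt G (Ici t) t)
    {A : Set ℝ≥0} (hA : ∀ t ∈ A, G t ≤ Function.leftLim G t ∧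
      ∃ b, t < b ∧ ∀ s, t ≤ s → s < b → G s = G t) : stieltjes G A = 0 := by
  -- Each point of `A` shares its value of `G` with a later point of a countable dense set. For a
  -- fixed dense point `q`, with `a` the infimum of the corresponding points, right-continuity gives
  -- `G q ≤ G a`, so `(a, q]` is null; only an atom at `a` could remain, and points of `A` carry
  -- none.
  set B : ℕ → Set ℝ≥0 := fun k => {t | t ∈ A ∧ t < TopologicalSpace.denseSeq ℝ≥0 k ∧
    G (TopologicalSpace.denseSeq ℝ≥0 k) = G t}
  have hAB : A ⊆ ⋃ k, B k := fun t ht => by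
    obtain ⟨b, hb, hbs⟩ := (hA t ht).2
    obtain ⟨k, hk⟩ := exists_denseSeq_mem_Ioo hb
    exact mem_iUnion.2 ⟨k, ht, hk.1, hbs _ hk.1.le hk.2⟩
  refine measure_mono_null hAB (measure_iUnion_null fun k => ?_)
  rcases (B k).eq_empty_or_nonempty with h | hne
  · rw [h, measure_empty]
  set q := TopologicalSpace.denseSeq ℝ≥0 k
  set a := sInf (B k)
  have hGa : G q ≤ G a := by
    by_contra! hlt
    obtain ⟨b, hb, hbs⟩ := exists_forall_Ico ((hc a).eventually (Iio_mem_nhds hlt))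
    obtain ⟨t, ht, htb⟩ := exists_lt_of_csInf_lt hne hb
    exact absurd (hbs t (csInf_le (OrderBot.bddBelow _) ht) htb) (not_lt.2 ht.2.2.le)
  have hIoc : stieltjes G (Ioc a q) = 0 := by
    rw [stieltjes_Ioc hG hc, ENNReal.ofReal_eq_zero]
    linarith
  have hsub : B k ⊆ (B k ∩ {a}) ∪ Ioc a q := fun t ht => by
    rcases (csInf_le (OrderBot.bddBelow _) ht : a ≤ t).eq_or_lt with h | h
    · exact .inl ⟨ht, h.symm⟩
    · exact .inr ⟨h, ht.2.1.le⟩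
  refine measure_mono_null hsub (measure_union_null ?_ hIoc)
  by_cases ha : a ∈ B k
  · refine measure_mono_null inter_subset_right ?_
    rw [stieltjes_singleton hG hc, ENNReal.ofReal_eq_zero]
    linarith [(hA a ha.1).1]
  · rw [inter_singleton_eq_empty.2 ha, measure_empty]

/-- A continuous increasing `G` maps `dG` to Lebesgue measure. -/
theorem map_stieltjes (hG : Monotone G) (hc : Continuous G) (t : ℝ≥0) :
    ((stieltjes G).restrict (Ioc 0 t)).map G = volume.restrict (Ioc (G 0) (G t)) := by
  have hc' : ∀ s, ContinuousWithinAt G (Ici s) s := fun s => hc.continuousWithinAt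
  have : IsFiniteMeasure ((stieltjes G).restrict (Ioc 0 t)) :=
    ⟨by rw [Measure.restrict_apply_univ, stieltjes_Ioc hG hc']; exact ENNReal.ofReal_lt_top⟩
  refine Measure.ext_of_Iic _ _ fun c => ?_
  rw [Measure.map_apply hc.measurable measurableSet_Iic,
    Measure.restrict_apply (hc.measurable measurableSet_Iic),
    Measure.restrict_apply measurableSet_Iic]
  rcases lt_or_ge c (G 0) with h1 | h1
  · rw [show G ⁻¹' Iic c ∩ Ioc 0 t = ∅ from eq_empty_of_forall_notMem fun s hs =>
      absurd (hG (zero_le (a := s))) (not_le.2 (hs.1.trans_lt h1)),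
      show Iic c ∩ Ioc (G 0) (G t) = ∅ from eq_empty_of_forall_notMem fun s hs =>
      absurd hs.2.1 (not_lt.2 (hs.1.trans h1.le))]
    simp
  rcases le_or_gt (G t) c with h2 | h2
  · have hs1 : Ioc 0 t ⊆ G ⁻¹' Iic c := fun s hs => (hG hs.2).trans h2
    have hs2 : Ioc (G 0) (G t) ⊆ Iic c := fun s hs => hs.2.trans h2
    rw [inter_eq_right.2 hs1, inter_eq_right.2 hs2, stieltjes_Ioc hG hc', Real.volume_Ioc]
  -- With `r` the last time in `[0, t]` at which `G ≤ c`, continuity gives `G r = c` even if `G` has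
  -- flat stretches.
  obtain ⟨r, hr, hrmax⟩ := ((isCompact_Icc (a := 0) (b := t)).inter_right
    (isClosed_Iic.preimage hc : IsClosed (G ⁻¹' Iic c))).exists_isGreatest
    ⟨0, ⟨le_rfl, zero_le⟩, h1⟩
  obtain ⟨r', hr', hGr'⟩ := intermediate_value_Icc (zero_le (a := t)) hc.continuousOn ⟨h1, h2.le⟩
  have hGr : G r = c := le_antisymm hr.2 (hGr' ▸ hG (hrmax ⟨hr', hGr'.le⟩))
  rw [show G ⁻¹' Iic c ∩ Ioc 0 t = Ioc 0 r from ?_,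
    show Iic c ∩ Ioc (G 0) (G t) = Ioc (G 0) c from ?_, stieltjes_Ioc hG hc', Real.volume_Ioc, hGr]
  · ext x
    simp only [mem_inter_iff, mem_Iic, mem_Ioc]
    exact ⟨fun h => ⟨h.2.1, h.1⟩, fun h => ⟨h.2, h.1, h.2.trans h2.le⟩⟩
  · ext s
    simp only [mem_inter_iff, mem_preimage, mem_Iic, mem_Ioc]
    exact ⟨fun h => ⟨h.2.1, hrmax ⟨⟨zero_le, h.2.2⟩, h.1⟩⟩,
      fun h => ⟨(hG h.2).trans hr.2, h.1, h.2.trans hr.1.2⟩⟩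

theorem setIntegral_stieltjes_comp (hG : Monotone G) (hc : Continuous G) {φ : ℝ → ℝ}
    (hφ : Measurable φ) (t : ℝ≥0) :
    ∫ s in Ioc 0 t, φ (G s) ∂(stieltjes G) = ∫ u in G 0..G t, φ u := by
  rw [intervalIntegral.integral_of_le (hG zero_le), ← map_stieltjes hG hc,
    integral_map hc.measurable.aemeasurable hφ.aestronglyMeasurable]

theorem integrableOn_stieltjes (hG : Monotone G) (hc : ∀ t, ContinuousWithinAt G (Ici t) t)
    {φ : ℝ≥0 → ℝ} (hφ : Measurable φ) (hb : ∀ s, |φ s| ≤ 1) (s t : ℝ≥0) :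
    IntegrableOn φ (Ioc s t) (stieltjes G) := by
  refine Measure.integrableOn_of_bounded (M := 1) ?_ hφ.aestronglyMeasurable (.of_forall hb)
  rw [stieltjes_Ioc hG hc]
  exact ENNReal.ofReal_ne_top

end Stieltjes

theorem lintegral_stieltjesZero_eq_zero_iff {V K : ℝ≥0 → ℝ} (hV : Measurable V) :
    ∫⁻ t, indicator {t | 0 < V t} 1 t ∂(stieltjesZero K) = 0 ↔
      stieltjes K {t | 0 < V t} = 0 ∧ (0 < V 0 → K 0 ≤ 0) := by
  have hm : MeasurableSet {t | 0 < V t} := measurableSet_lt measurable_const hV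
  rw [lintegral_indicator_one hm, stieltjesZero, Measure.add_apply, Measure.smul_apply,
    Measure.dirac_apply' _ hm, add_eq_zero, smul_eq_mul, mul_eq_zero, ENNReal.ofReal_eq_zero]
  refine and_congr_right fun _ => ?_
  by_cases h : 0 < V 0 <;> simp [h]

/-! ### The tax-reflection transform and the fixed-point system -/

section Reflection

variable {δ : ℝ≥0 → ℝ} {m : ℝ} {X V S K : ℝ≥0 → ℝ}

/-- `dS`-almost everywhere `X + K = S`, so that `V` is the flow at time `S - m`. The substitution `u
= S` turns the tax integral into the integral of `δ` along the flow, which is `Φ(S)`.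
Complementarity holds because, where `V > 0`, `K` neither jumps nor grows just afterwards. -/
theorem IsTaxSystem.isTaxReflection (h : IsTaxSystem (taxPaid δ m) m X S K) (hδ : IsTaxRate δ)
    (hm : 0 ≤ m) (hX : IsCadlag X) (hJ : NoPositiveJumps X) (h0 : X 0 ≤ m) :
    IsTaxReflection δ m X (fun t => X t + K t - taxPaid δ m (S t)) K := by
  have hΦ := hδ.isTaxFunction hm
  have hKc := h.isCadlag_K hΦ hX
  have hSc := h.continuous_S hΦ hX hJ h0
  have hS0 := h.S_zero hΦ hX hJ h0
  have hSm := h.mono_S hX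
  have hVc : IsCadlag fun t => X t + K t - taxPaid δ m (S t) :=
    (hX.add hKc).sub ((h.isCadlag_S hΦ hX).comp_continuous hΦ.continuous)
  refine ⟨max_le h0 hm, hVc, hKc, fun t => by linarith [h.sub_le_K hΦ hX t], h.K_nonneg,
    h.mono_K, fun t => ?_, ?_⟩
  · rw [← show S = _ from funext h.S_eq]
    have hae : ∀ᵐ s ∂(stieltjes S), X s + K s = S s := by
      refine stieltjes_eq_zero hSm (h.rightContinuous_S hΦ hX) fun s hs => ?_
      refine ⟨?_, h.exists_S_eq hΦ hX (lt_of_le_of_ne (h.add_le_S hX s) hs)⟩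
      rw [hSc.continuousAt.continuousWithinAt.leftLim_eq]
    have h1 : ∫ s in Ioc 0 t, δ (X s + K s - taxPaid δ m (S s)).toNNReal ∂(stieltjes S) =
        ∫ s in Ioc 0 t, δ (taxFlow δ m (S s - m)).toNNReal ∂(stieltjes S) := by
      refine integral_congr_ae (ae_restrict_of_ae ?_)
      filter_upwards [hae] with s hs
      rw [hs, taxPaid, sub_sub_cancel]
    have h2 := setIntegral_stieltjes_comp hSm hSc (φ := fun u => δ (taxFlow δ m (u - m)).toNNReal)
      (hδ.measurable.comp (measurable_real_toNNReal.comp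
        ((hδ.measurable_taxFlow_time m).comp (measurable_id.sub_const m)))) t
    have h3 := intervalIntegral.integral_comp_sub_right
      (fun u => δ (taxFlow δ m u).toNNReal) m (a := m) (b := S t)
    have h4 := hδ.taxFlow_eq hm (sub_nonneg.2 (h.level_le_S t))
    have h5 : ∫ u in 0..S t - m, netRate δ (taxFlow δ m u) =
        (S t - m) - ∫ u in 0..S t - m, δ (taxFlow δ m u).toNNReal := by
      have hi : ∀ u, δ (taxFlow δ m u).toNNReal = 1 - netRate δ (taxFlow δ m u) := fun u => by
        rw [netRate, sub_sub_cancel]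
      simp only [hi]
      rw [intervalIntegral.integral_sub intervalIntegrable_const
        (hδ.intervalIntegrable_netRate (hδ.measurable_taxFlow_time m) _ _)]
      simp
    rw [hS0] at h2
    rw [sub_self] at h3
    rw [h1, h2, h3, taxPaid]
    linarith
  · refine (lintegral_stieltjesZero_eq_zero_iff
      (measurable_of_rightContinuous fun t => (hVc t).1)).2 ⟨?_, fun hV0 => ?_⟩
    · refine stieltjes_eq_zero h.mono_K (h.rightContinuous_K hΦ hX) fun t ht => ?_
      refine ⟨?_, h.exists_K_eq hΦ hX ht⟩
      rcases eq_zero_or_pos t with rfl | htpos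
      · rw [leftLim_eq_of_eq_bot _ (by simp)]
      · rw [← leftPart_of_pos K htpos, h.leftPart_eq hΦ hX ht]
    · rw [← h.leftPart_eq hΦ hX hV0, leftPart_zero]

/-! ### From a tax-reflection transform to a solution of the fixed-point system. -/

namespace IsTaxReflection

theorem measurable_rate (h : IsTaxReflection δ m X V K) (hδ : IsTaxRate δ) :
    Measurable fun s => netRate δ (V s) :=
  hδ.measurable_netRate.comp (measurable_of_rightContinuous fun t => (h.cadlag_V t).1)

theorem compl_iff (h : IsTaxReflection δ m X V K) :
    stieltjes K {t | 0 < V t} = 0 ∧ (0 < V 0 → K 0 ≤ 0) :=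
  (lintegral_stieltjesZero_eq_zero_iff
    (measurable_of_rightContinuous fun t => (h.cadlag_V t).1)).1 h.compl

theorem K_le_leftLim (h : IsTaxReflection δ m X V K) {t : ℝ≥0} (ht : 0 < V t) :
    K t ≤ Function.leftLim K t := by
  have := measure_mono_null (s := {t}) (t := {t | 0 < V t}) (singleton_subset_iff.2 ht)
    h.compl_iff.1
  rw [stieltjes_singleton h.monotone_K fun t => (h.cadlag_K t).1, ENNReal.ofReal_eq_zero] at this
  linarith

theorem K_eq_of_pos (h : IsTaxReflection δ m X V K) {s t : ℝ≥0} (hst : s ≤ t)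
    (hV : ∀ u ∈ Ioc s t, 0 < V u) : K t = K s := by
  have := measure_mono_null (s := Ioc s t) hV h.compl_iff.1
  rw [stieltjes_Ioc h.monotone_K fun t => (h.cadlag_K t).1, ENNReal.ofReal_eq_zero] at this
  exact le_antisymm (by linarith) (h.monotone_K hst)

/-- The total tax collected by time `t`. -/
theorem hasTax (h : IsTaxReflection δ m X V K) (t : ℝ≥0) :
    ∫ s in Ioc 0 t, δ (V s).toNNReal ∂(stieltjes (runningSup m fun u => X u + K u)) =
      X t + K t - V t := by
  rw [h.tax t]
  ring

theorem mono_sup (h : IsTaxReflection δ m X V K) (hX : IsCadlag X) :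
    Monotone (runningSup m fun u => X u + K u) :=
  monotone_runningSup (hX.add h.cadlag_K).locallyBddAbove m

theorem rightContinuous_sup (h : IsTaxReflection δ m X V K) (hX : IsCadlag X) (t : ℝ≥0) :
    ContinuousWithinAt (runningSup m fun u => X u + K u) (Ici t) t :=
  rightContinuous_runningSup (hX.add h.cadlag_K).locallyBddAbove
    (fun t => ((hX.add h.cadlag_K) t).1) m t

/-- At time `0` no tax has been paid, so `V 0 = X 0 + K 0`. Either this is zero, or the mass of `dK`
at `0` must vanish and it is `X 0`. -/
theorem sup_zero (h : IsTaxReflection δ m X V K) :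
    runningSup m (fun u => X u + K u) 0 = m := by
  refine le_antisymm (runningSup_le le_rfl fun s hs => ?_) (le_runningSup_level _ _ _)
  rw [nonpos_iff_eq_zero.1 hs]
  have hV := h.tax 0
  rw [Ioc_self, setIntegral_empty, sub_zero] at hV
  rcases (h.nonneg_V 0).eq_or_lt with h1 | h1
  · rw [← hV, ← h1]
    exact (le_max_right _ _).trans h.level
  · linarith [h.compl_iff.2 h1, h.nonneg_K 0, (le_max_left (X 0) 0).trans h.level]

/-- The part of the running supremum of the reflected path that is not paid in tax. -/
theorem sup_sub_tax (h : IsTaxReflection δ m X V K) (hδ : IsTaxRate δ) (hX : IsCadlag X)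
    (s t : ℝ≥0) (hst : s ≤ t) :
    ∫ u in Ioc s t, netRate δ (V u) ∂(stieltjes (runningSup m fun u => X u + K u)) =
      (runningSup m (fun u => X u + K u) t - (X t + K t - V t)) -
        (runningSup m (fun u => X u + K u) s - (X s + K s - V s)) := by
  set S := runningSup m fun u => X u + K u
  have hSm := h.mono_sup hX
  have hSc := h.rightContinuous_sup hX
  have hi : ∀ r t, IntegrableOn (fun u => netRate δ (V u)) (Ioc r t) (stieltjes S) :=
    integrableOn_stieltjes hSm hSc (h.measurable_rate hδ) fun u => by
      rw [abs_of_pos (hδ.netRate_pos _)]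
      exact hδ.netRate_le_one _
  have key : ∀ t, ∫ u in Ioc 0 t, netRate δ (V u) ∂(stieltjes S) =
      S t - S 0 - (X t + K t - V t) := fun t => by
    have h1 : ∀ u, netRate δ (V u) = 1 - (1 - netRate δ (V u)) := fun u => by ring
    have h2 : ∀ u, δ (V u).toNNReal = 1 - netRate δ (V u) := fun u => by
      rw [netRate, sub_sub_cancel]
    have h3 := h.hasTax t
    simp only [h2] at h3
    have hfin : stieltjes S (Ioc 0 t) ≠ ⊤ := by
      rw [stieltjes_Ioc hSm hSc]
      exact ENNReal.ofReal_ne_top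
    have h4 := integral_sub (integrableOn_const (C := (1 : ℝ)) hfin) (hi 0 t)
    rw [setIntegral_const, Measure.real, stieltjes_Ioc hSm hSc,
      ENNReal.toReal_ofReal (sub_nonneg.2 (hSm zero_le)), smul_eq_mul, mul_one] at h4
    rw [h4] at h3
    linarith
  have hunion := setIntegral_union (μ := stieltjes S) (f := fun u => netRate δ (V u))
    (Ioc_disjoint_Ioc_of_le (le_refl s)) measurableSet_Ioc (hi 0 s) (hi s t)
  rw [Ioc_union_Ioc_eq_Ioc zero_le hst, key, key] at hunion
  linarith

/-- At a jump of `S`, `X + K = S`, and since `1 - δ > 0` the atom leaves a positive untaxed part, so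
`V > 0`. Then `K` does not jump by complementarity, and `X` would have a positive jump. -/
theorem continuous_sup (h : IsTaxReflection δ m X V K) (hδ : IsTaxRate δ) (hX : IsCadlag X)
    (hJ : NoPositiveJumps X) : Continuous (runningSup m fun u => X u + K u) := by
  set S := runningSup m fun u => X u + K u with hS
  have hSm := h.mono_sup hX
  have hSc := h.rightContinuous_sup hX
  refine continuous_iff_continuousAt.2 fun t => continuousAt_iff_continuous_left'_right'.2
    ⟨?_, (hSc t).mono Ioi_subset_Ici_self⟩
  rw [hSm.continuousWithinAt_Iio_iff_leftLim_eq]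
  rcases eq_zero_or_pos t with rfl | ht
  · exact leftLim_eq_of_eq_bot _ (by simp)
  have : (𝓝[<] t).NeBot := nhdsLT_neBot_of_exists_lt ⟨0, ht⟩
  refine le_antisymm (hSm.leftLim_le le_rfl) ?_
  by_contra! hlt
  have hYS : ∀ s, X s + K s ≤ S s := fun s =>
    le_runningSup (hX.add h.cadlag_K).locallyBddAbove m (le_refl s)
  have hSY : S t ≤ X t + K t := by
    have : S t ≤ max (Function.leftLim S t) (X t + K t) := by
      refine runningSup_le (((le_runningSup_level m _ 0).trans (hSm.le_leftLim ht)).trans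
        (le_max_left _ _)) fun s hs => ?_
      rcases hs.eq_or_lt with rfl | hst
      · exact le_max_right _ _
      · exact ((hYS s).trans (hSm.le_leftLim hst)).trans (le_max_left _ _)
    rcases le_max_iff.1 this with h1 | h1
    · exact absurd h1 (not_le.2 hlt)
    · exact h1
  have hVpos : 0 < V t := by
    have h1 := h.sup_sub_tax hδ hX 0 t zero_le
    have h2 : ∫ u in {t}, netRate δ (V u) ∂(stieltjes S) ≤
        ∫ u in Ioc 0 t, netRate δ (V u) ∂(stieltjes S) := by
      refine setIntegral_mono_set (integrableOn_stieltjes hSm hSc (h.measurable_rate hδ)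
        (fun u => ?_) 0 t) (.of_forall fun u => (hδ.netRate_pos _).le)
        (LE.le.eventuallyLE (singleton_subset_iff.2 ⟨ht, le_rfl⟩))
      rw [abs_of_pos (hδ.netRate_pos _)]
      exact hδ.netRate_le_one _
    rw [integral_singleton, Measure.real, stieltjes_singleton hSm hSc, ENNReal.toReal_ofReal
      (sub_nonneg.2 (hSm.leftLim_le le_rfl)), smul_eq_mul] at h2
    have h3 := mul_pos (sub_pos.2 hlt) (hδ.netRate_pos (V t))
    have h4 := h.hasTax 0
    rw [Ioc_self, setIntegral_empty] at h4
    rw [h.sup_zero] at h1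
    have h5 := (le_max_right (X 0) 0).trans h.level
    linarith [hYS t]
  have hK := h.K_le_leftLim hVpos
  obtain ⟨l, hl⟩ := (hX t).2
  have h1 : l + Function.leftLim K t ≤ Function.leftLim S t :=
    le_of_tendsto_of_tendsto' (hl.add (h.monotone_K.tendsto_leftLim t)) (hSm.tendsto_leftLim t) hYS
  linarith [hJ t ht l hl]

/-- Along the running supremum, the untaxed part follows the flow of the tax equation. -/
theorem sup_sub_tax_eq_taxFlow (h : IsTaxReflection δ m X V K) (hδ : IsTaxRate δ)
    (hX : IsCadlag X) (hJ : NoPositiveJumps X) (T : ℝ≥0) :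
    runningSup m (fun u => X u + K u) T - (X T + K T - V T) =
      taxFlow δ m (runningSup m (fun u => X u + K u) T - m) := by
  have hm : 0 ≤ m := (le_max_right (X 0) 0).trans h.level
  have hinc := h.sup_sub_tax hδ hX
  have hSc := h.continuous_sup hδ hX hJ
  have hSm := h.mono_sup hX
  have hS0 := h.sup_zero
  have hb := (hX.add h.cadlag_K).locallyBddAbove
  have hae : ∀ᵐ s ∂(stieltjes (runningSup m fun u => X u + K u)),
      X s + K s = runningSup m (fun u => X u + K u) s := by
    refine stieltjes_eq_zero hSm (h.rightContinuous_sup hX) fun s hs => ?_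
    refine ⟨?_, exists_runningSup_eq hb ((hX.add h.cadlag_K) s).1
      (lt_of_le_of_ne (le_runningSup hb m (le_refl s)) hs)⟩
    rw [hSc.continuousAt.continuousWithinAt.leftLim_eq]
  set S := runningSup m fun u => X u + K u
  set H : ℝ≥0 → ℝ := fun t => S t - (X t + K t - V t)
  have hH0 : H 0 = m := by
    have := h.hasTax 0
    rw [Ioc_self, setIntegral_empty] at this
    simp only [H, hS0]
    linarith
  have hHm : Monotone H := fun s t hst => by
    have h1 := hinc s t hst
    have h2 : 0 ≤ ∫ u in Ioc s t, netRate δ (V u) ∂(stieltjes S) :=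
      integral_nonneg fun u => (hδ.netRate_pos _).le
    simp only [H]
    linarith
  -- The untaxed part `H` changes only when `S` does, so it is a function of `S`.
  have hHS : ∀ s t, s ≤ t → S s = S t → H s = H t := fun s t hst hSst => by
    have h1 := hinc s t hst
    have h2 : stieltjes S (Ioc s t) = 0 := by
      rw [stieltjes_Ioc hSm (h.rightContinuous_sup hX), hSst, sub_self, ENNReal.ofReal_zero]
    rw [Measure.restrict_eq_zero.2 h2, integral_zero_measure] at h1
    simp only [H]
    linarith
  have hHS' : ∀ s t, S s = S t → H s = H t := fun s t hSst => by
    rcases le_total s t with hst | hst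
    · exact hHS s t hst hSst
    · exact (hHS t s hst hSst.symm).symm
  -- A time at which `S` has risen by `u`, clipped to the range of `S` on `[0, T]` so that `z = H ∘
  -- r` is defined and monotone on all of `ℝ`.
  have hex : ∀ u : ℝ, ∃ r, S r = max m (min (m + u) (S T)) := fun u => by
    obtain ⟨r, -, hr⟩ := intermediate_value_Icc (zero_le (a := T)) hSc.continuousOn
      (show max m (min (m + u) (S T)) ∈ Icc (S 0) (S T) from
        ⟨hS0 ▸ le_max_left _ _, max_le (le_runningSup_level _ _ _) (min_le_right _ _)⟩)
    exact ⟨r, hr⟩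
  choose r hr using hex
  set z : ℝ → ℝ := fun u => H (r u)
  have hz : Monotone z := fun u u' huu' => by
    have hle : S (r u) ≤ S (r u') := by
      rw [hr, hr]
      exact max_le_max le_rfl (min_le_min (by linarith) le_rfl)
    rcases le_total (r u) (r u') with h1 | h1
    · exact hHm h1
    · exact (hHS' _ _ (le_antisymm hle (hSm h1))).le
  have hzH : ∀ s ≤ T, z (S s - m) = H s := fun s hs => hHS' _ _ (by
    rw [hr, add_sub_cancel, min_eq_left (hSm hs), max_eq_right (le_runningSup_level _ _ _)])
  refine (hzH T le_rfl).symm.trans (hδ.eq_taxFlow_of_le hm hz.measurable (fun t ht hta => ?_)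
    (sub_nonneg.2 (le_runningSup_level _ _ _)) le_rfl)
  obtain ⟨s, hs, hst⟩ := intermediate_value_Icc (zero_le (a := T)) hSc.continuousOn
    (show m + t ∈ Icc (S 0) (S T) from ⟨by linarith, by linarith⟩)
  have htS : t = S s - m := by linarith
  rw [htS, hzH s hs.2]
  have h1 := hinc 0 s zero_le
  -- Where `X + K = S`, the definition of `H` reduces to `V`; this closes the equation for `z`.
  have h2 : ∫ u in Ioc 0 s, netRate δ (V u) ∂(stieltjes S) =
      ∫ u in Ioc 0 s, netRate δ (z (S u - m)) ∂(stieltjes S) := by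
    refine setIntegral_congr_ae measurableSet_Ioc ?_
    filter_upwards [hae] with u hu hus
    rw [hzH u (hus.2.trans hs.2)]
    simp only [H, hu, sub_sub_cancel]
  have h3 := setIntegral_stieltjes_comp hSm hSc (φ := fun u => netRate δ (z (u - m)))
    (hδ.measurable_netRate.comp (hz.measurable.comp (measurable_id.sub_const m))) s
  have h4 := intervalIntegral.integral_comp_sub_right
    (fun u => netRate δ (z u)) m (a := m) (b := S s)
  rw [sub_self] at h4
  rw [hS0] at h3
  rw [← h4, ← h3, ← h2, h1]
  simp only [H] at hH0 ⊢
  linarith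

theorem eq_sub_taxPaid (h : IsTaxReflection δ m X V K) (hδ : IsTaxRate δ) (hX : IsCadlag X)
    (hJ : NoPositiveJumps X) (t : ℝ≥0) :
    V t = X t + K t - taxPaid δ m (runningSup m (fun u => X u + K u) t) := by
  have := h.sup_sub_tax_eq_taxFlow hδ hX hJ t
  simp only [taxPaid]
  linarith

/-- Nonnegativity of `V` makes `K` at least the reflection term, and complementarity makes it
minimal. If `K t` exceeded that term `L`, then `V > 0` wherever `K > L` up to `t`, so `K` could not
have crossed `L`, neither continuously nor by a jump. -/
theorem isTaxSystem (h : IsTaxReflection δ m X V K) (hδ : IsTaxRate δ) (hX : IsCadlag X)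
    (hJ : NoPositiveJumps X) :
    IsTaxSystem (taxPaid δ m) m X (runningSup m fun u => X u + K u) K := by
  have hV := h.eq_sub_taxPaid hδ hX hJ
  have hSm := h.mono_sup hX
  have hm : 0 ≤ m := (le_max_right (X 0) 0).trans h.level
  set S := runningSup m fun u => X u + K u
  have hbdd : LocallyBddAbove fun u => taxPaid δ m (S u) - X u := by
    simpa only [sub_eq_add_neg, Function.comp_apply] using
      ((hδ.isTaxFunction hm).mono.comp hSm).locallyBddAbove.add hX.neg.locallyBddAbove
  refine ⟨h.monotone_K, fun _ => rfl, fun t => le_antisymm ?_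
    (runningSup_le (h.nonneg_K t) fun s hs => ?_)⟩
  swap
  · linarith [h.nonneg_V s, hV s, h.monotone_K hs]
  by_contra! hlt
  set L := runningSup 0 (fun u => taxPaid δ m (S u) - X u) t
  have hpos : ∀ s ≤ t, L < K s → 0 < V s := fun s hs hKs => by
    have := le_runningSup hbdd 0 hs
    rw [hV s]
    linarith
  -- After the crossing time `s₀`, `K` is constant up to `t`, so the excess is already present at
  -- `s₀`. It would then be an atom of `dK` at a time with `V > 0`.
  set s₀ := sInf {s | L < K s}
  have hs₀t : s₀ ≤ t := csInf_le (a := t) (OrderBot.bddBelow _) hlt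
  have hbefore : ∀ s < s₀, K s ≤ L := fun s hs => not_lt.1 fun hh =>
    absurd (csInf_le (a := s) (s := {s | L < K s}) (OrderBot.bddBelow _) hh) (not_le.2 hs)
  have hafter : ∀ s, s₀ < s → L < K s := fun s hs => by
    obtain ⟨r, hr, hrs⟩ := exists_lt_of_csInf_lt (s := {s | L < K s}) ⟨t, hlt⟩ hs
    exact lt_of_lt_of_le hr (h.monotone_K hrs.le)
  have hKs₀ : K t = K s₀ := h.K_eq_of_pos hs₀t fun u hu => hpos u hu.2 (hafter u hu.1)
  rw [hKs₀] at hlt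
  have hVs₀ := hpos s₀ hs₀t hlt
  rcases eq_zero_or_pos s₀ with h0 | h0
  · rw [h0] at hVs₀ hlt
    linarith [h.compl_iff.2 hVs₀, le_runningSup_level 0 (fun u => taxPaid δ m (S u) - X u) t]
  · have : (𝓝[<] s₀).NeBot := nhdsLT_neBot_of_exists_lt ⟨0, h0⟩
    have h1 : Function.leftLim K s₀ ≤ L := le_of_tendsto (h.monotone_K.tendsto_leftLim s₀)
      (by filter_upwards [self_mem_nhdsWithin] with s hs using hbefore s hs)
    linarith [h.K_le_leftLim hVs₀]

end IsTaxReflection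

/-- The unique tax-reflection transform in terms of the minimal solution of the fixed-point
system. -/
theorem IsTaxReflection.eq_lim (h : IsTaxReflection δ m X V K) (hδ : IsTaxRate δ)
    (hX : IsCadlag X) (hJ : NoPositiveJumps X) :
    V = (fun t => X t + reflLim (taxPaid δ m) m X t -
      taxPaid δ m (supLim (taxPaid δ m) m X t)) ∧ K = reflLim (taxPaid δ m) m X := by
  have hm : 0 ≤ m := (le_max_right (X 0) 0).trans h.level
  have hΦ := hδ.isTaxFunction hm
  obtain ⟨hS, hK⟩ := (h.isTaxSystem hδ hX hJ).unique (isTaxSystem_lim hΦ hX) hΦ hX hJ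
    ((le_max_left _ _).trans h.level)
  refine ⟨funext fun t => ?_, hK⟩
  rw [h.eq_sub_taxPaid hδ hX hJ, hS, hK]

theorem existsUnique_isTaxReflection (hδ : IsTaxRate δ) (hm : 0 ≤ m) (hX : IsCadlag X)
    (hJ : NoPositiveJumps X) (h0 : X 0 ≤ m) :
    ∃! VK : (ℝ≥0 → ℝ) × (ℝ≥0 → ℝ), IsTaxReflection δ m X VK.1 VK.2 := by
  refine ⟨(_, _), (isTaxSystem_lim (hδ.isTaxFunction hm) hX).isTaxReflection hδ hm hX hJ h0,
    fun VK h => ?_⟩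
  obtain ⟨h1, h2⟩ := h.eq_lim hδ hX hJ
  exact Prod.ext h1 h2

end Reflection

end TaxProcess

namespace TaxProcess

/-! ### The natural tax process along a path -/

namespace IsTaxSystem

variable {Φ Φ' : ℝ → ℝ} {m : ℝ} {X S K : ℝ≥0 → ℝ}

/-- The running supremum of the natural tax process is the untaxed part of `S`. -/
theorem runningSup_natural (h : IsTaxSystem Φ m X S K) (hΦ : IsTaxFunction m Φ) (hX : IsCadlag X)
    (t : ℝ≥0) :
    runningSup m (fun s => X s + leftPart K s - Φ (S s)) t = S t - Φ (S t) := by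
  have hle : ∀ s, X s + leftPart K s - Φ (S s) ≤ S s - Φ (S s) := fun s => by
    linarith [leftPart_le h.mono_K (h.K_nonneg 0) s, h.add_le_S hX s]
  have hmono : Monotone fun s => S s - Φ (S s) := hΦ.mono_sub.comp (h.mono_S hX)
  have hbdd : LocallyBddAbove fun s => X s + leftPart K s - Φ (S s) :=
    locallyBddAbove_iff.2 fun t => ⟨S t - Φ (S t), fun s hs => (hle s).trans (hmono hs)⟩
  have hm : m ≤ S t - Φ (S t) := by
    have : m - Φ m ≤ S t - Φ (S t) := hΦ.mono_sub (h.level_le_S t)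
    rwa [hΦ.map_level, sub_zero] at this
  refine le_antisymm (runningSup_le hm fun s hs => (hle s).trans (hmono hs)) ?_
  rcases (h.level_le_S t).eq_or_lt with hS | hS
  · rw [← hS, hΦ.map_level, sub_zero]
    exact le_runningSup_level _ _ _
  by_contra! hlt
  set R := runningSup m (fun s => X s + leftPart K s - Φ (S s)) t
  -- The level `c` exceeds `Φ (S t)`, so `V⁺ > 0` at a time when `X + K > c` and `K` has no jump
  -- there. It also exceeds `R + Φ (S t)`, so the natural process is above `R` at that time.
  obtain ⟨c, hc, hcS⟩ := exists_between
    (max_lt (max_lt hS (hΦ.lt_self _ hS)) (show R + Φ (S t) < S t by linarith))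
  have hcm : m < c := ((le_max_left _ _).trans (le_max_left _ _)).trans_lt hc
  have hcΦ : Φ (S t) < c := ((le_max_right _ _).trans (le_max_left _ _)).trans_lt hc
  have hcR : R + Φ (S t) < c := (le_max_right _ _).trans_lt hc
  rw [h.S_eq t] at hcS
  obtain ⟨s, hs, hcs⟩ := lt_runningSup hcS hcm.le
  have hΦs := hΦ.mono (h.mono_S hX hs)
  have h1 := h.leftPart_eq hΦ hX (t := s) (by linarith)
  have h2 : X s + leftPart K s - Φ (S s) ≤ R := le_runningSup hbdd m hs
  linarith

/-- The fixed-point system restarted at time `T`. -/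
theorem shift (h : IsTaxSystem Φ m X S K) (hΦ : IsTaxFunction m Φ) (hX : IsCadlag X) (T : ℝ≥0)
    (hΦ' : ∀ t, Φ' (S (T + t) - Φ (S T)) = Φ (S (T + t)) - Φ (S T)) :
    IsTaxSystem Φ' (S T - Φ (S T)) (fun t => X (T + t) + leftPart K T - Φ (S T))
      (fun t => S (T + t) - Φ (S T)) (fun t => K (T + t) - leftPart K T) := by
  have hKm : Monotone fun t => K (T + t) - leftPart K T := fun s t hst =>
    sub_le_sub_right (h.mono_K (by gcongr)) _
  have hSm : Monotone fun t => S (T + t) - Φ (S T) := fun s t hst =>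
    sub_le_sub_right (h.mono_S hX (by gcongr)) _
  refine ⟨hKm, fun t => ?_, fun t => ?_⟩
  · have heq : (fun u => X (T + u) + leftPart K T - Φ (S T) + (K (T + u) - leftPart K T)) =
        fun u => X (T + u) + K (T + u) - Φ (S T) := funext fun u => by ring
    rw [heq]
    have hle : ∀ u, X (T + u) + K (T + u) - Φ (S T) ≤ S (T + u) - Φ (S T) := fun u =>
      sub_le_sub_right (h.add_le_S hX _) _
    have hb : LocallyBddAbove fun u => X (T + u) + K (T + u) - Φ (S T) :=
      locallyBddAbove_iff.2 fun t => ⟨S (T + t) - Φ (S T), fun s hs => (hle s).trans (hSm hs)⟩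
    refine le_antisymm ?_ (runningSup_le (sub_le_sub_right (h.mono_S hX le_self_add) _)
      fun u hu => (hle u).trans (hSm hu))
    set R := runningSup (S T - Φ (S T)) (fun u => X (T + u) + K (T + u) - Φ (S T)) t
    have h1 : S T - Φ (S T) ≤ R := le_runningSup_level _ _ _
    have h2 : S (T + t) ≤ max (S T) (R + Φ (S T)) := h.S_le_max hX fun u hu1 hu2 => by
      obtain ⟨v, rfl⟩ := exists_add_of_le hu1
      have := le_runningSup hb (S T - Φ (S T)) (le_of_add_le_add_left hu2)
      linarith
    rw [max_eq_right (by linarith)] at h2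
    linarith
  · have heq : (fun u => Φ' (S (T + u) - Φ (S T)) - (X (T + u) + leftPart K T - Φ (S T))) =
        fun u => Φ (S (T + u)) - X (T + u) - leftPart K T := funext fun u => by rw [hΦ']; ring
    rw [heq]
    have hle : ∀ u, Φ (S (T + u)) - X (T + u) - leftPart K T ≤ K (T + u) - leftPart K T :=
      fun u => sub_le_sub_right (h.sub_le_K hΦ hX _) _
    have hb : LocallyBddAbove fun u => Φ (S (T + u)) - X (T + u) - leftPart K T :=
      locallyBddAbove_iff.2 fun t => ⟨K (T + t) - leftPart K T, fun s hs => (hle s).trans (hKm hs)⟩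
    refine le_antisymm ?_ (runningSup_le (sub_nonneg.2
      ((leftPart_le h.mono_K (h.K_nonneg 0) T).trans (h.mono_K le_self_add)))
      fun u hu => (hle u).trans (hKm hu))
    set R := runningSup 0 (fun u => Φ (S (T + u)) - X (T + u) - leftPart K T) t
    have h1 : 0 ≤ R := le_runningSup_level _ _ _
    -- The restart uses `K (T-)`: the bailout at time `T` is made again by the restarted system, as
    -- its mass at time `0`.
    have h2 : K (T + t) ≤ max (leftPart K T) (R + leftPart K T) :=
      h.K_le_max_leftPart hΦ hX fun u hu1 hu2 => by
        obtain ⟨v, rfl⟩ := exists_add_of_le hu1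
        have := le_runningSup hb 0 (le_of_add_le_add_left hu2)
        linarith
    rw [max_eq_right (by linarith)] at h2
    linarith

end IsTaxSystem

theorem tendsto_add_nhdsLT (T : ℝ≥0) {t : ℝ≥0} :
    Tendsto (fun s => T + s) (𝓝[<] t) (𝓝[<] (T + t)) := by
  refine tendsto_nhdsWithin_iff.2 ⟨?_, ?_⟩
  · exact (continuous_const.add continuous_id).continuousAt.continuousWithinAt
  · filter_upwards [self_mem_nhdsWithin] with s hs
    exact (add_lt_add_iff_left T).2 hs

theorem leftPart_shift {K : ℝ≥0 → ℝ} (hK : Monotone K) (T t : ℝ≥0) :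
    leftPart (fun t => K (T + t) - leftPart K T) t = leftPart K (T + t) - leftPart K T := by
  rcases eq_zero_or_pos t with rfl | ht
  · rw [leftPart_zero, add_zero, sub_self]
  · have : (𝓝[<] t).NeBot := nhdsLT_neBot_of_exists_lt ⟨0, ht⟩
    rw [leftPart_of_pos _ ht, leftPart_of_pos K (ht.trans_le le_add_self)]
    exact leftLim_eq_of_tendsto
      (((hK.tendsto_leftLim (T + t)).comp (tendsto_add_nhdsLT T)).sub_const _)

/-- The paths to which the tax-reflection transform with initial maximum level `m` applies. -/
structure IsInputPath (m : ℝ) (X : ℝ≥0 → ℝ) : Prop where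
  cadlag : IsCadlag X
  noPositiveJumps : NoPositiveJumps X
  zero_le : X 0 ≤ m

theorem IsInputPath.shift {m : ℝ} {X : ℝ≥0 → ℝ} (hX : IsInputPath m X) {m' c : ℝ} (T : ℝ≥0)
    (h0 : X T + c ≤ m') : IsInputPath m' fun t => X (T + t) + c where
  cadlag t := by
    refine ⟨?_, ?_⟩
    · have h1 : ContinuousWithinAt (fun s => T + s) (Ici t) t :=
        (continuous_const.add continuous_id).continuousWithinAt
      exact (((hX.cadlag (T + t)).1.comp h1 fun s hs => by
        simpa using hs).add continuousWithinAt_const)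
    · obtain ⟨l, hl⟩ := (hX.cadlag (T + t)).2
      exact ⟨l + c, (hl.comp (tendsto_add_nhdsLT T)).add_const c⟩
  noPositiveJumps t ht l hl := by
    obtain ⟨l', hl'⟩ := (hX.cadlag (T + t)).2
    have : (𝓝[<] t).NeBot := nhdsLT_neBot_of_exists_lt ⟨0, ht⟩
    rw [tendsto_nhds_unique hl ((hl'.comp (tendsto_add_nhdsLT T)).add_const c)]
    linarith [hX.noPositiveJumps (T + t) (ht.trans_le le_add_self) l' hl']
  zero_le := by simpa using h0

/-- The cumulative bailouts along the path `X`. -/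
noncomputable def bailoutPath (δ : ℝ≥0 → ℝ) (m : ℝ) (X : ℝ≥0 → ℝ) : ℝ≥0 → ℝ :=
  leftPart (reflLim (taxPaid δ m) m X)

/-- The natural tax process along the path `X`, together with its running supremum. -/
noncomputable def taxPath (δ : ℝ≥0 → ℝ) (m : ℝ) (X : ℝ≥0 → ℝ) (t : ℝ≥0) : ℝ × ℝ :=
  (X t + bailoutPath δ m X t - taxPaid δ m (supLim (taxPaid δ m) m X t),
    taxFlow δ m (supLim (taxPaid δ m) m X t - m))

section TaxPath

variable {δ : ℝ≥0 → ℝ} {m : ℝ} {X : ℝ≥0 → ℝ}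

theorem runningSup_taxPath (hδ : IsTaxRate δ) (hm : 0 ≤ m) (hX : IsInputPath m X) (t : ℝ≥0) :
    runningSup m (fun s => (taxPath δ m X s).1) t = (taxPath δ m X t).2 := by
  have := (isTaxSystem_lim (hδ.isTaxFunction hm) hX.cadlag).runningSup_natural
    (hδ.isTaxFunction hm) hX.cadlag t
  rw [taxPaid, sub_sub_cancel] at this
  exact this

theorem taxPath_fst_le_snd (hδ : IsTaxRate δ) (hm : 0 ≤ m) (hX : IsInputPath m X) (t : ℝ≥0) :
    (taxPath δ m X t).1 ≤ (taxPath δ m X t).2 := by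
  have h := isTaxSystem_lim (hδ.isTaxFunction hm) hX.cadlag
  have h1 := leftPart_le h.mono_K (h.K_nonneg 0) t
  have h2 := h.add_le_S hX.cadlag t
  simp only [taxPath, bailoutPath, taxPaid] at *
  linarith

theorem taxPath_zero (hδ : IsTaxRate δ) (hm : 0 ≤ m) (hX : IsInputPath m X) :
    taxPath δ m X 0 = (X 0, m) := by
  have h := isTaxSystem_lim (hδ.isTaxFunction hm) hX.cadlag
  have h1 := h.S_zero (hδ.isTaxFunction hm) hX.cadlag hX.noPositiveJumps hX.zero_le
  rw [taxPath, bailoutPath, leftPart_zero, h1, (hδ.isTaxFunction hm).map_level, sub_self,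
    hδ.taxFlow_of_nonpos hm le_rfl, add_zero, sub_zero]

/-- After time `T`, the natural tax process follows the same dynamics, started from its state at
time `T` and driven by the increments of `X` after `T`. -/
theorem taxPath_shift (hδ : IsTaxRate δ) (hm : 0 ≤ m) (hX : IsInputPath m X) (T t : ℝ≥0) :
    taxPath δ (taxPath δ m X T).2 (fun t => (taxPath δ m X T).1 + (X (T + t) - X T)) t =
      taxPath δ m X (T + t) := by
  have hΦ := hδ.isTaxFunction hm
  have h := isTaxSystem_lim hΦ hX.cadlag
  have hV := taxPath_fst_le_snd hδ hm hX T
  simp only [taxPath, bailoutPath] at hV ⊢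
  set S := supLim (taxPaid δ m) m X
  set K := reflLim (taxPaid δ m) m X
  have hm' : taxFlow δ m (S T - m) = S T - taxPaid δ m (S T) := by rw [taxPaid, sub_sub_cancel]
  have hm'0 : 0 ≤ taxFlow δ m (S T - m) := hm.trans (hδ.level_le_taxFlow hm _)
  -- By the semigroup property, the tax paid after `T` is the tax function of the new level `V̄_T`,
  -- so the shifted solution belongs to a system of the same type.
  have hflow : ∀ t, taxFlow δ (taxFlow δ m (S T - m)) (S (T + t) - S T) =
      taxFlow δ m (S (T + t) - m) := fun t => by
    rw [hδ.taxFlow_taxFlow hm (sub_nonneg.2 (h.level_le_S T))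
      (sub_nonneg.2 (h.mono_S hX.cadlag le_self_add))]
    congr 1
    ring
  have hΦ' : ∀ t, taxPaid δ (taxFlow δ m (S T - m)) (S (T + t) - taxPaid δ m (S T)) =
      taxPaid δ m (S (T + t)) - taxPaid δ m (S T) := fun t => by
    rw [taxPaid, show S (T + t) - taxPaid δ m (S T) - taxFlow δ m (S T - m) = S (T + t) - S T by
      rw [hm']; ring, hflow, taxPaid, taxPaid]
    ring
  have hpath : (fun t => X T + leftPart K T - taxPaid δ m (S T) + (X (T + t) - X T)) =
      fun t => X (T + t) + leftPart K T - taxPaid δ m (S T) := funext fun t => by ring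
  have hin : IsInputPath (taxFlow δ m (S T - m))
      fun t => X (T + t) + leftPart K T - taxPaid δ m (S T) := by
    simpa only [add_sub_assoc] using hX.shift T (c := leftPart K T - taxPaid δ m (S T))
      (by rw [← add_sub_assoc]; exact hV)
  have hsys := h.shift hΦ hX.cadlag T hΦ'
  rw [← hm'] at hsys
  obtain ⟨hS', hK'⟩ := (isTaxSystem_lim (hδ.isTaxFunction hm'0) hin.cadlag).unique hsys
    (hδ.isTaxFunction hm'0) hin.cadlag hin.noPositiveJumps hin.zero_le
  rw [hpath, hS', hK', leftPart_shift h.mono_K, hΦ',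
    show S (T + t) - taxPaid δ m (S T) - taxFlow δ m (S T - m) = S (T + t) - S T by rw [hm']; ring,
    hflow]
  refine Prod.ext ?_ rfl
  simp only
  ring

/-- The zero path reproduces the convention `V = K = 0` used when `X` starts above `m`. -/
theorem taxPath_const_zero (hδ : IsTaxRate δ) (hm : 0 ≤ m) (t : ℝ≥0) :
    bailoutPath δ m (fun _ => 0) t = 0 ∧ taxPath δ m (fun _ => 0) t = (0, m) := by
  have hΦ := hδ.isTaxFunction hm
  have hX : IsInputPath m fun _ => (0 : ℝ) :=
    ⟨isCadlag_const 0, fun t ht l hl => by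
      have : (𝓝[<] t).NeBot := nhdsLT_neBot_of_exists_lt ⟨0, ht⟩
      exact (tendsto_nhds_unique hl tendsto_const_nhds).ge, hm⟩
  have h : IsTaxSystem (taxPaid δ m) m (fun _ => 0) (fun _ => m) fun _ => 0 := by
    refine ⟨monotone_const, fun t => le_antisymm (le_runningSup_level _ _ _)
      (runningSup_le le_rfl fun s _ => by simpa using hm), fun t =>
      le_antisymm (le_runningSup_level _ _ _) (runningSup_le le_rfl fun s _ => ?_)⟩
    rw [hΦ.map_level, sub_zero]
  obtain ⟨hS, hK⟩ := (isTaxSystem_lim hΦ hX.cadlag).unique h hΦ hX.cadlag hX.noPositiveJumps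
    hX.zero_le
  have hb : bailoutPath δ m (fun _ => 0) t = 0 := by
    rw [bailoutPath, hK]
    exact le_antisymm (leftPart_le monotone_const le_rfl t)
      (leftPart_nonneg monotone_const le_rfl t)
  refine ⟨hb, ?_⟩
  rw [taxPath, hb, hS, hΦ.map_level, sub_self, hδ.taxFlow_of_nonpos hm le_rfl]
  simp

theorem taxReflection_eq (hδ : IsTaxRate δ) (hm : 0 ≤ m) (hX : IsInputPath m X) :
    taxReflection δ m X = (fun t => X t + reflLim (taxPaid δ m) m X t -
      taxPaid δ m (supLim (taxPaid δ m) m X t), reflLim (taxPaid δ m) m X) := by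
  have hex := (existsUnique_isTaxReflection hδ hm hX.cadlag hX.noPositiveJumps hX.zero_le).exists
  rw [taxReflection, dif_pos hex]
  obtain ⟨h1, h2⟩ := hex.choose_spec.eq_lim hδ hX.cadlag hX.noPositiveJumps
  exact Prod.ext h1 h2

theorem taxReflection_of_lt (h : m < X 0) : taxReflection δ m X = (0, 0) :=
  dif_neg fun ⟨_, hVK⟩ => absurd ((le_max_left _ _).trans hVK.level) (not_le.2 h)

end TaxPath

/-! ### Passage from single paths to the process. -/

section Driven

variable {Ω : Type*} {δ : ℝ≥0 → ℝ} {m : ℝ} {X : ℝ≥0 → Ω → ℝ}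

open Classical in
/-- The process `X`, replaced by the zero path where it starts above `m`. -/
noncomputable def restartedPath (X : ℝ≥0 → Ω → ℝ) (m : ℝ) (t : ℝ≥0) (ω : Ω) : ℝ :=
  if X 0 ω ≤ m then X t ω else 0

/-- The identity holds for every `ω`, since bad paths are replaced by the zero path. Whether a path
is bad is decided by `X 0`, so adaptedness needs no completion of the filtration. -/
theorem bailout_taxProcess_eq (hδ : IsTaxRate δ) (hm : 0 ≤ m)
    (hc : ∀ ω, IsCadlag fun t => X t ω) (hJ : ∀ ω, NoPositiveJumps fun t => X t ω)
    (t : ℝ≥0) (ω : Ω) :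
    bailout δ X m t ω = bailoutPath δ m (fun s => restartedPath X m s ω) t ∧
      taxProcess δ X m t ω = (taxPath δ m (fun s => restartedPath X m s ω) t).1 := by
  by_cases h0 : X 0 ω ≤ m
  · have hX : IsInputPath m fun s => X s ω := ⟨hc ω, hJ ω, h0⟩
    simp only [restartedPath, if_pos h0, bailout, taxProcess, VPlus, KPlus,
      taxReflection_eq hδ hm hX, bailoutPath, taxPath, leftPart]
    refine ⟨trivial, ?_⟩
    split_ifs with ht
    · subst ht
      ring
    · ring
  · obtain ⟨h1, h2⟩ := taxPath_const_zero hδ hm t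
    simp only [restartedPath, if_neg h0, h1, h2, bailout, taxProcess, VPlus, KPlus,
      taxReflection_of_lt (X := fun s => X s ω) (not_le.1 h0)]
    have hl : Function.leftLim (fun _ : ℝ≥0 => (0 : ℝ)) t = 0 := by
      rcases eq_zero_or_pos t with rfl | ht
      · exact leftLim_eq_of_eq_bot _ (by simp)
      · have : (𝓝[<] t).NeBot := nhdsLT_neBot_of_exists_lt ⟨0, ht⟩
        exact leftLim_eq_of_tendsto tendsto_const_nhds
    simp [hl]

theorem isInputPath_restartedPath (hm : 0 ≤ m) (hc : ∀ ω, IsCadlag fun t => X t ω)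
    (hJ : ∀ ω, NoPositiveJumps fun t => X t ω) (ω : Ω) :
    IsInputPath m fun s => restartedPath X m s ω := by
  by_cases h0 : X 0 ω ≤ m
  · simp only [restartedPath, if_pos h0]
    exact ⟨hc ω, hJ ω, h0⟩
  · simp only [restartedPath, if_neg h0]
    exact ⟨isCadlag_const 0, fun t ht l hl => by
      have : (𝓝[<] t).NeBot := nhdsLT_neBot_of_exists_lt ⟨0, ht⟩
      exact (tendsto_nhds_unique hl tendsto_const_nhds).ge, hm⟩

theorem taxPair_eq (hδ : IsTaxRate δ) {p : ℝ × ℝ} (hp : 0 ≤ p.2)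
    (hc : ∀ ω, IsCadlag fun t => X t ω) (hJ : ∀ ω, NoPositiveJumps fun t => X t ω)
    (t : ℝ≥0) (ω : Ω) :
    taxPair δ X p t ω = taxPath δ p.2 (fun s => restartedPath X p.2 s ω) t := by
  have h := fun s => (bailout_taxProcess_eq hδ hp hc hJ s ω).2
  rw [taxPair, funext h, h,
    runningSup_taxPath hδ hp (isInputPath_restartedPath hp hc hJ ω)]

theorem taxPair_eq_of_le (hδ : IsTaxRate δ) {p : ℝ × ℝ} (hp : 0 ≤ p.2)
    (hc : ∀ ω, IsCadlag fun t => X t ω) (hJ : ∀ ω, NoPositiveJumps fun t => X t ω)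
    {ω : Ω} (h0 : X 0 ω ≤ p.2) (t : ℝ≥0) :
    taxPair δ X p t ω = taxPath δ p.2 (fun s => X s ω) t := by
  rw [taxPair_eq hδ hp hc hJ]
  simp only [restartedPath, if_pos h0]

end Driven

end TaxProcess

namespace TaxProcess

/-! ### Measurability of the natural tax process -/

/-- `Y`, evaluated at any measurable random time before `t`, is measurable. -/
def MeasurableUpTo {α : Type*} [MeasurableSpace α] (t : ℝ≥0) (Y : ℝ≥0 → α → ℝ) : Prop :=
  ∀ σ : α → ℝ≥0, Measurable σ → (∀ a, σ a ≤ t) → Measurable fun a => Y (σ a) a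

theorem measurable_gridAbove (n : ℕ) : Measurable (gridAbove n) := by
  have h : Measurable fun t : ℝ≥0 => ((⌊t * (n + 1)⌋₊ : ℕ) : ℝ≥0) :=
    (measurable_from_nat (f := fun k : ℕ => (k : ℝ≥0))).comp
      (Nat.measurable_floor.comp (measurable_id.mul_const _))
  exact (h.add_const 1).div_const _

theorem countable_range_gridAbove (n : ℕ) : (range (gridAbove n)).Countable :=
  (countable_range fun k : ℕ => ((k : ℝ≥0) + 1) / (n + 1)).mono <| by
    rintro _ ⟨t, rfl⟩
    exact ⟨⌊t * (n + 1)⌋₊, rfl⟩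

section Generic

variable {α : Type*} {mα : MeasurableSpace α} {t : ℝ≥0} {Y : ℝ≥0 → α → ℝ} {m : α → ℝ}
  {δ : ℝ≥0 → ℝ}

/-- The time is approximated by the next grid point, capped at `t`: this takes countably many
values, looks no further than `t`, and converges from the right. -/
theorem measurableUpTo_of_rightContinuous
    (hc : ∀ a s, ContinuousWithinAt (fun s => Y s a) (Ici s) s)
    (hY : ∀ s ≤ t, Measurable (Y s)) : MeasurableUpTo t Y := fun σ hσ hσt => by
  refine measurable_of_tendsto_metrizable (f := fun n a => Y (min t (gridAbove n (σ a))) a)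
    (fun n => ?_) (tendsto_pi_nhds.2 fun a => ?_)
  · have hcount : (range fun a => min t (gridAbove n (σ a))).Countable :=
      ((countable_range_gridAbove n).image (min t)).mono <| by
        rintro _ ⟨a, rfl⟩
        exact ⟨_, mem_range_self _, rfl⟩
    have hg : Measurable fun a => min t (gridAbove n (σ a)) :=
      measurable_const.min ((measurable_gridAbove n).comp hσ)
    have := hcount.to_subtype
    intro C hC
    have h : (fun a => Y (min t (gridAbove n (σ a))) a) ⁻¹' C =
        ⋃ r : range fun a => min t (gridAbove n (σ a)),
          (fun a => min t (gridAbove n (σ a))) ⁻¹' {r.1} ∩ Y r.1 ⁻¹' C := by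
      ext a
      refine ⟨fun ha => mem_iUnion.2 ⟨⟨_, mem_range_self a⟩, rfl, ha⟩, fun ha => ?_⟩
      obtain ⟨r, hr, ha⟩ := mem_iUnion.1 ha
      rw [mem_preimage, mem_singleton_iff] at hr
      rwa [mem_preimage, hr]
    rw [h]
    refine MeasurableSet.iUnion fun r => (hg (measurableSet_singleton r.1)).inter ?_
    obtain ⟨_, a, rfl⟩ := r
    exact hY _ (min_le_left _ _) hC
  · have h : Tendsto (fun n => min t (gridAbove n (σ a))) atTop (𝓝[≥] σ a) := by
      refine tendsto_nhdsWithin_iff.2 ⟨?_, Eventually.of_forall fun n =>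
        le_min (hσt a) (lt_gridAbove n _).le⟩
      have := (tendsto_const_nhds (x := t)).min
        (tendsto_nhds_of_tendsto_nhdsWithin (tendsto_gridAbove (σ a)))
      rwa [min_eq_right (hσt a)] at this
    exact (hc a (σ a)).tendsto.comp h

/-- The supremum up to `σ` runs over `Y` at the times `q ∧ σ`, with `q` in a countable dense set.
These are again admissible random times, so the property is stable under iteration. -/
theorem MeasurableUpTo.runningSup (hY : MeasurableUpTo t Y) (hc : ∀ a, IsCadlag fun s => Y s a)
    (hm : Measurable m) :
    MeasurableUpTo t fun s a => TaxProcess.runningSup (m a) (fun u => Y u a) s :=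
  fun σ hσ hσt => by
    simp_rw [fun a => runningSup_eq_max_iSup (hc a).locallyBddAbove (fun s => (hc a s).1) (m a)]
    exact hm.max (Measurable.iSup fun k => hY _ (measurable_const.min hσ)
      fun a => (min_le_right _ _).trans (hσt a))

theorem MeasurableUpTo.leftPart (hY : MeasurableUpTo t Y)
    (hmono : ∀ a, Monotone fun s => Y s a) :
    MeasurableUpTo t fun s a => TaxProcess.leftPart (fun u => Y u a) s := fun σ hσ hσt => by
  refine measurable_of_tendsto_metrizable
    (f := fun (n : ℕ) a => if σ a = 0 then 0 else Y (σ a - min (σ a) (1 / (n + 1))) a)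
    (fun n => ?_) (tendsto_pi_nhds.2 fun a => ?_)
  · refine Measurable.ite (hσ (measurableSet_singleton 0)) measurable_const ?_
    exact hY _ (hσ.sub (hσ.min measurable_const)) fun a => tsub_le_self.trans (hσt a)
  · rcases eq_zero_or_pos (σ a) with h0 | h0
    · simp [h0, leftPart_zero]
    · simp only [h0.ne', if_false]
      rw [leftPart_of_pos _ h0]
      have : (𝓝[<] σ a).NeBot := nhdsLT_neBot_of_exists_lt ⟨0, h0⟩
      refine ((hmono a).tendsto_leftLim (σ a)).comp (tendsto_nhdsWithin_iff.2 ⟨?_, ?_⟩)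
      · have h1 : Tendsto (fun n : ℕ => (1 : ℝ≥0) / (n + 1)) atTop (𝓝 0) :=
          tendsto_one_div_add_atTop_nhds_zero_nat
        have h2 := (tendsto_const_nhds (x := σ a)).sub ((tendsto_const_nhds (x := σ a)).min h1)
        simpa using h2
      · exact Eventually.of_forall fun n => tsub_lt_self h0 (lt_min h0 (by positivity))

theorem MeasurableUpTo.iSup {Y : ℕ → ℝ≥0 → α → ℝ} (hY : ∀ n, MeasurableUpTo t (Y n)) :
    MeasurableUpTo t fun s a => ⨆ n, Y n s a := fun σ hσ hσt =>
  Measurable.iSup fun n => hY n σ hσ hσt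

theorem measurable_taxPaid (hδ : IsTaxRate δ) : Measurable fun p : ℝ × ℝ => taxPaid δ p.1 p.2 :=
  measurable_snd.sub
    (hδ.measurable_taxFlow.comp (measurable_fst.prodMk (measurable_snd.sub measurable_fst)))

/-- The level may depend on `a`: one argument serves both adaptedness, with `m` fixed, and joint
measurability in the starting point. -/
theorem measurableUpTo_iterates (hδ : IsTaxRate δ) (hm : Measurable m) (hm0 : ∀ a, 0 ≤ m a)
    (hY : MeasurableUpTo t Y) (hc : ∀ a, IsCadlag fun s => Y s a) (n : ℕ) :
    MeasurableUpTo t (fun s a => reflIter (taxPaid δ (m a)) (m a) (fun u => Y u a) n s) ∧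
      MeasurableUpTo t fun s a => supIter (taxPaid δ (m a)) (m a) (fun u => Y u a) n s := by
  have hsup : ∀ n,
      MeasurableUpTo t (fun s a => reflIter (taxPaid δ (m a)) (m a) (fun u => Y u a) n s) →
      MeasurableUpTo t fun s a => supIter (taxPaid δ (m a)) (m a) (fun u => Y u a) n s :=
    fun n h => MeasurableUpTo.runningSup
      (fun σ hσ hσt => (hY σ hσ hσt).add (h σ hσ hσt))
      (fun a => (hc a).add (isCadlag_reflIter (hδ.isTaxFunction (hm0 a)) (hc a) n)) hm
  suffices h : MeasurableUpTo t
      (fun s a => reflIter (taxPaid δ (m a)) (m a) (fun u => Y u a) n s) from ⟨h, hsup n h⟩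
  induction n with
  | zero => exact fun σ hσ hσt => measurable_const
  | succ n ih =>
    refine MeasurableUpTo.runningSup (m := fun _ => 0) (Y := fun u a =>
      taxPaid δ (m a) (supIter (taxPaid δ (m a)) (m a) (fun u => Y u a) n u) - Y u a)
      (fun σ hσ hσt => ?_)
      (fun a => isCadlag_taxed_sub (hδ.isTaxFunction (hm0 a)) (hc a) n) measurable_const
    exact ((measurable_taxPaid hδ).comp (hm.prodMk (hsup n ih σ hσ hσt))).sub (hY σ hσ hσt)

theorem measurableUpTo_bailoutPath (hδ : IsTaxRate δ) (hm : Measurable m) (hm0 : ∀ a, 0 ≤ m a)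
    (hY : MeasurableUpTo t Y) (hc : ∀ a, IsCadlag fun s => Y s a) :
    MeasurableUpTo t fun s a => bailoutPath δ (m a) (fun u => Y u a) s :=
  MeasurableUpTo.leftPart (MeasurableUpTo.iSup fun n =>
    (measurableUpTo_iterates hδ hm hm0 hY hc n).1)
    fun a => (isTaxSystem_lim (hδ.isTaxFunction (hm0 a)) (hc a)).mono_K

theorem measurable_taxPath (hδ : IsTaxRate δ) (hm : Measurable m) (hm0 : ∀ a, 0 ≤ m a)
    (hY : MeasurableUpTo t Y) (hc : ∀ a, IsCadlag fun s => Y s a) {σ : α → ℝ≥0}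
    (hσ : Measurable σ) (hσt : ∀ a, σ a ≤ t) :
    Measurable fun a => taxPath δ (m a) (fun u => Y u a) (σ a) := by
  have hS : Measurable fun a => supLim (taxPaid δ (m a)) (m a) (fun u => Y u a) (σ a) :=
    MeasurableUpTo.iSup (fun n => (measurableUpTo_iterates hδ hm hm0 hY hc n).2) σ hσ hσt
  exact (((hY σ hσ hσt).add (measurableUpTo_bailoutPath hδ hm hm0 hY hc σ hσ hσt)).sub
    ((measurable_taxPaid hδ).comp (hm.prodMk hS))).prodMk
      (hδ.measurable_taxFlow.comp (hm.prodMk (hS.sub hm)))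

end Generic

section Driven

variable {Ω : Type*} {δ : ℝ≥0 → ℝ} {m : ℝ} {X : ℝ≥0 → Ω → ℝ}

theorem measurableUpTo_restartedPath {mF : MeasurableSpace Ω} {t : ℝ≥0}
    (hc : ∀ ω, IsCadlag fun t => X t ω) (hX : ∀ s ≤ t, Measurable (X s)) :
    MeasurableUpTo t (restartedPath X m) := by
  refine measurableUpTo_of_rightContinuous (fun ω s => ?_) fun s hs => ?_
  · by_cases h0 : X 0 ω ≤ m
    · simpa only [restartedPath, if_pos h0] using (hc ω s).1
    · simpa only [restartedPath, if_neg h0] using continuousWithinAt_const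
  · exact Measurable.ite (measurableSet_le (hX 0 zero_le) measurable_const) (hX s hs)
      measurable_const

/-- The paths of the natural tax process depend measurably on its starting point and on the
increments of the driving path. -/
theorem exists_measurableSet_taxPath (hδ : IsTaxRate δ) {B : Set (ℝ≥0 → ℝ × ℝ)}
    (hB : MeasurableSet B) :
    ∃ B' : Set ((ℝ × ℝ) × (ℝ≥0 → ℝ)), MeasurableSet B' ∧ ∀ z f, 0 ≤ z.2 → IsCadlag f →
      ((fun t => taxPath δ z.2 (fun s => z.1 + f s) t) ∈ B ↔ (z, f) ∈ B') := by
  -- Working in the trace σ-algebra on `A` avoids any claim that the set of càdlàg paths is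
  -- measurable; `B'` is a measurable set with the right trace.
  let A : Set ((ℝ × ℝ) × (ℝ≥0 → ℝ)) := {a | 0 ≤ a.1.2 ∧ IsCadlag a.2}
  have hY : ∀ t, MeasurableUpTo t fun (s : ℝ≥0) (a : A) => a.1.1.1 + a.1.2 s := fun t =>
    measurableUpTo_of_rightContinuous
      (fun a s => continuousWithinAt_const.add (a.2.2 s).1) fun s _ => by fun_prop
  have hm : Measurable fun (a : A) (t : ℝ≥0) =>
      taxPath δ a.1.1.2 (fun s => a.1.1.1 + a.1.2 s) t := measurable_pi_lambda _ fun t =>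
    measurable_taxPath hδ (m := fun a : A => a.1.1.2) (by fun_prop) (fun a => a.2.1) (hY t)
      (fun a => (isCadlag_const _).add a.2.2) (σ := fun _ => t) measurable_const fun _ => le_rfl
  obtain ⟨B', hB', h⟩ := hm hB
  refine ⟨B', hB', fun z f hz hf => ?_⟩
  exact (Set.ext_iff.1 h ⟨(z, f), hz, hf⟩).symm

end Driven

end TaxProcess

namespace TaxProcess

/-! ### Processes with independent increments -/

/-- The increments after time `q` of a process. -/
def increments {Ω : Type*} (X : ℝ≥0 → Ω → ℝ) (q : ℝ≥0) (ω : Ω) (t : ℝ≥0) : ℝ :=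
  X (q + t) ω - X q ω

/-- Finitely many times can be enumerated by a monotone sequence that starts at `0`. -/
theorem exists_monotone_enumeration (I : Finset ℝ≥0) :
    ∃ t : ℕ → ℝ≥0, Monotone t ∧ t 0 = 0 ∧ ∀ s ∈ I, ∃ k, t k = s := by
  obtain ⟨c, hc⟩ : ∃ c, (insert 0 I).card = c + 1 :=
    Nat.exists_eq_add_one.2 (Finset.card_pos.2 ⟨0, Finset.mem_insert_self 0 I⟩)
  have hmono : Monotone fun k : ℕ => (insert 0 I).orderEmbOfFin hc
      ⟨min k c, Nat.lt_succ_of_le (min_le_right k c)⟩ := fun k l hkl =>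
    ((insert 0 I).orderEmbOfFin hc).monotone (Fin.mk_le_mk.2 (min_le_min_right c hkl))
  have hsurj : ∀ s ∈ insert 0 I, ∃ k : ℕ, (insert 0 I).orderEmbOfFin hc
      ⟨min k c, Nat.lt_succ_of_le (min_le_right k c)⟩ = s := fun s hs => by
    have : s ∈ range ((insert 0 I).orderEmbOfFin hc) := by
      rw [Finset.range_orderEmbOfFin]
      exact hs
    obtain ⟨i, rfl⟩ := this
    refine ⟨i, congrArg _ (Fin.ext ?_)⟩
    exact min_eq_left (Nat.lt_succ_iff.1 i.2)
  refine ⟨_, hmono, ?_, fun s hs => hsurj s (Finset.mem_insert_of_mem hs)⟩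
  obtain ⟨k, hk⟩ := hsurj 0 (Finset.mem_insert_self 0 I)
  exact le_antisymm ((hmono (Nat.zero_le k)).trans hk.le) zero_le

section Increments

variable {Ω Ω' : Type*} {mΩ : MeasurableSpace Ω} {mΩ' : MeasurableSpace Ω'}
  {X : ℝ≥0 → Ω → ℝ} {Y : ℝ≥0 → Ω' → ℝ} {μ : Measure Ω} {ν : Measure Ω'}

theorem measurable_increments (hX : ∀ t, Measurable (X t)) (q : ℝ≥0) :
    Measurable (increments X q) :=
  measurable_pi_lambda _ fun t => (hX (q + t)).sub (hX q)

/-- The law of a process with independent increments is determined by the laws of its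
increments. -/
theorem map_increments_eq [IsProbabilityMeasure μ] [IsProbabilityMeasure ν]
    (hX : ∀ t, Measurable (X t)) (hY : ∀ t, Measurable (Y t))
    (hXi : HasIndepIncrements X μ) (hYi : HasIndepIncrements Y ν)
    (h : ∀ s t, s ≤ t → μ.map (X t - X s) = ν.map (Y t - Y s)) :
    μ.map (increments X 0) = ν.map (increments Y 0) := by
  have hXm := measurable_increments hX 0
  have hYm := measurable_increments hY 0
  have := Measure.isProbabilityMeasure_map (μ := μ) hXm.aemeasurable
  have := Measure.isProbabilityMeasure_map (μ := ν) hYm.aemeasurable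
  refine IsProjectiveLimit.unique (P := fun I : Finset ℝ≥0 =>
    (μ.map (increments X 0)).map I.restrict) (fun I => rfl) fun I => ?_
  obtain ⟨t, ht, ht0, hI⟩ := exists_monotone_enumeration I
  choose! k hk using hI
  -- Finite-dimensional marginals are partial sums of increments along one enumeration, and these
  -- increments have a product law.
  let φ : (ℕ → ℝ) → I → ℝ := fun d s => ∑ i ∈ Finset.range (k s), d i
  have hφ : Measurable φ := by fun_prop
  have hrep : ∀ f : ℝ≥0 → ℝ,
      (fun s : I => f (0 + s) - f 0) = φ fun i => f (t (i + 1)) - f (t i) := fun f => by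
    funext s
    have := Finset.sum_range_sub (fun i => f (t i)) (k s)
    rw [hk s s.2, ht0] at this
    simpa [φ] using this.symm
  have hrepX : I.restrict ∘ increments X 0 = φ ∘ fun ω i => X (t (i + 1)) ω - X (t i) ω :=
    funext fun ω => hrep fun s => X s ω
  have hrepY : I.restrict ∘ increments Y 0 = φ ∘ fun ω i => Y (t (i + 1)) ω - Y (t i) ω :=
    funext fun ω => hrep fun s => Y s ω
  have hXd : ∀ i, Measurable fun ω => X (t (i + 1)) ω - X (t i) ω := fun i => (hX _).sub (hX _)
  have hYd : ∀ i, Measurable fun ω => Y (t (i + 1)) ω - Y (t i) ω := fun i => (hY _).sub (hY _)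
  have hlaw : μ.map (fun ω i => X (t (i + 1)) ω - X (t i) ω) =
      ν.map (fun ω i => Y (t (i + 1)) ω - Y (t i) ω) := by
    rw [(hXi.nat ht).map_fun_eq_infinitePi_map₀ (measurable_pi_lambda _ hXd).aemeasurable,
      (hYi.nat ht).map_fun_eq_infinitePi_map₀ (measurable_pi_lambda _ hYd).aemeasurable]
    congr 1
    funext i
    exact h _ _ (ht i.le_succ)
  change (ν.map _).map _ = (μ.map _).map _
  rw [Measure.map_map I.measurable_restrict hYm, Measure.map_map I.measurable_restrict hXm,
    hrepX, hrepY, ← Measure.map_map hφ (measurable_pi_lambda _ hXd),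
    ← Measure.map_map hφ (measurable_pi_lambda _ hYd), hlaw]

/-- The increments after time `q` are independent of those before. -/
theorem indepFun_increments [IsProbabilityMeasure μ] (hX : ∀ t, Measurable (X t))
    (hXi : HasIndepIncrements X μ) (q : ℝ≥0) :
    IndepFun (fun ω (s : Iic q) => X s ω - X 0 ω) (increments X q) μ := by
  refine IndepFun.process_indepFun_process (X := fun (s : Iic q) ω => X s ω - X 0 ω)
    (Y := fun t ω => increments X q ω t) (fun s => (hX _).sub (hX _))
    (fun t => (hX _).sub (hX _)) fun I J => ?_
  obtain ⟨t, ht, ht0, hc⟩ := exists_monotone_enumeration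
    (I.image Subtype.val ∪ insert q (J.image (q + ·)))
  obtain ⟨n, hn⟩ := hc q (by simp)
  -- The enumeration may repeat values, so an index beyond `n` can occur for a time at most `q`;
  -- that time then equals `q`, and the index is replaced by `n`.
  have hI : ∀ s : I, ∃ k ≤ n, t k = s.1.1 := fun s => by
    obtain ⟨k, hk⟩ := hc s.1.1 (Finset.mem_union_left _ (Finset.mem_image_of_mem _ s.2))
    rcases le_total k n with hkn | hkn
    · exact ⟨k, hkn, hk⟩
    · refine ⟨n, le_rfl, le_antisymm ((ht hkn).trans hk.le) ?_⟩
      rw [hn]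
      exact s.1.2
  have hJ : ∀ s : J, ∃ k, n ≤ k ∧ t k = q + s.1 := fun s => by
    obtain ⟨k, hk⟩ := hc (q + s.1) (by simp)
    rcases le_total n k with hkn | hkn
    · exact ⟨k, hkn, hk⟩
    · refine ⟨n, le_rfl, le_antisymm ?_ (hk.ge.trans (ht hkn))⟩
      rw [hn]
      exact le_self_add
  choose k hkn hk using hI
  choose l hln hl using hJ
  have hD := hXi.nat ht
  set D : ℕ → Ω → ℝ := fun i ω => X (t (i + 1)) ω - X (t i) ω
  have hDm : ∀ i, Measurable (D i) := fun i => (hX _).sub (hX _)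
  have hind := hD.indepFun_finset (Finset.range n)
    (Finset.Ico n (Finset.univ.sup l))
    (Finset.range_eq_Ico n ▸ Finset.Ico_disjoint_Ico_consecutive 0 n _) hDm
  have hφ : Measurable fun (d : Finset.range n → ℝ) (s : I) =>
      ∑ i : Finset.range n, if i.1 < k s then d i else 0 :=
    measurable_pi_lambda _ fun s => Finset.measurable_sum _ fun i _ => by
      split_ifs
      · exact measurable_pi_apply i
      · exact measurable_const
  have hψ : Measurable fun (d : Finset.Ico n (Finset.univ.sup l) → ℝ) (s : J) =>
      ∑ i : Finset.Ico n (Finset.univ.sup l), if i.1 < l s then d i else 0 :=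
    measurable_pi_lambda _ fun s => Finset.measurable_sum _ fun i _ => by
      split_ifs
      · exact measurable_pi_apply i
      · exact measurable_const
  convert hind.comp hφ hψ using 1
  · funext ω s
    simp only [Function.comp]
    rw [Finset.sum_coe_sort (Finset.range n) fun i => if i < k s then D i ω else 0,
      ← Finset.sum_filter, show (Finset.range n).filter (· < k s) = Finset.range (k s) by
        ext i
        have := hkn s
        simp only [Finset.mem_filter, Finset.mem_range]
        omega,
      Finset.sum_range_sub (fun i => X (t i) ω), hk, ht0]
  · funext ω s
    simp only [Function.comp]
    have hls : l s ≤ Finset.univ.sup l := Finset.le_sup (Finset.mem_univ s)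
    rw [Finset.sum_coe_sort (Finset.Ico n _) fun i => if i < l s then D i ω else 0,
      ← Finset.sum_filter, show (Finset.Ico n (Finset.univ.sup l)).filter (· < l s) =
        Finset.Ico n (l s) by
          ext i
          simp only [Finset.mem_filter, Finset.mem_Ico]
          omega,
      Finset.sum_Ico_sub (fun i => X (t i) ω) (hln s), hl, hn]
    rfl

end Increments

end TaxProcess

namespace TaxProcess

/-! ### The strong Markov property of a process with stationary independent increments -/

section

variable {Ω : Type*} {mΩ : MeasurableSpace Ω} {X : ℝ≥0 → Ω → ℝ} {μ : Measure Ω}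

theorem measurable_eval_time (hX : ∀ t, Measurable (X t)) (hc : ∀ ω, IsCadlag fun t => X t ω)
    {σ : Ω → ℝ≥0} (hσ : Measurable σ) : Measurable fun ω => X (σ ω) ω := by
  refine measurable_of_tendsto_metrizable (f := fun (n : ℕ) ω => X (min (σ ω) n) ω) (fun n =>
    measurableUpTo_of_rightContinuous (t := n) (fun ω s => (hc ω s).1) (fun s _ => hX s) _
      (hσ.min measurable_const) fun ω => min_le_right _ _) (tendsto_pi_nhds.2 fun ω => ?_)
  refine tendsto_const_nhds.congr' ?_
  filter_upwards [eventually_ge_atTop ⌈σ ω⌉₊] with n hn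
  rw [min_eq_left ((Nat.le_ceil _).trans (Nat.cast_le.2 hn))]

theorem measurable_increments_time (hX : ∀ t, Measurable (X t))
    (hc : ∀ ω, IsCadlag fun t => X t ω) {σ : Ω → ℝ≥0} (hσ : Measurable σ) :
    Measurable fun ω => increments X (σ ω) ω :=
  measurable_pi_lambda _ fun t => (measurable_eval_time hX hc (hσ.add_const t)).sub
    (measurable_eval_time hX hc hσ)

/-- The Markov property at a deterministic time. -/
theorem measure_inter_increments [IsProbabilityMeasure μ] (hXm : ∀ t, StronglyMeasurable (X t))
    (hXi : HasIndepIncrements X μ) {x : ℝ} (h0 : ∀ᵐ ω ∂μ, X 0 ω = x) {q : ℝ≥0} {G : Set Ω}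
    (hG : MeasurableSet[Filtration.natural X hXm q] G) {A : Set (ℝ≥0 → ℝ)} (hA : MeasurableSet A) :
    μ (G ∩ increments X q ⁻¹' A) = μ G * μ.map (increments X q) A := by
  have hm := measurable_increments (fun t => (hXm t).measurable) q
  have h1 := (indepFun_increments (fun t => (hXm t).measurable) hXi q).comp
    (φ := fun f s => x + f s) (by fun_prop) measurable_id
  -- The filtration also records `X 0`, which is almost surely the constant `x`, so the past is
  -- determined by the increments up to null sets.
  have h2 : IndepFun (fun ω (s : Iic q) => X s ω) (increments X q) μ :=
    IndepFun.process_congr_left (X := fun (s : Iic q) ω => x + (X s ω - X 0 ω)) h1 fun s => by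
      filter_upwards [h0] with ω hω
      rw [hω]
      ring
  rw [Filtration.natural_eq_comap] at hG
  obtain ⟨C, hC, rfl⟩ := hG
  rw [h2.measure_inter_preimage_eq_mul _ _ hC hA, Measure.map_apply hm hA]

theorem floor_mul_add_one_eq_iff {n k : ℕ} {t : ℝ≥0} : ⌊t * (n + 1)⌋₊ = k ↔
    (k : ℝ≥0) / (n + 1) ≤ t ∧ t < (k + 1) / (n + 1) := by
  rw [Nat.floor_eq_iff (zero_le), div_le_iff₀ (by positivity), lt_div_iff₀ (by positivity)]

variable {T : Ω → WithTop ℝ≥0}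

/-- An event prior to a stopping time of the right-continuous filtration `𝓕₊` which implies that
it is less than `r` belongs to `𝓕 r`. -/
theorem measurableSet_inter_lt {𝓕 : Filtration ℝ≥0 mΩ} (hT : IsStoppingTime 𝓕.rightCont T)
    {G : Set Ω} (hG : MeasurableSet[hT.measurableSpace] G) (r : ℝ≥0) :
    MeasurableSet[𝓕 r] (G ∩ {ω | T ω < r}) := by
  have h : G ∩ {ω | T ω < r} = ⋃ (j : ℕ) (_ : TopologicalSpace.denseSeq ℝ≥0 j < r),
      G ∩ {ω | T ω ≤ TopologicalSpace.denseSeq ℝ≥0 j} := by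
    ext ω
    simp only [mem_inter_iff, mem_ofPred_eq, mem_iUnion, exists_prop]
    constructor
    · rintro ⟨hω, hr⟩
      lift T ω to ℝ≥0 using (hr.trans_le le_top).ne with τ
      obtain ⟨j, hj1, hj2⟩ := exists_denseSeq_mem_Ioo (WithTop.coe_lt_coe.1 hr)
      exact ⟨j, hj2, hω, WithTop.coe_le_coe.2 hj1.le⟩
    · rintro ⟨j, hj, hω, hle⟩
      exact ⟨hω, hle.trans_lt (WithTop.coe_lt_coe.2 hj)⟩
  rw [h]
  refine MeasurableSet.iUnion fun j => MeasurableSet.iUnion fun hj => ?_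
  have h1 : 𝓕.rightCont (TopologicalSpace.denseSeq ℝ≥0 j) ≤ 𝓕 r := by
    rw [Filtration.rightCont_eq]
    exact iInf₂_le r hj
  exact h1 _ (hG.2 _)

/-- The strong Markov property on the grid approximating the stopping time from above. -/
theorem measure_inter_increments_grid [IsProbabilityMeasure μ]
    (hXm : ∀ t, StronglyMeasurable (X t)) (hXi : HasIndepIncrements X μ) {x : ℝ}
    (h0 : ∀ᵐ ω ∂μ, X 0 ω = x) {Q : Measure (ℝ≥0 → ℝ)} (hQ : ∀ q, μ.map (increments X q) = Q)
    (hT : IsStoppingTime (Filtration.natural X hXm).rightCont T) {G : Set Ω}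
    (hG : MeasurableSet[hT.measurableSpace] G) (hGT : ∀ ω ∈ G, T ω ≠ ⊤) (n : ℕ)
    {A : Set (ℝ≥0 → ℝ)} (hA : MeasurableSet A) :
    μ (G ∩ {ω | increments X (gridAbove n (T ω).untopA) ω ∈ A}) = μ G * Q A := by
  -- On `E k` the time lies strictly below the grid point `(k + 1) / (n + 1)`. Thus `E k` belongs to
  -- the unaugmented σ-algebra at that point, although `T` is only a stopping time for the
  -- right-continuous filtration.
  set E : ℕ → Set Ω := fun k => G ∩ {ω | ⌊(T ω).untopA * (n + 1)⌋₊ = k}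
  have hE : ∀ k : ℕ,
      MeasurableSet[Filtration.natural X hXm ((k + 1) / (n + 1))] (E k) := fun k => by
    have : E k = (G ∩ {ω | T ω < ((k + 1) / (n + 1) : ℝ≥0)}) \
        (G ∩ {ω | T ω < (k / (n + 1) : ℝ≥0)}) := by
      ext ω
      simp only [E, mem_inter_iff, mem_ofPred_eq, Set.mem_sdiff, floor_mul_add_one_eq_iff]
      refine ⟨fun ⟨hω, h⟩ => ?_, fun ⟨⟨hω, h⟩, h'⟩ => ⟨hω, ?_⟩⟩
      · have := hGT ω hω
        lift T ω to ℝ≥0 using this with τ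
        rw [show (τ : WithTop ℝ≥0).untopA = τ from rfl] at h
        exact ⟨⟨hω, WithTop.coe_lt_coe.2 h.2⟩, fun h' => h.1.not_gt (WithTop.coe_lt_coe.1 h'.2)⟩
      · have h'' := fun h => h' ⟨hω, h⟩
        have := hGT ω hω
        lift T ω to ℝ≥0 using this with τ
        rw [show (τ : WithTop ℝ≥0).untopA = τ from rfl]
        exact ⟨not_lt.1 fun h => h'' (WithTop.coe_lt_coe.2 h), WithTop.coe_lt_coe.1 h⟩
    rw [this]
    exact (measurableSet_inter_lt hT hG _).diff ((Filtration.natural X hXm).mono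
      (by gcongr; exact le_self_add) _ (measurableSet_inter_lt hT hG _))
  have hE' : ∀ k, MeasurableSet (E k) := fun k => (Filtration.natural X hXm).le _ _ (hE k)
  have hdisj : Pairwise (Function.onFun Disjoint E) := fun k l hkl =>
    Set.disjoint_left.2 fun ω hk hl => hkl (hk.2.symm.trans hl.2)
  have hGE : G = ⋃ k, E k := by
    ext ω
    simp [E]
  have hGA : G ∩ {ω | increments X (gridAbove n (T ω).untopA) ω ∈ A} =
      ⋃ k : ℕ, E k ∩ increments X ((k + 1) / (n + 1)) ⁻¹' A := by
    ext ω
    simp only [mem_inter_iff, mem_ofPred_eq, mem_iUnion, E, mem_preimage]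
    constructor
    · rintro ⟨hω, h⟩
      exact ⟨_, ⟨hω, rfl⟩, h⟩
    · rintro ⟨k, ⟨hω, rfl⟩, h⟩
      exact ⟨hω, h⟩
  have hm := measurable_increments fun t => (hXm t).measurable
  rw [hGA, measure_iUnion (fun k l hkl => (hdisj hkl).mono inter_subset_left inter_subset_left)
    fun k => (hE' k).inter (hm _ hA), hGE, measure_iUnion hdisj hE', ← ENNReal.tsum_mul_right]
  refine tsum_congr fun k => ?_
  rw [measure_inter_increments hXm hXi h0 (hE k) hA, hQ]

/-- The increments after a stopping time are independent of the past and have the law of the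
increments after time `0`. -/
theorem map_restrict_increments [IsProbabilityMeasure μ]
    (hXm : ∀ t, StronglyMeasurable (X t)) (hc : ∀ ω, IsCadlag fun t => X t ω)
    (hXi : HasIndepIncrements X μ) {x : ℝ} (h0 : ∀ᵐ ω ∂μ, X 0 ω = x)
    {Q : Measure (ℝ≥0 → ℝ)} (hQ : ∀ q, μ.map (increments X q) = Q)
    (hT : IsStoppingTime (Filtration.natural X hXm).rightCont T) {G : Set Ω}
    (hG : MeasurableSet[hT.measurableSpace] G) (hGT : ∀ ω ∈ G, T ω ≠ ⊤) :
    (μ.restrict G).map (fun ω => increments X (T ω).untopA ω) = μ G • Q := by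
  have hXm' := fun t => (hXm t).measurable
  have hτ : Measurable fun ω => (T ω).untopA := hT.measurable'.untopA
  have hG' : MeasurableSet G := hT.measurableSpace_le _ hG
  have hτn : ∀ n, Measurable fun ω => gridAbove n (T ω).untopA := fun n =>
    (measurable_gridAbove n).comp hτ
  have hgrid : ∀ n, (μ.restrict G).map
      (fun ω => increments X (gridAbove n (T ω).untopA) ω) = μ G • Q := fun n => by
    ext A hA
    have hm := measurable_increments_time hXm' hc (hτn n)
    rw [Measure.map_apply hm hA, Measure.restrict_apply (hm hA), inter_comm, Measure.smul_apply,
      smul_eq_mul]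
    exact measure_inter_increments_grid hXm hXi h0 hQ hT hG hGT n hA
  have hm := measurable_increments_time hXm' hc hτ
  have : IsFiniteMeasure Q := by
    rw [← hQ 0]
    infer_instance
  have hfin : IsFiniteMeasure (μ G • Q) := by
    rw [← hgrid 0]
    infer_instance
  refine IsProjectiveLimit.unique (P := fun I : Finset ℝ≥0 => (μ G • Q).map I.restrict)
    (fun I => ?_) fun I => rfl
  rw [Measure.map_map I.measurable_restrict hm]
  refine ext_of_forall_integral_eq_of_IsFiniteMeasure fun f => ?_
  have hfm : Measurable f := f.continuous.measurable
  have hmI : ∀ {σ : Ω → ℝ≥0}, Measurable σ →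
      Measurable fun ω => I.restrict (increments X (σ ω) ω) := fun hσ =>
    I.measurable_restrict.comp (measurable_increments_time hXm' hc hσ)
  -- Right-continuity gives convergence of the increments at finitely many times, so bounded
  -- continuous test functions pass to the limit, while on the grid the integrals do not depend on
  -- `n`.
  have hlim : Tendsto (fun n => ∫ ω, f (I.restrict (increments X (gridAbove n (T ω).untopA) ω))
      ∂(μ.restrict G)) atTop
      (𝓝 (∫ ω, f (I.restrict (increments X (T ω).untopA ω)) ∂(μ.restrict G))) := by
    refine tendsto_integral_of_dominated_convergence (fun _ => ‖f‖) (fun n =>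
      (hfm.comp (hmI (hτn n))).aestronglyMeasurable)
      (integrable_const _) (fun n => Eventually.of_forall fun ω => f.norm_coe_le_norm _)
      (Eventually.of_forall fun ω => ?_)
    refine (f.continuous.tendsto _).comp (tendsto_pi_nhds.2 fun t => ?_)
    have hg : Tendsto (fun n => gridAbove n (T ω).untopA) atTop (𝓝[≥] (T ω).untopA) :=
      (tendsto_gridAbove _).mono_right (nhdsWithin_mono _ Ioi_subset_Ici_self)
    refine Tendsto.sub ?_ ((hc ω _).1.tendsto.comp hg)
    have hg' : Tendsto (fun n => gridAbove n (T ω).untopA + t.1) atTop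
        (𝓝[≥] ((T ω).untopA + t)) := by
      refine tendsto_nhdsWithin_iff.2 ⟨(tendsto_nhds_of_tendsto_nhdsWithin hg).add_const _,
        Eventually.of_forall fun n => ?_⟩
      exact add_le_add_left (lt_gridAbove n _).le _
    exact (hc ω _).1.tendsto.comp hg'
  have hconst : ∀ n, ∫ ω, f (I.restrict (increments X (gridAbove n (T ω).untopA) ω))
      ∂(μ.restrict G) = ∫ y, f y ∂((μ G • Q).map I.restrict) := fun n => by
    rw [← hgrid n, Measure.map_map I.measurable_restrict
      (measurable_increments_time hXm' hc (hτn n))]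
    exact (integral_map (hmI (hτn n)).aemeasurable hfm.aestronglyMeasurable).symm
  simp_rw [hconst] at hlim
  exact (integral_map (hmI hτ).aemeasurable hfm.aestronglyMeasurable).trans
    (tendsto_nhds_unique hlim tendsto_const_nhds)

end

end TaxProcess

namespace TaxProcess

/-! ### The natural tax process of a spectrally negative Lévy process -/

section Levy

variable {Ω : Type*} {mΩ : MeasurableSpace Ω} {X : ℝ≥0 → Ω → ℝ} {P : ℝ × ℝ → Measure Ω}

/-- The process observed from time `q` still has independent increments, with one-dimensional laws
that depend only on their length. Hence a single law `Q` serves all starting points and all times.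
-/
theorem IsSpectrallyNegativeLevyFamily.map_increments (hX : IsSpectrallyNegativeLevyFamily X P)
    {p : ℝ × ℝ} (hp : p.1 ≤ p.2) (q : ℝ≥0) :
    (P p).map (increments X q) = (P 0).map (increments X 0) := by
  have h := hX.levy p hp
  have h' := hX.levy 0 le_rfl
  have := h.isProbabilityMeasure
  have := h'.isProbabilityMeasure
  have hi : HasIndepIncrements (fun t => X (q + t)) (P p) := fun n t ht =>
    h.indepIncrements n (fun i => q + t i) fun i j hij => add_le_add le_rfl (ht hij)
  have hinc : increments (fun t => X (q + t)) 0 = increments X q := by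
    funext ω t
    simp [increments]
  rw [← hinc]
  refine map_increments_eq (fun t => h.measurable _) h'.measurable hi h'.indepIncrements
    fun s t hst => ?_
  obtain ⟨r, rfl⟩ := exists_add_of_le hst
  rw [← add_assoc, h.stationaryIncrements, h'.stationaryIncrements]
  exact hX.law_increment p 0 hp le_rfl r

variable {δ : ℝ≥0 → ℝ}

theorem measurable_taxPair (hδ : IsTaxRate δ) (hc : ∀ ω, IsCadlag fun t => X t ω)
    (hJ : ∀ ω, NoPositiveJumps fun t => X t ω) {p : ℝ × ℝ} (hp : 0 ≤ p.2)
    {mF : MeasurableSpace Ω} {t : ℝ≥0} (hX : ∀ s ≤ t, Measurable (X s)) {σ : Ω → ℝ≥0}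
    (hσ : Measurable σ) (hσt : ∀ ω, σ ω ≤ t) : Measurable fun ω => taxPair δ X p (σ ω) ω := by
  simp_rw [fun ω => taxPair_eq hδ hp hc hJ (σ ω) ω]
  exact measurable_taxPath hδ (m := fun _ => p.2) measurable_const (fun _ => hp)
    (measurableUpTo_restartedPath hc hX)
    (fun ω => (isInputPath_restartedPath hp hc hJ ω).cadlag) hσ hσt

theorem taxPair_mem_stateSpace (hδ : IsTaxRate δ) (hc : ∀ ω, IsCadlag fun t => X t ω)
    (hJ : ∀ ω, NoPositiveJumps fun t => X t ω) {p : ℝ × ℝ} (hp : 0 ≤ p.2) (t : ℝ≥0) (ω : Ω) :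
    taxPair δ X p t ω ∈ stateSpace := by
  rw [taxPair_eq hδ hp hc hJ]
  exact max_le (taxPath_fst_le_snd hδ hp (isInputPath_restartedPath hp hc hJ ω) t)
    (hp.trans (hδ.level_le_taxFlow hp _))

/-- The law of the process started from `z`, in terms of the law of the increments. -/
theorem measure_taxPair_mem (hδ : IsTaxRate δ) (hX : IsSpectrallyNegativeLevyFamily X P)
    {B : Set (ℝ≥0 → ℝ × ℝ)} {B' : Set ((ℝ × ℝ) × (ℝ≥0 → ℝ))} (hB' : MeasurableSet B')
    (h : ∀ z f, 0 ≤ z.2 → IsCadlag f →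
      ((fun t => taxPath δ z.2 (fun s => z.1 + f s) t) ∈ B ↔ (z, f) ∈ B'))
    {z : ℝ × ℝ} (hz : z ∈ stateSpace) :
    P z {ω | (fun t => taxPair δ X z t ω) ∈ B} =
      (P 0).map (increments X 0) (Prod.mk z ⁻¹' B') := by
  have hz1 : z.1 ≤ z.2 := (le_max_left _ _).trans hz
  have hz2 : 0 ≤ z.2 := (le_max_right _ _).trans hz
  have hL := hX.levy z hz1
  rw [← hX.map_increments hz1 0, Measure.map_apply (measurable_increments hL.measurable 0)
    (measurable_prodMk_left hB')]
  refine measure_congr ?_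
  filter_upwards [hX.initial z hz1] with ω hω
  have h0 : X 0 ω ≤ z.2 := hω.trans_le hz1
  have hf : (fun t => taxPair δ X z t ω) =
      fun t => taxPath δ z.2 (fun s => z.1 + increments X 0 ω s) t := by
    funext t
    rw [taxPair_eq_of_le hδ hz2 hL.cadlag hL.noPositiveJumps h0]
    simp [increments, hω]
  have hc : IsCadlag (increments X 0 ω) := by
    change IsCadlag fun t => X (0 + t) ω - X 0 ω
    simpa using (hL.cadlag ω).sub (isCadlag_const (X 0 ω))
  exact propext (by
    change (fun t => taxPair δ X z t ω) ∈ B ↔ (z, increments X 0 ω) ∈ B'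
    rw [hf]
    exact h z _ hz2 hc)

theorem measurableSet_stoppedValue_taxPair (hδ : IsTaxRate δ)
    (hXm : ∀ t, StronglyMeasurable (X t)) (hc : ∀ ω, IsCadlag fun t => X t ω)
    (hJ : ∀ ω, NoPositiveJumps fun t => X t ω) {p : ℝ × ℝ} (hp : 0 ≤ p.2)
    {T : Ω → WithTop ℝ≥0} (hT : IsStoppingTime (Filtration.natural X hXm).rightCont T)
    {C : Set (ℝ × ℝ)} (hC : MeasurableSet C) :
    MeasurableSet[hT.measurableSpace]
      {ω | T ω ≠ ⊤ ∧ stoppedValue (taxPair δ X p) T ω ∈ C} := by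
  have hle : ∀ i : ℝ≥0, MeasurableSet[(Filtration.natural X hXm).rightCont i]
      ({ω | T ω ≠ ⊤ ∧ stoppedValue (taxPair δ X p) T ω ∈ C} ∩ {ω | T ω ≤ i}) := fun i => by
    classical
    -- A random time bounded by `i`, measurable for the σ-algebra at `i`, that agrees with `T` on
    -- `{T ≤ i}`; evaluation at such times is measurable.
    let σ : Ω → ℝ≥0 := fun ω => if T ω ≤ i then (T ω).untopA else 0
    have hσ1 : ∀ ω, T ω ≤ i → σ ω = (T ω).untopA := fun ω h => if_pos h
    have hσ0 : ∀ ω, ¬T ω ≤ i → σ ω = 0 := fun ω h => if_neg h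
    have hσi : ∀ ω, σ ω ≤ i := fun ω => by
      by_cases h : T ω ≤ i
      · rw [hσ1 ω h]
        lift T ω to ℝ≥0 using (h.trans_lt (WithTop.coe_lt_top i)).ne with τ
        exact WithTop.coe_le_coe.1 h
      · rw [hσ0 ω h]
        exact zero_le
    have hσ : Measurable[(Filtration.natural X hXm).rightCont i] σ := by
      refine measurable_of_Iic fun r => ?_
      have : σ ⁻¹' Iic r = {ω | T ω ≤ (min r i : ℝ≥0)} ∪ {ω | T ω ≤ i}ᶜ := by
        ext ω
        simp only [mem_preimage, mem_Iic, mem_union, mem_ofPred_eq, mem_compl_iff]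
        by_cases h : T ω ≤ i
        · simp only [hσ1 ω h, h, not_true, or_false]
          lift T ω to ℝ≥0 using (h.trans_lt (WithTop.coe_lt_top i)).ne with τ
          rw [show (τ : WithTop ℝ≥0).untopA = τ from rfl, WithTop.coe_le_coe, le_min_iff,
            and_iff_left (WithTop.coe_le_coe.1 h)]
        · simp only [hσ0 ω h, h, not_false_iff, or_true, zero_le]
      rw [this]
      exact ((Filtration.natural X hXm).rightCont.mono (min_le_right r i) _
        (hT (min r i))).union (hT i).compl
    have hset : {ω | T ω ≠ ⊤ ∧ stoppedValue (taxPair δ X p) T ω ∈ C} ∩ {ω | T ω ≤ i} =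
        {ω | T ω ≤ i} ∩ (fun ω => taxPair δ X p (σ ω) ω) ⁻¹' C := by
      ext ω
      simp only [mem_inter_iff, mem_ofPred_eq, mem_preimage, stoppedValue]
      constructor
      · rintro ⟨⟨-, hω⟩, h⟩
        exact ⟨h, by rwa [hσ1 ω h]⟩
      · rintro ⟨h, hω⟩
        exact ⟨⟨(h.trans_lt (WithTop.coe_lt_top i)).ne, by rwa [← hσ1 ω h]⟩, h⟩
    rw [hset]
    refine (hT i).inter (measurable_taxPair hδ hc hJ hp (fun s hs => ?_) hσ hσi hC)
    exact ((Filtration.stronglyAdapted_natural hXm s).measurable.mono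
      ((Filtration.natural X hXm).mono hs) le_rfl).mono
        ((Filtration.natural X hXm).le_rightCont i) le_rfl
  refine ⟨?_, hle⟩
  have hset : {ω | T ω ≠ ⊤ ∧ stoppedValue (taxPair δ X p) T ω ∈ C} = ⋃ n : ℕ,
      {ω | T ω ≠ ⊤ ∧ stoppedValue (taxPair δ X p) T ω ∈ C} ∩ {ω | T ω ≤ (n : ℝ≥0)} := by
    rw [← inter_iUnion, eq_comm, inter_eq_left]
    rintro ω ⟨h, -⟩
    lift T ω to ℝ≥0 using h with τ hτ
    obtain ⟨n, hn⟩ := exists_nat_ge τ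
    exact mem_iUnion.2 ⟨n, by rw [mem_ofPred_eq, ← hτ]; exact WithTop.coe_le_coe.2 hn⟩
  rw [hset]
  exact MeasurableSet.iUnion fun n =>
    le_iSup (fun i => (Filtration.natural X hXm).rightCont i) (n : ℝ≥0) _ (hle n)

theorem measurable_stoppedValue_taxPair (hδ : IsTaxRate δ) (hXm : ∀ t, Measurable (X t))
    (hc : ∀ ω, IsCadlag fun t => X t ω) (hJ : ∀ ω, NoPositiveJumps fun t => X t ω) {p : ℝ × ℝ}
    (hp : 0 ≤ p.2) {T : Ω → WithTop ℝ≥0} (hT : Measurable T) :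
    Measurable (stoppedValue (taxPair δ X p) T) := by
  refine measurable_of_tendsto_metrizable
    (f := fun (n : ℕ) ω => taxPair δ X p (min (T ω).untopA n) ω) (fun n =>
      measurable_taxPair hδ hc hJ hp (t := n) (fun s _ => hXm s) (hT.untopA.min measurable_const)
        fun ω => min_le_right _ _) (tendsto_pi_nhds.2 fun ω => ?_)
  refine tendsto_const_nhds.congr' ?_
  filter_upwards [eventually_ge_atTop ⌈(T ω).untopA⌉₊] with n hn
  rw [min_eq_left ((Nat.le_ceil _).trans (Nat.cast_le.2 hn)), stoppedValue]

/-- The state at a stopping time and the increments after it are independent. -/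
theorem map_restrict_stoppedValue_increments (hδ : IsTaxRate δ)
    (hXm : ∀ t, StronglyMeasurable (X t)) (hX : IsSpectrallyNegativeLevyFamily X P)
    {p : ℝ × ℝ} (hp : p ∈ stateSpace) {T : Ω → WithTop ℝ≥0}
    (hT : IsStoppingTime (Filtration.natural X hXm).rightCont T) {G : Set Ω}
    (hG : MeasurableSet[hT.measurableSpace] G) (hGT : ∀ ω ∈ G, T ω ≠ ⊤) :
    ((P p).restrict G).map
      (fun ω => (stoppedValue (taxPair δ X p) T ω, increments X (T ω).untopA ω)) =
    (((P p).restrict G).map (stoppedValue (taxPair δ X p) T)).prod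
      ((P 0).map (increments X 0)) := by
  have hp1 : p.1 ≤ p.2 := (le_max_left _ _).trans hp
  have hp2 : 0 ≤ p.2 := (le_max_right _ _).trans hp
  have hL := hX.levy p hp1
  have := hL.isProbabilityMeasure
  have := (hX.levy 0 le_rfl).isProbabilityMeasure
  have hZ := measurable_stoppedValue_taxPair hδ hL.measurable hL.cadlag hL.noPositiveJumps hp2
    hT.measurable'
  have hI := measurable_increments_time hL.measurable hL.cadlag hT.measurable'.untopA
  refine (Measure.prod_eq fun C A hC hA => ?_).symm
  -- Constraining the state at `T` leaves an event prior to `T`, so the independence of later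
  -- increments applies to it and gives the product formula on rectangles.
  have hGC : MeasurableSet[hT.measurableSpace] (G ∩ stoppedValue (taxPair δ X p) T ⁻¹' C) := by
    have : G ∩ stoppedValue (taxPair δ X p) T ⁻¹' C =
        G ∩ {ω | T ω ≠ ⊤ ∧ stoppedValue (taxPair δ X p) T ω ∈ C} := by
      ext ω
      exact ⟨fun h => ⟨h.1, hGT ω h.1, h.2⟩, fun h => ⟨h.1, h.2.2⟩⟩
    rw [this]
    exact hG.inter (measurableSet_stoppedValue_taxPair hδ hXm hL.cadlag hL.noPositiveJumps hp2
      hT hC)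
  have h := congrArg (· A) (map_restrict_increments hXm hL.cadlag hL.indepIncrements
    (hX.initial p hp1) (hX.map_increments hp1) hT hGC fun ω hω => hGT ω hω.1)
  simp only [Measure.map_apply hI hA, Measure.restrict_apply (hI hA), Measure.smul_apply,
    smul_eq_mul] at h
  rw [Measure.map_apply (hZ.prodMk hI) (hC.prod hA),
    Measure.restrict_apply ((hZ.prodMk hI) (hC.prod hA)), Measure.map_apply hZ hC,
    Measure.restrict_apply (hZ hC), inter_comm (_ ⁻¹' C) G, ← h]
  congr 1
  ext ω
  simp only [mem_inter_iff, mem_preimage, mem_prod]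
  tauto

/-- The natural tax process and its running supremum form a strong Markov process. -/
theorem isStrongMarkov_taxPair (hδ : IsTaxRate δ) (hXm : ∀ t, StronglyMeasurable (X t))
    (hX : IsSpectrallyNegativeLevyFamily X P) :
    IsStrongMarkov (Filtration.natural X hXm).rightCont stateSpace (taxPair δ X) P := by
  have hL := fun p hp => hX.levy p ((le_max_left _ _).trans (show p ∈ stateSpace from hp))
  have hp2 : ∀ p ∈ stateSpace, 0 ≤ p.2 := fun p hp => (le_max_right _ _).trans hp
  have hc := (hX.levy 0 le_rfl).cadlag
  have hJ := (hX.levy 0 le_rfl).noPositiveJumps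
  have := (hX.levy 0 le_rfl).isProbabilityMeasure
  have hXm' := fun t => (hXm t).measurable
  refine
    { mem_state := fun p hp t ω => taxPair_mem_stateSpace hδ hc hJ (hp2 p hp) t ω
      adapted := fun p hp t => ?_
      initial := fun p hp => ?_
      measurable_law := fun B hB => ?_
      measurable_stopped := fun p hp T hT C hC =>
        measurableSet_stoppedValue_taxPair hδ hXm hc hJ (hp2 p hp) hT hC
      strong_markov := fun p hp T hT G hG hGT B hB => ?_ }
  · refine measurable_taxPair hδ hc hJ (hp2 p hp) (fun s hs => ?_) measurable_const
      fun _ => le_rfl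
    exact ((Filtration.stronglyAdapted_natural hXm s).measurable.mono
      ((Filtration.natural X hXm).mono hs) le_rfl).mono
        ((Filtration.natural X hXm).le_rightCont t) le_rfl
  · have hp1 : p.1 ≤ p.2 := (le_max_left _ _).trans hp
    filter_upwards [hX.initial p hp1] with ω hω
    rw [taxPair_eq_of_le hδ (hp2 p hp) hc hJ (hω.trans_le hp1),
      taxPath_zero hδ (hp2 p hp) ⟨hc ω, hJ ω, hω.trans_le hp1⟩, hω]
  · obtain ⟨B', hB', h⟩ := exists_measurableSet_taxPath hδ hB
    simp_rw [fun p : stateSpace => measure_taxPair_mem hδ hX hB' h p.2]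
    exact (measurable_measure_prodMk_left hB').comp measurable_subtype_coe
  · obtain ⟨B', hB', h⟩ := exists_measurableSet_taxPath hδ hB
    have hp1 : p.1 ≤ p.2 := (le_max_left _ _).trans hp
    have hG' : MeasurableSet G := hT.measurableSpace_le _ hG
    have hZ := measurable_stoppedValue_taxPair hδ hXm' hc hJ (hp2 p hp) hT.measurable'
    have hI := measurable_increments_time hXm' hc hT.measurable'.untopA
    have hZE : ∀ ω, stoppedValue (taxPair δ X p) T ω ∈ stateSpace := fun ω =>
      taxPair_mem_stateSpace hδ hc hJ (hp2 p hp) _ ω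
    simp_rw [fun ω => measure_taxPair_mem hδ hX hB' h (hZE ω)]
    -- The right side is the mass of `B'` under a product measure, which is the joint law of the
    -- state at `T` and the increments after it. The pathwise restart identity then matches the two
    -- events almost surely.
    rw [← lintegral_map (measurable_measure_prodMk_left hB') hZ, ← Measure.prod_apply hB',
      ← map_restrict_stoppedValue_increments hδ hXm hX hp hT hG hGT,
      Measure.map_apply (hZ.prodMk hI) hB', Measure.restrict_apply ((hZ.prodMk hI) hB'),
      inter_comm]
    refine measure_congr ?_
    filter_upwards [hX.initial p hp1] with ω hω
    have h0 : X 0 ω ≤ p.2 := hω.trans_le hp1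
    have hpath := fun t => taxPair_eq_of_le hδ (hp2 p hp) hc hJ h0 t
    have hshift := fun t => taxPath_shift hδ (hp2 p hp) ⟨hc ω, hJ ω, h0⟩ (T ω).untopA t
    have hcI : IsCadlag (increments X (T ω).untopA ω) :=
      ((show IsInputPath p.2 fun t => X t ω from ⟨hc ω, hJ ω, h0⟩).shift (T ω).untopA
        (c := -X (T ω).untopA ω) (m' := 0) (by simp)).cadlag
    have hmem := h _ _ (hp2 _ (hZE ω)) hcI
    refine propext (and_congr ?_ Iff.rfl)
    refine Iff.trans ?_ hmem
    simp only [stoppedValue, hpath, increments]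
    change (fun t => taxPair δ X p ((T ω).untopA + t) ω) ∈ B ↔ _
    simp only [hpath, hshift]

end Levy

end TaxProcess

theorem mainTheorem5 {Ω : Type*} [mΩ : MeasurableSpace Ω]
    (X : ℝ≥0 → Ω → ℝ) (hXm : ∀ t, StronglyMeasurable (X t))
    (P : ℝ × ℝ → Measure Ω) (hX : TaxProcess.IsSpectrallyNegativeLevyFamily X P)
    (δ : ℝ≥0 → ℝ) (hδ : TaxProcess.IsTaxRate δ) :
    -- the transform defining the process exists and is unique
    (∀ m : ℝ, 0 ≤ m → ∀ ω, X 0 ω ≤ m →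
      ∃! VK : (ℝ≥0 → ℝ) × (ℝ≥0 → ℝ),
        TaxProcess.IsTaxReflection δ m (fun t => X t ω) VK.1 VK.2) ∧
    -- `(V, K)` is adapted to the natural filtration of `X`
    (∀ m : ℝ, 0 ≤ m → ∀ t,
      Measurable[Filtration.natural X hXm t] (TaxProcess.taxProcess δ X m t) ∧
      Measurable[Filtration.natural X hXm t] (TaxProcess.bailout δ X m t)) ∧
    -- `(V, V̄)` is strong Markov in the right-continuous filtration
    TaxProcess.IsStrongMarkov (Filtration.natural X hXm).rightCont TaxProcess.stateSpace
      (TaxProcess.taxPair δ X) P := by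
  have hc := (hX.levy 0 le_rfl).cadlag
  have hJ := (hX.levy 0 le_rfl).noPositiveJumps
  refine ⟨fun m hm ω h0 => TaxProcess.existsUnique_isTaxReflection hδ hm (hc ω) (hJ ω) h0,
    fun m hm t => ?_, TaxProcess.isStrongMarkov_taxPair hδ hXm hX⟩
  have hXt : ∀ s ≤ t, Measurable[Filtration.natural X hXm t] (X s) := fun s hs =>
    (Filtration.stronglyAdapted_natural hXm s).measurable.mono
      ((Filtration.natural X hXm).mono hs) le_rfl
  have hY := TaxProcess.measurableUpTo_restartedPath (m := m)
    (mF := Filtration.natural X hXm t) hc hXt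
  have hcY := fun ω => (TaxProcess.isInputPath_restartedPath hm hc hJ ω).cadlag
  have heq := fun ω => TaxProcess.bailout_taxProcess_eq hδ hm hc hJ t ω
  refine ⟨?_, ?_⟩
  · rw [funext fun ω => (heq ω).2]
    exact measurable_fst.comp (TaxProcess.measurable_taxPath hδ (m := fun _ => m)
      measurable_const (fun _ => hm) hY hcY (σ := fun _ => t) measurable_const fun _ => le_rfl)
  · rw [funext fun ω => (heq ω).1]
    exact TaxProcess.measurableUpTo_bailoutPath hδ (m := fun _ => m) measurable_const
      (fun _ => hm) hY hcY (fun _ => t) measurable_const fun _ => le_rfl
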